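/- **Conventions.** Let $\mathsf{D}(\mathsf{Ab})$ be the derived category of abelian groups and let $\mathsf{DAb}_{\le 0}\subset \mathsf{D}(\mathsf{Ab})$ be the full subcategory of the objects whose homology is concentrated in nonnegative homological degrees (equivalently, in cohomological degrees $\le 0$). The shift $C\mapsto C[n]$ raises homological degrees by $n$, so that $H_{i+n}(C[n])=H_i(C)$. For an arbitrary (not necessarily additive) functor $F:\mathsf{Ab}\to\mathsf{Ab}$, the (Dold--Puppe) derived functor $LF:\mathsf{DAb}_{\le 0}\to \mathsf{D}(\mathsf{Ab})$ is $LF(C)=N(F(K(P)))$, where $P\to C$ is a resolution by a nonnegatively graded chain complex of projective (that is, free) abelian groups, $K$ is the inverse of the Dold--Kan normalization functor $N$ from simplicial abelian groups to nonnegatively graded chain complexes, and $F$ is applied in each simplicial degree. For an abelian group $A$ and $n\ge 0$, let $\mathscr L^n(A)$ be the degree $n$ component $\mathscr L(A)\cap A^{\otimes n}$ of the Lie subring $\mathscr L(A)$ generated by $A$ in the tensor ring $\bigoplus_{n\ge 0} A^{\otimes n}$ with bracket $[a,b]=ab-ba$. A *graded Lie ring with squares* is a graded abelian group $B=\bigoplus_{i\ge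 0}B_i$ with bilinear brackets $\{\ ,\ \}:B_i\times B_j\to B_{i+j}$ and maps ${}^{[2]}:B_i\to B_{2i}$ for $i$ odd such that, for all $x\in B_i$, $y\in B_j$, $z\in B_k$, 1. $\{x,y\}+(-1)^{ij}\{y,x\}=0$; 2. $\{x,x\}=0$ if $i$ is even; 3. $(-1)^{ik}\{\{x,y\},z\}+(-1)^{ji}\{\{y,z\},x\}+(-1)^{kj}\{\{z,x\},y\}=0$; 4. $\{\{x,x\},x\}=0$; 5. $(ax)^{[2]}=a^2x^{[2]}$ for $a\in\mathbb Z$ and $i$ odd; 6. $(x+y)^{[2]}=x^{[2]}+y^{[2]}+\{x,y\}$ if $i=j$ is odd; 7. $\{y,x^{[2]}\}=\{\{y,x\},x\}$ if $i$ is odd. Let $\mathscr L_s^n(A)$ be the degree $n$ component of the graded Lie ring with squares freely generated by $A$ in degree $1$: it comes with a homomorphism from $A$ to its degree $1$ component, and it is universal among graded Lie rings with squares $B$ with a homomorphism $A\to B_1$. Both $\mathscr L^n$ and $\mathscr L^n_s$ are functors $\mathsf{Ab}\to\mathsf{Ab}$. **Theorem (Décalage).** For every prime $p$, there is an isomorphism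 in $\mathsf{D}(\mathsf{Ab})$, natural in $C\in\mathsf{DAb}_{\le 0}$, $$L\mathscr L^p(C[1])\;\cong\; L\mathscr L_s^p(C)[p],$$ that is, the functors $C\mapsto L\mathscr L^p(C[1])$ and $C\mapsto L\mathscr L_s^p(C)[p]$ from $\mathsf{DAb}_{\le 0}$ to $\mathsf{D}(\mathsf{Ab})$ are naturally isomorphic. -/

import Mathlib

open CategoryTheory CategoryTheory.Limits Opposite

universe w u v

namespace LieDecalage

/-- The category of abelian groups. -/
abbrev Ab : Type (u + 1) := ModuleCat.{u} ℤ

section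

attribute [local instance] LieRing.ofAssociativeRing

/-- The degree `n` component of the Lie subring generated by `A` in the tensor ring of `A`,
the bracket being the commutator `a * b - b * a`. -/
noncomputable def lieComponent (n : ℕ) (A : Type u) [AddCommGroup A] [Module ℤ A] :
    Submodule ℤ (TensorAlgebra ℤ A) :=
  (LieSubalgebra.lieSpan ℤ (TensorAlgebra ℤ A) (Set.range (TensorAlgebra.ι ℤ))).toSubmodule ⊓
    LinearMap.range (TensorAlgebra.ι ℤ (M := A)) ^ n

/-- The functoriality of the tensor ring. -/
noncomputable def tensorMap {A B : Type u} [AddCommGroup A] [Module ℤ A] [AddCommGroup B]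
    [Module ℤ B] (f : A →ₗ[ℤ] B) : TensorAlgebra ℤ A →ₐ[ℤ] TensorAlgebra ℤ B :=
  TensorAlgebra.lift ℤ (TensorAlgebra.ι ℤ ∘ₗ f)

lemma tensorMap_ι {A B : Type u} [AddCommGroup A] [Module ℤ A] [AddCommGroup B]
    [Module ℤ B] (f : A →ₗ[ℤ] B) (a : A) :
    tensorMap f (TensorAlgebra.ι ℤ a) = TensorAlgebra.ι ℤ (f a) := by
  exact TensorAlgebra.lift_ι_apply _ _

lemma lieComponent_map (n : ℕ) {A B : Type u} [AddCommGroup A] [Module ℤ A] [AddCommGroup B]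
    [Module ℤ B] (f : A →ₗ[ℤ] B) (x : TensorAlgebra ℤ A) (hx : x ∈ lieComponent n A) :
    tensorMap f x ∈ lieComponent n B := by
  obtain ⟨h1, h2⟩ := hx
  refine ⟨?_, ?_⟩
  · have h : LieSubalgebra.lieSpan ℤ (TensorAlgebra ℤ A) (Set.range (TensorAlgebra.ι ℤ)) ≤
        (LieSubalgebra.lieSpan ℤ (TensorAlgebra ℤ B) (Set.range (TensorAlgebra.ι ℤ))).comap
          (AlgHom.toLieHom (tensorMap f)) := by
      rw [LieSubalgebra.lieSpan_le]
      rintro _ ⟨a, rfl⟩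
      exact LieSubalgebra.subset_lieSpan ⟨f a, (tensorMap_ι f a).symm⟩
    exact h h1
  · have h : (LinearMap.range (TensorAlgebra.ι ℤ (M := A))).map
        (tensorMap f).toLinearMap ≤ LinearMap.range (TensorAlgebra.ι ℤ (M := B)) := by
      rintro _ ⟨_, ⟨a, rfl⟩, rfl⟩
      exact ⟨f a, (tensorMap_ι f a).symm⟩
    have h3 : tensorMap f x ∈ (LinearMap.range (TensorAlgebra.ι ℤ (M := A)) ^ n).map
        (tensorMap f).toLinearMap := ⟨x, h2, rfl⟩
    rw [Submodule.map_pow] at h3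
    exact pow_le_pow_left' h n h3

end

/-- The `n`th Lie functor. -/
noncomputable def lieFunctor (n : ℕ) : Ab.{u} ⥤ Ab.{u} where
  obj A := ModuleCat.of ℤ (lieComponent n A)
  map f := ModuleCat.ofHom
    ((tensorMap f.hom).toLinearMap.restrict (lieComponent_map n f.hom))
  map_id A := by
    have h : tensorMap (ModuleCat.Hom.hom (𝟙 A)) = AlgHom.id ℤ (TensorAlgebra ℤ A) := by
      apply TensorAlgebra.hom_ext
      ext a
      exact tensorMap_ι _ a
    ext x
    exact DFunLike.congr_fun h x.1
  map_comp f g := by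
    have h : tensorMap (ModuleCat.Hom.hom (f ≫ g)) =
        (tensorMap g.hom).comp (tensorMap f.hom) := by
      apply TensorAlgebra.hom_ext
      ext a
      exact (tensorMap_ι _ a).trans (((congrArg (tensorMap g.hom) (tensorMap_ι f.hom a)).trans
        (tensorMap_ι g.hom (f.hom a))).symm)
    ext x
    exact DFunLike.congr_fun h x.1

/-- A graded Lie ring with squares: a graded abelian group `B` with bilinear brackets
`B i × B j → B (i + j)` and with squaring operations `B i → B (2 i)` for `i` odd. -/
class GLRS (B : ℕ → Type v) [∀ n, AddCommGroup (B n)] where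
  /-- the bracket -/
  br {i j k : ℕ} (h : i + j = k) : B i →+ B j →+ B k
  /-- the square of an element of odd degree -/
  sq {i k : ℕ} (hi : Odd i) (h : i + i = k) : B i → B k
  br_comm {i j k : ℕ} (h : i + j = k) (h' : j + i = k) (x : B i) (y : B j) :
    br h x y + (-1 : ℤ) ^ (i * j) • br h' y x = 0
  br_self {i k : ℕ} (hi : Even i) (h : i + i = k) (x : B i) : br h x x = 0
  jacobi {i j k a b c n : ℕ} (hij : i + j = a) (hjk : j + k = b) (hki : k + i = c)
    (ha : a + k = n) (hb : b + i = n) (hc : c + j = n) (x : B i) (y : B j) (z : B k) :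
    (-1 : ℤ) ^ (i * k) • br ha (br hij x y) z + (-1 : ℤ) ^ (j * i) • br hb (br hjk y z) x +
      (-1 : ℤ) ^ (k * j) • br hc (br hki z x) y = 0
  br_br_self {i j k : ℕ} (h : i + i = j) (h' : j + i = k) (x : B i) : br h' (br h x x) x = 0
  sq_smul {i k : ℕ} (hi : Odd i) (h : i + i = k) (a : ℤ) (x : B i) :
    sq hi h (a • x) = a ^ 2 • sq hi h x
  sq_add {i k : ℕ} (hi : Odd i) (h : i + i = k) (x y : B i) :
    sq hi h (x + y) = sq hi h x + sq hi h y + br h x y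
  br_sq {i j a b n : ℕ} (hi : Odd i) (h : i + i = a) (ha : j + a = n) (hb : j + i = b)
    (hn : b + i = n) (x : B i) (y : B j) : br ha y (sq hi h x) = br hn (br hb y x) x

/-- Homomorphisms of graded Lie rings with squares. -/
@[ext]
structure GLRSHom (B : ℕ → Type v) (C : ℕ → Type w) [∀ n, AddCommGroup (B n)]
    [∀ n, AddCommGroup (C n)] [GLRS B] [GLRS C] where
  /-- the components of the homomorphism -/
  app (n : ℕ) : B n →+ C n
  map_br {i j k : ℕ} (h : i + j = k) (x : B i) (y : B j) :
    app k (GLRS.br h x y) = GLRS.br h (app i x) (app j y)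
  map_sq {i k : ℕ} (hi : Odd i) (h : i + i = k) (x : B i) :
    app k (GLRS.sq hi h x) = GLRS.sq hi h (app i x)

/-- Formal expressions in elements of `A`, which are given the degree `1`. -/
inductive Expr (A : Type u) : ℕ → Type u where
  | of (a : A) : Expr A 1
  | zero (n : ℕ) : Expr A n
  | add {n : ℕ} (x y : Expr A n) : Expr A n
  | smul {n : ℕ} (a : ℤ) (x : Expr A n) : Expr A n
  | br {i j k : ℕ} (h : i + j = k) (x : Expr A i) (y : Expr A j) : Expr A k
  | sq {i k : ℕ} (hi : Odd i) (h : i + i = k) (x : Expr A i) : Expr A k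

namespace Expr

/-- The smallest congruence for which the quotient is a graded Lie ring with squares, and
for which `of` is additive. -/
inductive Rel (A : Type u) [AddCommGroup A] : ∀ {n : ℕ}, Expr A n → Expr A n → Prop where
  | refl {n : ℕ} (x : Expr A n) : Rel A x x
  | symm {n : ℕ} {x y : Expr A n} : Rel A x y → Rel A y x
  | trans {n : ℕ} {x y z : Expr A n} : Rel A x y → Rel A y z → Rel A x z
  | congr_add {n : ℕ} {x x' y y' : Expr A n} :
      Rel A x x' → Rel A y y' → Rel A (add x y) (add x' y')
  | congr_smul {n : ℕ} (a : ℤ) {x x' : Expr A n} : Rel A x x' → Rel A (smul a x) (smul a x')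
  | congr_br {i j k : ℕ} (h : i + j = k) {x x' : Expr A i} {y y' : Expr A j} :
      Rel A x x' → Rel A y y' → Rel A (br h x y) (br h x' y')
  | congr_sq {i k : ℕ} (hi : Odd i) (h : i + i = k) {x x' : Expr A i} :
      Rel A x x' → Rel A (sq hi h x) (sq hi h x')
  | add_assoc {n : ℕ} (x y z : Expr A n) : Rel A (add (add x y) z) (add x (add y z))
  | add_comm {n : ℕ} (x y : Expr A n) : Rel A (add x y) (add y x)
  | zero_add {n : ℕ} (x : Expr A n) : Rel A (add (zero n) x) x
  | zero_smul {n : ℕ} (x : Expr A n) : Rel A (smul 0 x) (zero n)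
  | one_smul {n : ℕ} (x : Expr A n) : Rel A (smul 1 x) x
  | add_smul {n : ℕ} (a b : ℤ) (x : Expr A n) :
      Rel A (smul (a + b) x) (add (smul a x) (smul b x))
  | of_add (a b : A) : Rel A (of (a + b)) (add (of a) (of b))
  | add_br {i j k : ℕ} (h : i + j = k) (x x' : Expr A i) (y : Expr A j) :
      Rel A (br h (add x x') y) (add (br h x y) (br h x' y))
  | br_add {i j k : ℕ} (h : i + j = k) (x : Expr A i) (y y' : Expr A j) :
      Rel A (br h x (add y y')) (add (br h x y) (br h x y'))
  | br_comm {i j k : ℕ} (h : i + j = k) (h' : j + i = k) (x : Expr A i) (y : Expr A j) :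
      Rel A (add (br h x y) (smul ((-1) ^ (i * j)) (br h' y x))) (zero k)
  | br_self {i k : ℕ} (hi : Even i) (h : i + i = k) (x : Expr A i) : Rel A (br h x x) (zero k)
  | jacobi {i j k a b c n : ℕ} (hij : i + j = a) (hjk : j + k = b) (hki : k + i = c)
      (ha : a + k = n) (hb : b + i = n) (hc : c + j = n)
      (x : Expr A i) (y : Expr A j) (z : Expr A k) :
      Rel A (add (add (smul ((-1) ^ (i * k)) (br ha (br hij x y) z))
        (smul ((-1) ^ (j * i)) (br hb (br hjk y z) x)))
        (smul ((-1) ^ (k * j)) (br hc (br hki z x) y))) (zero n)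
  | br_br_self {i j k : ℕ} (h : i + i = j) (h' : j + i = k) (x : Expr A i) :
      Rel A (br h' (br h x x) x) (zero k)
  | sq_smul {i k : ℕ} (hi : Odd i) (h : i + i = k) (a : ℤ) (x : Expr A i) :
      Rel A (sq hi h (smul a x)) (smul (a ^ 2) (sq hi h x))
  | sq_add {i k : ℕ} (hi : Odd i) (h : i + i = k) (x y : Expr A i) :
      Rel A (sq hi h (add x y)) (add (add (sq hi h x) (sq hi h y)) (br h x y))
  | br_sq {i j a b n : ℕ} (hi : Odd i) (h : i + i = a) (ha : j + a = n) (hb : j + i = b)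
      (hn : b + i = n) (x : Expr A i) (y : Expr A j) :
      Rel A (br ha y (sq hi h x)) (br hn (br hb y x) x)

/-- The congruence as a setoid. -/
def setoid (A : Type u) [AddCommGroup A] (n : ℕ) : Setoid (Expr A n) where
  r := Rel A
  iseqv := ⟨Rel.refl, Rel.symm, Rel.trans⟩

end Expr

/-- The free graded Lie ring with squares generated by `A` in degree `1`. -/
def FreeGLRS (A : Type u) [AddCommGroup A] (n : ℕ) : Type u :=
  Quotient (Expr.setoid A n)

namespace FreeGLRS

variable {A : Type u} [AddCommGroup A]

/-- The class of an expression. -/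
def mk {n : ℕ} (x : Expr A n) : FreeGLRS A n := Quotient.mk (Expr.setoid A n) x

lemma mk_eq {n : ℕ} {x y : Expr A n} (h : Expr.Rel A x y) : mk x = mk y := Quotient.sound h

@[elab_as_elim]
lemma ind {n : ℕ} {P : FreeGLRS A n → Prop} (h : ∀ x, P (mk x)) (x : FreeGLRS A n) : P x :=
  Quotient.ind h x

instance (n : ℕ) : Zero (FreeGLRS A n) := ⟨mk (Expr.zero n)⟩

instance (n : ℕ) : Add (FreeGLRS A n) :=
  ⟨Quotient.map₂ Expr.add fun _ _ h _ _ h' => Expr.Rel.congr_add h h'⟩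

instance (n : ℕ) : SMul ℤ (FreeGLRS A n) :=
  ⟨fun a => Quotient.map (Expr.smul a) fun _ _ h => Expr.Rel.congr_smul a h⟩

lemma mk_add {n : ℕ} (x y : Expr A n) : mk (Expr.add x y) = mk x + mk y := rfl

lemma mk_smul {n : ℕ} (a : ℤ) (x : Expr A n) : mk (Expr.smul a x) = a • mk x := rfl

lemma mk_zero (n : ℕ) : mk (Expr.zero n : Expr A n) = 0 := rfl

protected lemma add_comm' {n : ℕ} (x y : FreeGLRS A n) : x + y = y + x := by
  induction x using ind with | h x =>
  induction y using ind with | h y =>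
  exact mk_eq (Expr.Rel.add_comm x y)

protected lemma zero_add' {n : ℕ} (x : FreeGLRS A n) : 0 + x = x := by
  induction x using ind with | h x =>
  exact mk_eq (Expr.Rel.zero_add x)

protected lemma zero_smul' {n : ℕ} (x : FreeGLRS A n) : (0 : ℤ) • x = 0 := by
  induction x using ind with | h x =>
  exact mk_eq (Expr.Rel.zero_smul x)

protected lemma one_smul' {n : ℕ} (x : FreeGLRS A n) : (1 : ℤ) • x = x := by
  induction x using ind with | h x =>
  exact mk_eq (Expr.Rel.one_smul x)

protected lemma add_smul' {n : ℕ} (a b : ℤ) (x : FreeGLRS A n) :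
    (a + b) • x = a • x + b • x := by
  induction x using ind with | h x =>
  exact mk_eq (Expr.Rel.add_smul a b x)

protected lemma add_assoc' {n : ℕ} (x y z : FreeGLRS A n) : x + y + z = x + (y + z) := by
  induction x using ind with | h x =>
  induction y using ind with | h y =>
  induction z using ind with | h z =>
  exact mk_eq (Expr.Rel.add_assoc x y z)

protected lemma neg_add' {n : ℕ} (x : FreeGLRS A n) : (-1 : ℤ) • x + x = 0 := by
  conv_lhs =>
    rhs
    rw [← FreeGLRS.one_smul' x]
  rw [← FreeGLRS.add_smul', ← FreeGLRS.zero_smul' x]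
  rfl

instance (n : ℕ) : Neg (FreeGLRS A n) := ⟨fun x => (-1 : ℤ) • x⟩

instance (n : ℕ) : AddGroup (FreeGLRS A n) where
  add_assoc := FreeGLRS.add_assoc'
  zero_add := FreeGLRS.zero_add'
  add_zero x := by rw [FreeGLRS.add_comm', FreeGLRS.zero_add']
  nsmul := nsmulRec
  zsmul a x := a • x
  zsmul_zero' := FreeGLRS.zero_smul'
  zsmul_succ' a x := by
    change ((a.succ : ℕ) : ℤ) • x = (a : ℤ) • x + x
    rw [Nat.cast_succ, FreeGLRS.add_smul', FreeGLRS.one_smul']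
  zsmul_neg' a x := by
    change Int.negSucc a • x = (-1 : ℤ) • (((a.succ : ℕ) : ℤ) • x)
    have h1 : Int.negSucc a • x + ((a.succ : ℕ) : ℤ) • x = 0 := by
      rw [← FreeGLRS.add_smul', Int.negSucc_eq, Nat.succ_eq_add_one, Nat.cast_add, Nat.cast_one,
        neg_add_cancel, FreeGLRS.zero_smul']
    have h2 := FreeGLRS.neg_add' (((a.succ : ℕ) : ℤ) • x)
    rw [← FreeGLRS.zero_add' ((-1 : ℤ) • _), ← h1, FreeGLRS.add_assoc',
      FreeGLRS.add_comm' (((a.succ : ℕ) : ℤ) • x), h2, FreeGLRS.add_comm', FreeGLRS.zero_add']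
  neg_add_cancel := FreeGLRS.neg_add'

instance (n : ℕ) : AddCommGroup (FreeGLRS A n) where
  add_comm := FreeGLRS.add_comm'

lemma smul_mk {n : ℕ} (a : ℤ) (x : Expr A n) : a • mk x = mk (Expr.smul a x) := rfl

/-- The inclusion of the generators. -/
def of : A →+ FreeGLRS A 1 :=
  AddMonoidHom.mk' (fun a => mk (Expr.of a)) fun a b => mk_eq (Expr.Rel.of_add a b)

/-- The bracket. -/
def bracket {i j k : ℕ} (h : i + j = k) : FreeGLRS A i →+ FreeGLRS A j →+ FreeGLRS A k :=
  AddMonoidHom.mk' (fun x => AddMonoidHom.mk'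
    (Quotient.map₂ (Expr.br h) (fun _ _ hx _ _ hy => Expr.Rel.congr_br h hx hy) x)
    (fun y y' => by
      induction x using ind with | h x =>
      induction y using ind with | h y =>
      induction y' using ind with | h y' =>
      exact mk_eq (Expr.Rel.br_add h x y y')))
    (fun x x' => by
      ext y
      induction x using ind with | h x =>
      induction x' using ind with | h x' =>
      induction y using ind with | h y =>
      exact mk_eq (Expr.Rel.add_br h x x' y))

/-- The square. -/
def square {i k : ℕ} (hi : Odd i) (h : i + i = k) : FreeGLRS A i → FreeGLRS A k :=
  Quotient.map (Expr.sq hi h) fun _ _ hx => Expr.Rel.congr_sq hi h hx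

instance : GLRS (FreeGLRS A) where
  br := bracket
  sq := square
  br_comm h h' x y := by
    induction x using ind with | h x =>
    induction y using ind with | h y =>
    exact mk_eq (Expr.Rel.br_comm h h' x y)
  br_self hi h x := by
    induction x using ind with | h x =>
    exact mk_eq (Expr.Rel.br_self hi h x)
  jacobi hij hjk hki ha hb hc x y z := by
    induction x using ind with | h x =>
    induction y using ind with | h y =>
    induction z using ind with | h z =>
    exact mk_eq (Expr.Rel.jacobi hij hjk hki ha hb hc x y z)
  br_br_self h h' x := by
    induction x using ind with | h x =>
    exact mk_eq (Expr.Rel.br_br_self h h' x)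
  sq_smul hi h a x := by
    induction x using ind with | h x =>
    exact mk_eq (Expr.Rel.sq_smul hi h a x)
  sq_add hi h x y := by
    induction x using ind with | h x =>
    induction y using ind with | h y =>
    exact mk_eq (Expr.Rel.sq_add hi h x y)
  br_sq hi h ha hb hn x y := by
    induction x using ind with | h x =>
    induction y using ind with | h y =>
    exact mk_eq (Expr.Rel.br_sq hi h ha hb hn x y)

section

variable {B : ℕ → Type v} [∀ n, AddCommGroup (B n)] [GLRS B] (f : A →+ B 1)

/-- The value of an expression. -/
def eval {n : ℕ} (x : Expr A n) : B n :=
  match x with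
  | .of a => f a
  | .zero _ => 0
  | .add x y => eval x + eval y
  | .smul a x => a • eval x
  | .br h x y => GLRS.br h (eval x) (eval y)
  | .sq hi h x => GLRS.sq hi h (eval x)

lemma eval_eq {n : ℕ} {x y : Expr A n} (h : Expr.Rel A x y) : eval f x = eval f y := by
  induction h with
  | refl x => rfl
  | symm _ h => exact h.symm
  | trans _ _ h h' => exact h.trans h'
  | congr_add _ _ h h' => simp only [eval, h, h']
  | congr_smul a _ h => simp only [eval, h]
  | congr_br _ _ _ h h' => simp only [eval, h, h']
  | congr_sq _ _ _ h => simp only [eval, h]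
  | add_assoc x y z => exact add_assoc _ _ _
  | add_comm x y => exact add_comm _ _
  | zero_add x => exact zero_add _
  | zero_smul x => exact zero_smul ℤ _
  | one_smul x => exact one_smul ℤ _
  | add_smul a b x => exact add_smul _ _ _
  | of_add a b => exact map_add f a b
  | add_br h x x' y => simp only [eval, map_add, AddMonoidHom.add_apply]
  | br_add h x y y' => simp only [eval, map_add]
  | br_comm h h' x y => exact GLRS.br_comm h h' _ _
  | br_self hi h x => exact GLRS.br_self hi h _
  | jacobi hij hjk hki ha hb hc x y z => exact GLRS.jacobi hij hjk hki ha hb hc _ _ _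
  | br_br_self h h' x => exact GLRS.br_br_self h h' _
  | sq_smul hi h a x => exact GLRS.sq_smul hi h a _
  | sq_add hi h x y => exact GLRS.sq_add hi h _ _
  | br_sq hi h ha hb hn x y => exact GLRS.br_sq hi h ha hb hn _ _

/-- The homomorphism extending a homomorphism defined on the generators. -/
def lift : GLRSHom (FreeGLRS A) B where
  app n := AddMonoidHom.mk' (Quotient.lift (eval f) fun _ _ h => eval_eq f h) fun x y => by
    induction x using ind with | h x =>
    induction y using ind with | h y =>
    rfl
  map_br h x y := by
    induction x using ind with | h x =>
    induction y using ind with | h y =>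
    rfl
  map_sq hi h x := by
    induction x using ind with | h x =>
    rfl

lemma lift_of (a : A) : (lift f).app 1 (of a) = f a := rfl

lemma hom_ext {φ ψ : GLRSHom (FreeGLRS A) B} (h : ∀ a, φ.app 1 (of a) = ψ.app 1 (of a)) :
    φ = ψ := by
  have key : ∀ {n : ℕ} (x : Expr A n), φ.app n (mk x) = ψ.app n (mk x) := by
    intro n x
    induction x with
    | of a => exact h a
    | zero n => exact (map_zero (φ.app n)).trans (map_zero (ψ.app n)).symm
    | add x y hx hy => rw [mk_add, map_add, map_add, hx, hy]
    | smul a x hx =>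
      have (χ : GLRSHom (FreeGLRS A) B) : χ.app _ (mk (Expr.smul a x)) = a • χ.app _ (mk x) :=
        map_zsmul (χ.app _) a (mk x)
      rw [this, this, hx]
    | br h x y hx hy =>
      have (χ : GLRSHom (FreeGLRS A) B) : χ.app _ (mk (Expr.br h x y)) =
        GLRS.br h (χ.app _ (mk x)) (χ.app _ (mk y)) := χ.map_br h (mk x) (mk y)
      rw [this, this, hx, hy]
    | sq hi h x hx =>
      have (χ : GLRSHom (FreeGLRS A) B) : χ.app _ (mk (Expr.sq hi h x)) =
        GLRS.sq hi h (χ.app _ (mk x)) := χ.map_sq hi h (mk x)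
      rw [this, this, hx]
  ext n x
  induction x using ind with | h x =>
  exact key x

/-- The universal property of the free graded Lie ring with squares. -/
theorem existsUnique_hom : ∃! φ : GLRSHom (FreeGLRS A) B, ∀ a, φ.app 1 (of a) = f a :=
  ⟨lift f, lift_of f, fun _ hφ => hom_ext fun a => hφ a⟩

end

/-- Functoriality of the free graded Lie ring with squares. -/
def map {A B : Type u} [AddCommGroup A] [AddCommGroup B] (f : A →+ B) :
    GLRSHom (FreeGLRS A) (FreeGLRS B) :=
  lift (of.comp f)

end FreeGLRS

/-- The identity homomorphism. -/
def GLRSHom.id (B : ℕ → Type v) [∀ n, AddCommGroup (B n)] [GLRS B] : GLRSHom B B where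
  app n := AddMonoidHom.id (B n)
  map_br _ _ _ := rfl
  map_sq _ _ _ := rfl

/-- The composite of two homomorphisms. -/
def GLRSHom.comp {B C D : ℕ → Type v} [∀ n, AddCommGroup (B n)] [∀ n, AddCommGroup (C n)]
    [∀ n, AddCommGroup (D n)] [GLRS B] [GLRS C] [GLRS D] (ψ : GLRSHom C D) (φ : GLRSHom B C) :
    GLRSHom B D where
  app n := (ψ.app n).comp (φ.app n)
  map_br h x y := by simp [φ.map_br, ψ.map_br]
  map_sq hi h x := by simp [φ.map_sq, ψ.map_sq]

/-- The `n`th super-Lie functor: the degree `n` component of the free graded Lie ring with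
squares generated by an abelian group in degree `1`. -/
def superLieFunctor (n : ℕ) : Ab.{u} ⥤ Ab.{u} where
  obj A := ModuleCat.of ℤ (FreeGLRS A n)
  map f := ModuleCat.ofHom ((FreeGLRS.map f.hom.toAddMonoidHom).app n).toIntLinearMap
  map_id A := by
    have h : FreeGLRS.map (ModuleCat.Hom.hom (𝟙 A)).toAddMonoidHom = GLRSHom.id (FreeGLRS A) :=
      FreeGLRS.hom_ext fun a => rfl
    rw [h]
    rfl
  map_comp {A B C} f g := by
    have h : FreeGLRS.map (ModuleCat.Hom.hom (f ≫ g)).toAddMonoidHom =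
        (FreeGLRS.map g.hom.toAddMonoidHom).comp (FreeGLRS.map f.hom.toAddMonoidHom) :=
      FreeGLRS.hom_ext fun a => rfl
    rw [h]
    rfl

section

open Simplicial

/-- The functor `[n] ↦ [0] * [n] = [n + 1]` on the simplex category. -/
def coneFunctor : SimplexCategory ⥤ SimplexCategory where
  obj n := SimplexCategory.mk (n.len + 1)
  map {m n} f := SimplexCategory.Hom.mk
    ⟨fun i => Fin.cases 0 (fun j => (f.toOrderHom j).succ) i, by
      intro i j h
      induction i using Fin.cases with
      | zero => simp
      | succ i =>
        induction j using Fin.cases with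
        | zero => simp at h
        | succ j =>
          simp only [Fin.cases_succ, Fin.succ_le_succ_iff]
          exact f.toOrderHom.monotone (by simpa using h)⟩
  map_id n := by
    ext i : 3
    induction i using Fin.cases <;> simp
  map_comp f g := by
    ext i : 3
    induction i using Fin.cases <;> rfl

lemma coneFunctor_map_δ {n : ℕ} (i : Fin (n + 2)) :
    coneFunctor.map (SimplexCategory.δ i) = SimplexCategory.δ i.succ := by
  ext j : 3
  induction j using Fin.cases with
  | zero => rfl
  | succ j => exact (Fin.succ_succAbove_succ i j).symm

lemma coneFunctor_map_σ {n : ℕ} (i : Fin (n + 1)) :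
    coneFunctor.map (SimplexCategory.σ i) = SimplexCategory.σ i.succ := by
  ext j : 3
  induction j using Fin.cases with
  | zero => rfl
  | succ j => exact (Fin.succ_predAbove_succ i j).symm

/-- The inclusion `[n] → [0] * [n]`. -/
def coneIncl : 𝟭 SimplexCategory ⟶ coneFunctor where
  app n := SimplexCategory.δ (n := n.len) 0
  naturality m n f := by
    ext j : 3
    rfl

/-- The constant map `[n] → [n + 1]` with value `0`. -/
def constZero (n : ℕ) : ⦋n⦌ ⟶ ⦋n + 1⦌ :=
  SimplexCategory.Hom.mk ⟨fun _ => 0, fun _ _ _ => le_rfl⟩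

/-- The constant map `[n] → [0] * [n]` at the cone point. -/
def coneConst : 𝟭 SimplexCategory ⟶ coneFunctor where
  app n := constZero n.len
  naturality m n f := by
    ext j : 3
    rfl

/-- The map `[n + 1] → [n + 1]` sending `j ≤ i` to `0` and fixing `j > i`. -/
def collapse {n : ℕ} (i : Fin (n + 1)) : ⦋n + 1⦌ ⟶ ⦋n + 1⦌ :=
  SimplexCategory.Hom.mk ⟨fun j => if j ≤ i.castSucc then 0 else j, by
    intro a b h
    dsimp
    split_ifs with h1 h2 h2
    · exact le_rfl
    · exact Fin.zero_le _
    · exact absurd (h.trans h2) h1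
    · exact h⟩

lemma collapse_apply {n : ℕ} (i : Fin (n + 1)) (j : Fin (n + 2)) :
    ((collapse i).toOrderHom j : ℕ) = if (j : ℕ) ≤ i then 0 else (j : ℕ) := by
  change ((if j ≤ i.castSucc then 0 else j : Fin (n + 2)) : ℕ) = _
  simp only [Fin.le_def, Fin.val_castSucc]
  split_ifs <;> simp

lemma δ_apply {n : ℕ} (i : Fin (n + 2)) (j : Fin (n + 1)) :
    ((SimplexCategory.δ i).toOrderHom j : ℕ) = if (j : ℕ) < i then (j : ℕ) else j + 1 := by
  change (i.succAbove j : ℕ) = _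
  simp only [Fin.succAbove, Fin.lt_def, Fin.val_castSucc]
  split_ifs <;> simp

lemma σ_apply {n : ℕ} (i : Fin (n + 1)) (j : Fin (n + 2)) :
    ((SimplexCategory.σ i).toOrderHom j : ℕ) = if (j : ℕ) ≤ i then (j : ℕ) else j - 1 := by
  change (i.predAbove j : ℕ) = _
  simp only [Fin.predAbove, Fin.lt_def, Fin.val_castSucc]
  split_ifs <;> simp <;> omega

lemma hom_ext_val {m n : ℕ} {f g : ⦋m⦌ ⟶ ⦋n⦌}
    (h : ∀ j : Fin (m + 1), (f.toOrderHom j : ℕ) = g.toOrderHom j) : f = g := by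
  ext j : 3
  exact Fin.ext (h j)

lemma comp_apply' {l m n : ℕ} (f : ⦋l⦌ ⟶ ⦋m⦌) (g : ⦋m⦌ ⟶ ⦋n⦌) (j : Fin (l + 1)) :
    (f ≫ g).toOrderHom j = g.toOrderHom (f.toOrderHom j) := rfl

lemma δ_zero_collapse (n : ℕ) :
    SimplexCategory.δ 0 ≫ collapse (0 : Fin (n + 1)) = SimplexCategory.δ 0 := by
  apply hom_ext_val
  intro j
  rw [comp_apply', collapse_apply, δ_apply]
  simp

lemma δ_last_collapse (n : ℕ) :
    SimplexCategory.δ (Fin.last (n + 1)) ≫ collapse (Fin.last n) = constZero n := by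
  apply hom_ext_val
  intro j
  rw [comp_apply', collapse_apply, δ_apply]
  change _ = 0
  simp only [Fin.val_last]
  split_ifs <;> omega

lemma δ_collapse_of_le {n : ℕ} (i : Fin (n + 2)) (j : Fin (n + 1)) (hij : i ≤ j.castSucc) :
    SimplexCategory.δ i.castSucc ≫ collapse j.succ =
      collapse j ≫ SimplexCategory.δ i.succ := by
  apply hom_ext_val
  intro k
  simp only [Fin.le_def, Fin.val_castSucc] at hij
  simp only [comp_apply', collapse_apply, δ_apply, Fin.val_castSucc, Fin.val_succ]
  split_ifs <;> omega

lemma δ_collapse_mid {n : ℕ} (j : Fin (n + 1)) :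
    SimplexCategory.δ j.castSucc.succ ≫ collapse j.succ =
      SimplexCategory.δ j.castSucc.succ ≫ collapse j.castSucc := by
  apply hom_ext_val
  intro k
  simp only [comp_apply', collapse_apply, δ_apply, Fin.val_castSucc, Fin.val_succ]
  split_ifs <;> omega

lemma δ_collapse_of_lt {n : ℕ} (i : Fin (n + 2)) (j : Fin (n + 1)) (hji : j.castSucc < i) :
    SimplexCategory.δ i.succ ≫ collapse j.castSucc =
      collapse j ≫ SimplexCategory.δ i.succ := by
  apply hom_ext_val
  intro k
  simp only [Fin.lt_def, Fin.val_castSucc] at hji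
  simp only [comp_apply', collapse_apply, δ_apply, Fin.val_castSucc, Fin.val_succ]
  split_ifs <;> omega

lemma σ_collapse_of_le {n : ℕ} (i j : Fin (n + 1)) (hij : i ≤ j) :
    SimplexCategory.σ i.castSucc ≫ collapse j =
      collapse j.succ ≫ SimplexCategory.σ i.succ := by
  apply hom_ext_val
  intro k
  simp only [Fin.le_def] at hij
  simp only [comp_apply', collapse_apply, σ_apply, Fin.val_castSucc, Fin.val_succ]
  split_ifs <;> omega

lemma σ_collapse_of_lt {n : ℕ} (i j : Fin (n + 1)) (hji : j ≤ i) :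
    SimplexCategory.σ i.succ ≫ collapse j =
      collapse j.castSucc ≫ SimplexCategory.σ i.succ := by
  apply hom_ext_val
  intro k
  simp only [Fin.le_def] at hji
  simp only [comp_apply', collapse_apply, σ_apply, Fin.val_castSucc, Fin.val_succ]
  split_ifs <;> omega

section

variable {A : Type*} [Category* A]

/-- The décalage (path object) of a simplicial object. -/
def pathObj (Y : SimplicialObject A) : SimplicialObject A := coneFunctor.op ⋙ Y

def pathEval (Y : SimplicialObject A) : pathObj Y ⟶ Y where
  app n := Y.map (coneIncl.app n.unop).op
  naturality m n f := by
    change Y.map _ ≫ Y.map _ = Y.map _ ≫ Y.map _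
    rw [← Y.map_comp, ← Y.map_comp]
    exact congrArg _ <|
      Quiver.Hom.unop_inj (coneIncl.naturality f.unop)

def pathConst (Y : SimplicialObject A) : pathObj Y ⟶ Y where
  app n := Y.map (coneConst.app n.unop).op
  naturality m n f := by
    change Y.map _ ≫ Y.map _ = Y.map _ ≫ Y.map _
    rw [← Y.map_comp, ← Y.map_comp]
    exact congrArg _ <|
      Quiver.Hom.unop_inj (coneConst.naturality f.unop)

lemma pathObj_δ (Y : SimplicialObject A) {n : ℕ} (i : Fin (n + 2)) :
    (pathObj Y).δ i = Y.δ i.succ := by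
  change Y.map (coneFunctor.map (SimplexCategory.δ i)).op = _
  rw [coneFunctor_map_δ]; rfl

lemma pathObj_σ (Y : SimplicialObject A) {n : ℕ} (i : Fin (n + 1)) :
    (pathObj Y).σ i = Y.σ i.succ := by
  change Y.map (coneFunctor.map (SimplexCategory.σ i)).op = _
  rw [coneFunctor_map_σ]; rfl

variable [Preadditive A]

/-- A simplicial homotopy `g ~ g + e` from a family of maps to the path object. -/
def pathHomotopy {X Y : SimplicialObject A} (g e : X ⟶ Y)
    (u : ∀ n : ℕ, X _⦋n⦌ ⟶ Y _⦋n + 1⦌)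
    (hδ : ∀ (n : ℕ) (i : Fin (n + 2)), X.δ i ≫ u n = u (n + 1) ≫ Y.δ i.succ)
    (hσ : ∀ (n : ℕ) (i : Fin (n + 1)), X.σ i ≫ u (n + 1) = u n ≫ Y.σ i.succ)
    (he : ∀ n : ℕ, u n ≫ Y.δ 0 = e.app (op ⦋n⦌))
    (hc : ∀ n : ℕ, u n ≫ Y.map (constZero n).op = 0) :
    SimplicialObject.Homotopy g (g + e) where
  h {n} i := (SimplicialObject.Homotopy.refl g).h i + u n ≫ Y.map (collapse i).op
  h_zero_comp_δ_zero n := by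
    rw [Preadditive.add_comp, SimplicialObject.Homotopy.h_zero_comp_δ_zero, Category.assoc,
      SimplicialObject.δ, ← Y.map_comp, ← op_comp, δ_zero_collapse, ← SimplicialObject.δ_def, he]
    rfl
  h_last_comp_δ_last n := by
    rw [Preadditive.add_comp, SimplicialObject.Homotopy.h_last_comp_δ_last, Category.assoc,
      SimplicialObject.δ, ← Y.map_comp, ← op_comp, δ_last_collapse, hc, add_zero]
  h_succ_comp_δ_castSucc_of_lt {n} i j hij := by
    rw [Preadditive.add_comp, Preadditive.comp_add,
      SimplicialObject.Homotopy.h_succ_comp_δ_castSucc_of_lt _ i j hij, Category.assoc,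
      reassoc_of% (hδ n i)]
    congr 2
    simp only [SimplicialObject.δ, ← Y.map_comp, ← op_comp]
    rw [δ_collapse_of_le i j hij]
  h_succ_comp_δ_castSucc_succ {n} j := by
    rw [Preadditive.add_comp, Preadditive.add_comp,
      SimplicialObject.Homotopy.h_succ_comp_δ_castSucc_succ, Category.assoc, Category.assoc]
    congr 2
    simp only [SimplicialObject.δ, ← Y.map_comp, ← op_comp]
    rw [δ_collapse_mid j]
  h_castSucc_comp_δ_succ_of_lt {n} i j hji := by
    rw [Preadditive.add_comp, Preadditive.comp_add,
      SimplicialObject.Homotopy.h_castSucc_comp_δ_succ_of_lt _ i j hji, Category.assoc,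
      reassoc_of% (hδ n i)]
    congr 2
    simp only [SimplicialObject.δ, ← Y.map_comp, ← op_comp]
    rw [δ_collapse_of_lt i j hji]
  h_comp_σ_castSucc_of_le {n} i j hij := by
    rw [Preadditive.add_comp, Preadditive.comp_add,
      SimplicialObject.Homotopy.h_comp_σ_castSucc_of_le _ i j hij, Category.assoc,
      reassoc_of% (hσ n i)]
    congr 2
    simp only [SimplicialObject.σ, ← Y.map_comp, ← op_comp]
    rw [σ_collapse_of_le i j hij]
  h_comp_σ_succ_of_lt {n} i j hji := by
    rw [Preadditive.add_comp, Preadditive.comp_add,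
      SimplicialObject.Homotopy.h_comp_σ_succ_of_lt _ i j hji, Category.assoc,
      reassoc_of% (hσ n i)]
    congr 2
    simp only [SimplicialObject.σ, ← Y.map_comp, ← op_comp]
    rw [σ_collapse_of_lt i j hji]

end

section

open AlgebraicTopology AlgebraicTopology.DoldKan

variable {A : Type*} [Category* A] [Abelian A]

/-- The inclusion of the normalized complex, in degree `n`. -/
noncomputable def mincl (Y : SimplicialObject A) (n : ℕ) : ((normalizedMooreComplex A).obj Y).X n ⟶ Y _⦋n⦌ :=
  (inclusionOfMooreComplexMap Y).f n

lemma incl_comp_δ (Y : SimplicialObject A) {n : ℕ} (i : Fin (n + 1)) :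
    mincl Y (n + 1) ≫ Y.δ i.succ = 0 :=
  HigherFacesVanish.inclusionOfMooreComplexMap n i (by simp)

lemma incl_comp_δ_zero (Y : SimplicialObject A) (n : ℕ) :
    mincl Y (n + 1) ≫ Y.δ 0 =
      ((normalizedMooreComplex A).obj Y).d (n + 1) n ≫ mincl Y n := by
  change (inclusionOfMooreComplexMap Y).f (n + 1) ≫ Y.δ 0 = _ ≫ (inclusionOfMooreComplexMap Y).f n
  rw [← (inclusionOfMooreComplexMap Y).comm (n + 1) n, alternatingFaceMapComplex_obj_d,
    AlternatingFaceMapComplex.objD, Preadditive.comp_sum, Fin.sum_univ_succ]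
  have (i : Fin (n + 1)) : (inclusionOfMooreComplexMap Y).f (n + 1) ≫ Y.δ i.succ = 0 :=
    incl_comp_δ Y i
  simp only [Preadditive.comp_zsmul, this]
  simp

lemma factors_of_δ (Z : SimplicialObject A) {W : A} (n : ℕ) (x : W ⟶ Z _⦋n + 1⦌)
    (hx : ∀ i : Fin (n + 1), x ≫ Z.δ i.succ = 0) :
    (NormalizedMooreComplex.objX Z (n + 1)).Factors x :=
  (Subobject.finset_inf_factors _).mpr fun i _ => kernelSubobject_factors _ _ (hx i)

lemma exists_lift_zero (Z : SimplicialObject A) {W : A} (x : W ⟶ Z _⦋0⦌) :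
    ∃ l : W ⟶ ((normalizedMooreComplex A).obj Z).X 0, l ≫ mincl Z 0 = x :=
  ⟨Subobject.factorThru (NormalizedMooreComplex.objX Z 0) x (Subobject.top_factors x), by
    rw [mincl, inclusionOfMooreComplexMap_f]; exact Subobject.factorThru_arrow _ _ _⟩

lemma exists_lift_succ (Z : SimplicialObject A) {W : A} (n : ℕ) (x : W ⟶ Z _⦋n + 1⦌)
    (hx : ∀ i : Fin (n + 1), x ≫ Z.δ i.succ = 0) :
    ∃ l : W ⟶ ((normalizedMooreComplex A).obj Z).X (n + 1), l ≫ mincl Z (n + 1) = x :=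
  ⟨Subobject.factorThru (NormalizedMooreComplex.objX Z (n + 1)) x (factors_of_δ Z n x hx), by
    rw [mincl, inclusionOfMooreComplexMap_f]; exact Subobject.factorThru_arrow _ _ _⟩

instance mono_incl_f (Z : SimplicialObject A) (n : ℕ) :
    Mono (mincl Z n) := by
  rw [mincl, inclusionOfMooreComplexMap_f]
  exact inferInstanceAs (Mono (NormalizedMooreComplex.objX Z n).arrow)

variable {X Y : SimplicialObject A} {f g : X ⟶ Y}

/-- The map into the path object associated to a chain homotopy, in degree `n`. -/
noncomputable def pathLift (h : Homotopy ((normalizedMooreComplex A).map f) ((normalizedMooreComplex A).map g))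
    (n : ℕ) : ((normalizedMooreComplex A).obj X).X n ⟶ Y _⦋n + 1⦌ :=
  h.hom n (n + 1) ≫ mincl Y (n + 1) +
    ((normalizedMooreComplex A).obj X).d n (n - 1) ≫ h.hom (n - 1) n ≫
      mincl Y n ≫ Y.σ 0

variable (h : Homotopy ((normalizedMooreComplex A).map f) ((normalizedMooreComplex A).map g))

lemma pathLift_zero :
    pathLift h 0 = h.hom 0 1 ≫ mincl Y 1 := by
  unfold pathLift
  rw [HomologicalComplex.shape _ 0 (0 - 1) (by simp)]
  simp

lemma pathLift_succ (n : ℕ) :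
    pathLift h (n + 1) = h.hom (n + 1) (n + 2) ≫ mincl Y (n + 2) +
      ((normalizedMooreComplex A).obj X).d (n + 1) n ≫ h.hom n (n + 1) ≫
        mincl Y (n + 1) ≫ Y.σ 0 := rfl

lemma pathLift_comp_δ_succ_succ (n : ℕ) (i : Fin (n + 1)) :
    pathLift h (n + 1) ≫ Y.δ i.succ.succ = 0 := by
  have h1 : Y.σ (0 : Fin (n + 2)) ≫ Y.δ i.succ.succ = Y.δ i.succ ≫ Y.σ 0 := by
    have := Y.δ_comp_σ_of_gt (i := i.succ) (j := 0) (by simp [Fin.lt_def])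
    simpa using this
  rw [pathLift_succ, Preadditive.add_comp]
  simp only [Category.assoc]
  rw [h1, incl_comp_δ Y i.succ, reassoc_of% (incl_comp_δ Y i)]
  simp

lemma pathLift_comp_δ_zero (n : ℕ) :
    pathLift h n ≫ Y.δ 0 =
      mincl X n ≫ (f - g).app (op ⦋n⦌) := by
  have h0 : ∀ n, mincl X n ≫ (f - g).app (op ⦋n⦌) =
      (((normalizedMooreComplex A).map f).f n - ((normalizedMooreComplex A).map g).f n) ≫
        mincl Y n := by
    intro n
    have hf := HomologicalComplex.congr_hom ((inclusionOfMooreComplex A).naturality f) n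
    have hg := HomologicalComplex.congr_hom ((inclusionOfMooreComplex A).naturality g) n
    change _ ≫ mincl Y n = mincl X n ≫ f.app (op ⦋n⦌) at hf
    change _ ≫ mincl Y n = mincl X n ≫ g.app (op ⦋n⦌) at hg
    rw [Preadditive.sub_comp, hf, hg, ← Preadditive.comp_sub]
    rfl
  have h2 : Y.σ (0 : Fin (n + 1)) ≫ Y.δ 0 = 𝟙 _ := by
    simpa using Y.δ_comp_σ_self (i := (0 : Fin (n + 1)))
  rw [h0, h.comm n, add_sub_cancel_right]
  cases n with
  | zero =>
    rw [pathLift_zero, Category.assoc, incl_comp_δ_zero, Homotopy.prevD_chainComplex,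
      Homotopy.dNext_zero_chainComplex, Preadditive.add_comp, zero_comp, Category.assoc]
    exact (zero_add _).symm
  | succ n =>
    rw [pathLift_succ, Preadditive.add_comp]
    simp only [Category.assoc]
    rw [incl_comp_δ_zero, h2]
    rw [Homotopy.prevD_chainComplex, Homotopy.dNext_succ_chainComplex, Preadditive.add_comp]
    simp only [Category.assoc, Category.comp_id]
    exact add_comm _ _

lemma pathLift_comp_constZero (n : ℕ) :
    pathLift h n ≫ Y.map (constZero n).op = 0 := by
  have h1 : constZero n = (SimplexCategory.Hom.mk ⟨fun _ => 0, fun _ _ _ => le_rfl⟩ :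
      ⦋n⦌ ⟶ ⦋n⦌) ≫ SimplexCategory.δ (Fin.last (n + 1)) := by
    apply hom_ext_val
    intro j
    rw [comp_apply', δ_apply]
    change 0 = if 0 < n + 1 then 0 else 1
    simp
  rw [h1, op_comp, Y.map_comp, ← SimplicialObject.δ_def, ← Category.assoc]
  have h2 : pathLift h n ≫ Y.δ (Fin.last (n + 1)) = 0 := by
    cases n with
    | zero =>
      rw [pathLift_zero, Category.assoc]
      erw [incl_comp_δ Y (0 : Fin 1)]
      simp
    | succ n => exact pathLift_comp_δ_succ_succ h n (Fin.last n)
  rw [h2, zero_comp]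

lemma pathLift_comp_δ_one (n : ℕ) :
    pathLift h (n + 1) ≫ Y.δ 1 = ((normalizedMooreComplex A).obj X).d (n + 1) n ≫ pathLift h n := by
  have h1 : mincl Y (n + 2) ≫ Y.δ 1 = 0 := incl_comp_δ Y (0 : Fin (n + 2))
  have h2 : Y.σ (0 : Fin (n + 2)) ≫ Y.δ (1 : Fin (n + 3)) = 𝟙 _ :=
    Y.δ_comp_σ_succ (i := (0 : Fin (n + 2)))
  rw [pathLift_succ, Preadditive.add_comp]
  simp only [Category.assoc]
  rw [h1]
  rw [h2]
  rw [Category.comp_id, comp_zero, zero_add]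
  cases n with
  | zero => rw [pathLift_zero]
  | succ n =>
    rw [pathLift_succ, Preadditive.comp_add, HomologicalComplex.d_comp_d_assoc, zero_comp,
      add_zero]

lemma mincl_naturality {Z W : SimplicialObject A} (φ : Z ⟶ W) (n : ℕ) :
    ((normalizedMooreComplex A).map φ).f n ≫ mincl W n = mincl Z n ≫ φ.app (op ⦋n⦌) :=
  HomologicalComplex.congr_hom ((inclusionOfMooreComplex A).naturality φ) n

lemma simplicial_hom_ext {Z W : SimplicialObject A} {φ ψ : Z ⟶ W}
    (H : ∀ n, mincl Z n ≫ φ.app (op ⦋n⦌) = mincl Z n ≫ ψ.app (op ⦋n⦌)) : φ = ψ := by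
  apply (Abelian.DoldKan.equivalence (A := A)).functor.map_injective
  change (normalizedMooreComplex A).map φ = (normalizedMooreComplex A).map ψ
  ext n : 1
  rw [← cancel_mono (mincl W n), mincl_naturality, mincl_naturality, H]

lemma exists_path_map : ∃ u : X ⟶ pathObj Y, ∀ n,
    mincl X n ≫ u.app (op ⦋n⦌) = pathLift h n := by
  have H : ∀ n, ∃ l : ((normalizedMooreComplex A).obj X).X n ⟶
      ((normalizedMooreComplex A).obj (pathObj Y)).X n,
      l ≫ mincl (pathObj Y) n = pathLift h n := by
    intro n
    cases n with
    | zero => exact exists_lift_zero (pathObj Y) (pathLift h 0)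
    | succ n =>
      refine exists_lift_succ (pathObj Y) n (pathLift h (n + 1)) fun i => ?_
      rw [pathObj_δ]
      exact pathLift_comp_δ_succ_succ h n i
  choose l hl using H
  let L : (normalizedMooreComplex A).obj X ⟶ (normalizedMooreComplex A).obj (pathObj Y) :=
    { f := l
      comm' := by
        rintro i j (rfl : j + 1 = i)
        rw [← cancel_mono (mincl (pathObj Y) j), Category.assoc, Category.assoc,
          ← incl_comp_δ_zero, hl, ← Category.assoc, hl, pathObj_δ]
        exact pathLift_comp_δ_one h j }
  obtain ⟨u, hu⟩ := (Abelian.DoldKan.equivalence (A := A)).functor.map_surjective L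
  refine ⟨u, fun n => ?_⟩
  rw [← hl]
  have hu' : ((normalizedMooreComplex A).map u).f n = l n := HomologicalComplex.congr_hom hu n
  rw [← hu']
  exact (mincl_naturality u n).symm

/-- A chain homotopy between normalized complexes comes from a simplicial homotopy. -/
theorem nonempty_simplicial_homotopy
    (h : Homotopy ((normalizedMooreComplex A).map f) ((normalizedMooreComplex A).map g)) :
    Nonempty (SimplicialObject.Homotopy g f) := by
  obtain ⟨u, hu⟩ := exists_path_map h
  let v (n : ℕ) : X _⦋n⦌ ⟶ Y _⦋n + 1⦌ := u.app (op ⦋n⦌)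
  have hv (n : ℕ) : mincl X n ≫ v n = pathLift h n := hu n
  have he : u ≫ pathEval Y = f - g := simplicial_hom_ext fun n => by
    change mincl X n ≫ v n ≫ Y.δ 0 = _
    rw [← Category.assoc, hv n, pathLift_comp_δ_zero h n]
  have hc : u ≫ pathConst Y = 0 := simplicial_hom_ext fun n => by
    change mincl X n ≫ v n ≫ Y.map (constZero n).op = mincl X n ≫ 0
    rw [← Category.assoc, hv n, pathLift_comp_constZero, comp_zero]
  have H := pathHomotopy g (f - g) v
    (fun n i => (u.naturality (SimplexCategory.δ i).op).trans
      (congrArg (fun t => u.app (op ⦋n + 1⦌) ≫ t) (pathObj_δ Y i)))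
    (fun n i => (u.naturality (SimplexCategory.σ i).op).trans
      (congrArg (fun t => u.app (op ⦋n⦌) ≫ t) (pathObj_σ Y i)))
    (fun n => congr_app he (op ⦋n⦌)) (fun n => congr_app hc (op ⦋n⦌))
  rw [add_sub_cancel] at H
  exact ⟨H⟩

end

end

section

variable {C : Type*} [Category* C] [Abelian C]

lemma quasiIso_of_op {K L : CochainComplex C ℤ} (φ : K ⟶ L)
    (h : QuasiIso ((CochainComplex.opEquivalence C).functor.map φ.op)) : QuasiIso φ := by
  rw [quasiIso_iff] at h ⊢
  intro n
  have h1 := h (-n)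
  rw [quasiIsoAt_iff' _ (-n - 1) (-n) (-n + 1) (by simp) (by simp)] at h1
  have h2 : QuasiIsoAt φ (- -n) := by
    rw [quasiIsoAt_iff' _ (-(-n + 1)) (- -n) (-(-n - 1)) (by simp; ring) (by simp; ring)]
    rw [← ShortComplex.quasiIso_opMap_iff]
    exact h1
  rwa [neg_neg] at h2

lemma exists_projective_quasiIso [EnoughProjectives C] (K : CochainComplex C ℤ)
    [K.IsStrictlyLE 0] :
    ∃ (L : CochainComplex C ℤ) (q : L ⟶ K), QuasiIso q ∧ (∀ n, Projective (L.X n)) ∧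
      L.IsStrictlyLE 0 := by
  let K' := (CochainComplex.opEquivalence C).functor.obj (op K)
  have hK' : K'.IsStrictlyGE 0 := by
    rw [CochainComplex.isStrictlyGE_iff]
    intro i hi
    exact (K.isZero_of_isStrictlyLE 0 (-i) (by omega)).op
  obtain ⟨L', i, hi, hL, hL'⟩ := CochainComplex.Plus.modelCategoryQuillen.exists_quasiIso_injective K' 0
  let L₀ := (CochainComplex.opEquivalence C).inverse.obj L'
  let e : (CochainComplex.opEquivalence C).functor.obj L₀ ≅ L' :=
    (CochainComplex.opEquivalence C).counitIso.app L'
  obtain ⟨φ, hφ⟩ := (CochainComplex.opEquivalence C).functor.map_surjective (i ≫ e.inv)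
  refine ⟨L₀.unop, φ.unop, quasiIso_of_op _ ?_, fun n => ?_, ?_⟩
  · change QuasiIso ((CochainComplex.opEquivalence C).functor.map φ)
    rw [hφ]
    infer_instance
  · have : Injective (L'.X (-n)) := hL _
    exact inferInstanceAs (Projective (unop (L'.X (-n))))
  · rw [CochainComplex.isStrictlyLE_iff]
    intro n hn
    exact (L'.isZero_of_isStrictlyGE 0 (-n) (by omega)).unop

lemma exists_extend_iso (L : CochainComplex C ℤ) [L.IsStrictlyLE 0]
    [∀ n, Projective (L.X n)] :
    ∃ P : ChainComplex C ℕ, (∀ n, Projective (P.X n)) ∧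
      Nonempty (P.extend ComplexShape.embeddingDownNat ≅ L) := by
  have : L.IsStrictlySupported ComplexShape.embeddingDownNat := ⟨fun i hi =>
    L.isZero_of_isStrictlyLE 0 i (by
      by_contra! h
      refine hi i.natAbs ?_
      change -(i.natAbs : ℤ) = i
      omega)⟩
  let e : (HomologicalComplex.truncLE' L ComplexShape.embeddingDownNat).extend ComplexShape.embeddingDownNat ≅ L :=
    (HomologicalComplex.truncLEIso L ComplexShape.embeddingDownNat).symm ≪≫ asIso (HomologicalComplex.ιTruncLE L ComplexShape.embeddingDownNat)
  refine ⟨_, fun n => ?_, ⟨e⟩⟩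
  exact Projective.of_iso ((HomologicalComplex.eval C _ (-n : ℤ)).mapIso e.symm ≪≫
    HomologicalComplex.extendXIso _ ComplexShape.embeddingDownNat rfl)
    (inferInstanceAs (Projective (L.X _)))

end

section

lemma eq_conj {D : Type*} [Category* D] {X X' Y Y' : D} {k : X ⟶ Y} {i : X ⟶ X'} {j : Y ⟶ Y'}
    {r : Y' ⟶ Y} {l : X' ⟶ Y'} (h1 : k ≫ j = i ≫ l) (h2 : j ≫ r = 𝟙 Y) : k = i ≫ l ≫ r := by
  rw [← Category.assoc, ← h1, Category.assoc, h2, Category.comp_id]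

open AlgebraicTopology AlgebraicTopology.DoldKan

variable {A : Type*} [Category* A] [Abelian A] {X Y : SimplicialObject A} {f g : X ⟶ Y}

/-- A simplicial homotopy induces a chain homotopy of normalized Moore complexes. -/
lemma nonempty_normalized_homotopy (H : SimplicialObject.Homotopy f g) :
    Nonempty (Homotopy ((normalizedMooreComplex A).map f) ((normalizedMooreComplex A).map g)) := by
  have key (k : X ⟶ Y) : (normalizedMooreComplex A).map k =
      inclusionOfMooreComplexMap X ≫ (alternatingFaceMapComplex A).map k ≫
        PInftyToNormalizedMooreComplex Y :=
    eq_conj ((inclusionOfMooreComplex A).naturality k) (splitMonoInclusionOfMooreComplexMap Y).id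
  rw [key f, key g]
  exact ⟨(H.toChainHomotopy.compRight _).compLeft _⟩

/-- The composite of the inverse of the normalization functor, of `F` applied in each
simplicial degree, and of the normalization functor. -/
noncomputable def doldPuppeComplex (F : A ⥤ A) : ChainComplex A ℕ ⥤ ChainComplex A ℕ :=
  Abelian.DoldKan.Γ ⋙ (SimplicialObject.whiskering A A).obj F ⋙ normalizedMooreComplex A

lemma nonempty_doldPuppe_homotopy (F : A ⥤ A) {K L : ChainComplex A ℕ} {f g : K ⟶ L}
    (h : Homotopy f g) :
    Nonempty (Homotopy ((doldPuppeComplex F).map f) ((doldPuppeComplex F).map g)) := by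
  let ε := (Abelian.DoldKan.equivalence (A := A)).counitIso
  have key (k : K ⟶ L) : (normalizedMooreComplex A).map (Abelian.DoldKan.Γ.map k) =
      ε.hom.app K ≫ k ≫ ε.inv.app L :=
    eq_conj (ε.hom.naturality k) (ε.hom_inv_id_app L)
  have h3 : Homotopy ((normalizedMooreComplex A).map (Abelian.DoldKan.Γ.map g))
      ((normalizedMooreComplex A).map (Abelian.DoldKan.Γ.map f)) := by
    rw [key f, key g]
    exact (h.symm.compRight _).compLeft _
  obtain ⟨H⟩ := nonempty_simplicial_homotopy h3
  exact nonempty_normalized_homotopy (H.whiskerRight F)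

end

/-- The complexes of projective abelian groups in nonnegative homological degrees. -/
def projProp : ObjectProperty (HomotopyCategory Ab.{u} (ComplexShape.down ℕ)) :=
  fun P => ∀ n, Projective (P.as.X n)

/-- The homotopy category of complexes of projective abelian groups in nonnegative homological
degrees. -/
abbrev ProjHtpy := (projProp.{u}).FullSubcategory

section

variable [HasDerivedCategory.{w} Ab.{u}]

open DerivedCategory in
/-- The full subcategory of the derived category consisting of the objects whose homology is
concentrated in nonnegative homological degrees, i.e. in nonpositive cohomological degrees. -/
abbrev ConnectiveDAb : Type (u + 1) := ((TStructure.t (C := Ab.{u})).le 0).FullSubcategory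

open DerivedCategory in
/-- The functor sending a complex of projectives to the corresponding object of the derived
category. -/
noncomputable def projToDAb : ProjHtpy.{u} ⥤ DerivedCategory Ab.{u} :=
  projProp.ι ⋙ ComplexShape.embeddingDownNat.extendHomotopyFunctor Ab.{u} ⋙ Qh

/-- The functor `projToDAb`, with values in connective objects; it is an equivalence. -/
noncomputable def projToConnective : ProjHtpy.{u} ⥤ ConnectiveDAb.{w, u} :=
  ObjectProperty.lift _ projToDAb fun P =>
    ⟨P.obj.as.extend ComplexShape.embeddingDownNat, Iso.refl _, inferInstance⟩

noncomputable instance : projToDAb.{w, u}.Full where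
  map_surjective {P Q} φ := by
    obtain ⟨⟨P⟩, hP⟩ := P
    have : ∀ n, Projective (P.X n) := hP
    obtain ⟨ψ, hψ⟩ := (CochainComplex.IsKProjective.Qh_map_bijective
      (P.extend ComplexShape.embeddingDownNat)
      ((ComplexShape.embeddingDownNat.extendHomotopyFunctor Ab.{u}).obj Q.obj)).surjective φ
    obtain ⟨χ, hχ⟩ :=
      (ComplexShape.embeddingDownNat.extendHomotopyFunctor Ab.{u}).map_surjective ψ
    exact ⟨ObjectProperty.homMk χ, by rw [← hψ, ← hχ]; rfl⟩

instance : projToDAb.{w, u}.Faithful where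
  map_injective {P Q} φ φ' h := by
    obtain ⟨⟨P⟩, hP⟩ := P
    have : ∀ n, Projective (P.X n) := hP
    apply projProp.ι.map_injective
    apply (ComplexShape.embeddingDownNat.extendHomotopyFunctor Ab.{u}).map_injective
    exact (CochainComplex.IsKProjective.Qh_map_bijective
      (P.extend ComplexShape.embeddingDownNat)
      ((ComplexShape.embeddingDownNat.extendHomotopyFunctor Ab.{u}).obj Q.obj)).injective h

instance : projToConnective.{w, u}.Full :=
  Functor.Full.of_comp_faithful_iso (ObjectProperty.liftCompιIso _ projToDAb.{w, u} _)

instance : projToConnective.{w, u}.Faithful :=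
  Functor.Faithful.of_comp_iso (ObjectProperty.liftCompιIso _ projToDAb.{w, u} _)

instance : projToConnective.{w, u}.EssSurj where
  mem_essImage X := by
    obtain ⟨X, K, e, hK⟩ := X
    obtain ⟨L, q, hq, hL, hL'⟩ := exists_projective_quasiIso K
    obtain ⟨P, hP, ⟨i⟩⟩ := exists_extend_iso L
    exact ⟨⟨⟨P⟩, hP⟩, ⟨ObjectProperty.isoMk _
      (DerivedCategory.Q.mapIso i ≪≫ asIso (DerivedCategory.Q.map q) ≪≫ e.symm)⟩⟩

instance : projToConnective.{w, u}.IsEquivalence where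

/-- The functor sending the homotopy class of a complex `K` to `F` applied to the simplicial
object corresponding to `K`, as an object of the derived category. -/
noncomputable def doldPuppe (F : Ab.{u} ⥤ Ab.{u}) :
    HomotopyCategory Ab.{u} (ComplexShape.down ℕ) ⥤ DerivedCategory Ab.{u} :=
  CategoryTheory.Quotient.lift _
    (doldPuppeComplex F ⋙ ComplexShape.embeddingDownNat.extendFunctor Ab.{u} ⋙ DerivedCategory.Q)
    (by
      rintro K L f g ⟨h⟩
      obtain ⟨H⟩ := nonempty_doldPuppe_homotopy F h
      let H' : Homotopy
          ((ComplexShape.embeddingDownNat.extendFunctor Ab.{u}).map ((doldPuppeComplex F).map f))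
          ((ComplexShape.embeddingDownNat.extendFunctor Ab.{u}).map ((doldPuppeComplex F).map g)) :=
        H.extend ComplexShape.embeddingDownNat
      exact DerivedCategory.Q_map_eq_of_homotopy _ H')

/-- The inverse of the equivalence `projToConnective`: it sends an object to a projective
resolution. -/
noncomputable def projResolution : ConnectiveDAb.{w, u} ⥤ ProjHtpy.{u} :=
  projToConnective.inv

/-- The left derived functor of `F`, in the sense of Dold and Puppe. -/
noncomputable def derivedFunctor (F : Ab.{u} ⥤ Ab.{u}) :
    ConnectiveDAb.{w, u} ⥤ DerivedCategory Ab.{u} :=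
  projResolution ⋙ projProp.ι ⋙ doldPuppe F

open DerivedCategory in
/-- The shift `C ↦ C[1]` on connective objects. -/
noncomputable def connectiveShift : ConnectiveDAb.{w, u} ⥤ ConnectiveDAb.{w, u} :=
  ObjectProperty.lift _ (ObjectProperty.ι _ ⋙ shiftFunctor (DerivedCategory Ab.{u}) (1 : ℤ))
    fun X => TStructure.t.le_monotone (by decide : (-1 : ℤ) ≤ 0) _
      (TStructure.t.le_shift 0 1 (-1) (by decide) X.obj X.property)

end

end LieDecalage

/-! Let 0 → A → B → D → 0 be exact with A and D projective. In the tensor ring of A × B give A the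
degree 1 and B the degree 0, and let d be the odd derivation extending A → B. The iterated super
commutators and squares of odd elements of weight p span a subcomplex L_p → … → L_1 → L_0
(`lieSpan`). It is augmented to 𝓛^p(D), and its term L_p, which involves letters of A only, is
𝓛_s^p(A). For p prime the sequence 0 → L_p → … → L_0 → 𝓛^p(D) → 0 is exact.

Given this, apply the sequence in each simplicial degree to the simplicial groups of P → cone P →
P[1]. For k < p every monomial in L_k contains a letter of B, so L_k, a functor of pairs, vanishes
on maps that are zero on B (`LieGr.map_zero`). Arbitrary functors preserve simplicial homotopies,
hence L_k is contractible when B comes from the cone. Cutting the exact sequence along the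
boundaries gives p short exact sequences with zero middle term in the derived category, up to the
isomorphism of L_p with the last boundaries. Each contributes a shift by one, which gives [p].
Natural isomorphisms on complexes of projectives descend to the homotopy category and then to
connective objects.

Exactness (`cycles_le_boundaries`) rests on three arguments. (1) The whole tensor ring has an
explicit contraction. It does not respect Lie elements, but the Dynkin operator turns words into Lie
elements, commutes with d and is multiplication by p on Lie elements of weight p. So p times a cycle
is a boundary (`nsmul_mem_boundaries`). (2) For a projection π of A, the derivation counting the
letters in the image of π is the anticommutator of d with an odd derivation preserving Lie elements,
hence is zero on homology. On mixed components its eigenvalues are 1, …, p - 1, so (p - 1)! times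
the mixed part of a cycle is a boundary, and by (1) so is the mixed part itself
(`sub_sub_mem_boundaries`). Induction on a basis of A, after passing to a free group by a
retraction, leaves one basis element a. (3) For one basis element, a contracted cycle is a
combination of words in a and its image with at least two odd letters. As a * a is a single Lie
element, such a word is a sum of products of at most p - 1 Lie elements. The Adams operations ψ^g,
which are convolution powers of the identity, commute with d and scale products of j Lie elements by
g ^ j up to products of fewer. The product of the ψ^g - g ^ j for 2 ≤ j ≤ p - 1 sends these words to
Lie elements, and multiplies Lie elements by the product of the g - g ^ j, which is prime to p for a
primitive root g (`tmap_spread_mem_boundaries`).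

That 𝓛_s^p(A) embeds in the tensor ring (`FreeGLRS.toT_injective`) follows the pattern of (2). The
derivations of the free graded Lie ring with squares factor through the tensor ring, so they vanish
on the kernel. The kernel is then p-torsion and has no mixed components, and on one generator the
ring is nonzero only in the weights 1 and 2. -/

namespace LieDecalage

/-! ### Lie monomials, words and products of Lie monomials in a ring -/

section Monomials

variable {R : Type v} [Ring R]

/-- The super commutator of elements of parities `k` and `l`. -/
def sbr (k l : ℕ) (x y : R) : R := x * y - (-1 : ℤ) ^ (k * l) • (y * x)

lemma neg_one_pow_smul_smul (n : ℕ) (x : R) : (-1 : ℤ) ^ n • (-1 : ℤ) ^ n • x = x := by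
  rw [smul_smul, ← mul_pow]; simp

lemma sbr_symm (k l : ℕ) (x y : R) : sbr k l x y = -((-1 : ℤ) ^ (k * l) • sbr l k y x) := by
  unfold sbr
  rw [smul_sub, mul_comm l k, neg_one_pow_smul_smul, neg_sub]

/-- The super commutator as a biadditive map. -/
def sbrHom (k l : ℕ) : R →+ R →+ R :=
  AddMonoidHom.mul - (-1 : ℤ) ^ (k * l) • AddMonoidHom.mul.flip

lemma sbrHom_apply (k l : ℕ) (x y : R) : sbrHom k l x y = sbr k l x y := rfl

/-- Iterated super commutators and squares of odd elements, built from letters; `LieMon S n k x`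
says that `x` is such a monomial of weight `n` and of degree `k`. -/
inductive LieMon (S : ℕ → R → Prop) : ℕ → ℕ → R → Prop
  | letter {k : ℕ} {x : R} : S k x → LieMon S 1 k x
  | br {n k m l : ℕ} {x y : R} :
      LieMon S n k x → LieMon S m l y → LieMon S (n + m) (k + l) (sbr k l x y)
  | sq {n k : ℕ} {x : R} : LieMon S n k x → Odd k → LieMon S (n + n) (k + k) (x * x)

/-- The group generated by the Lie monomials of given weight and degree. -/
def lieSpan (S : ℕ → R → Prop) (n k : ℕ) : AddSubgroup R :=
  AddSubgroup.closure {x | LieMon S n k x}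

/-- Products of letters. -/
inductive WordMon (S : ℕ → R → Prop) : ℕ → ℕ → R → Prop
  | nil : WordMon S 0 0 1
  | cons {k n l : ℕ} {x w : R} : S k x → WordMon S n l w → WordMon S (1 + n) (k + l) (x * w)

/-- The group generated by the words of given weight and degree. -/
def wordSpan (S : ℕ → R → Prop) (n k : ℕ) : AddSubgroup R :=
  AddSubgroup.closure {x | WordMon S n k x}

/-- Products of `j` Lie monomials. -/
inductive ProdMon (S : ℕ → R → Prop) : ℕ → ℕ → ℕ → R → Prop
  | nil : ProdMon S 0 0 0 1
  | cons {j n k m l : ℕ} {x w : R} : LieMon S n k x → ProdMon S j m l w →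
      ProdMon S (j + 1) (n + m) (k + l) (x * w)

/-- The group generated by the products of at most `j` Lie monomials, of given total weight
and degree. -/
def prodSpan (S : ℕ → R → Prop) (j n k : ℕ) : AddSubgroup R :=
  AddSubgroup.closure {x | ∃ i ≤ j, ProdMon S i n k x}

variable {S : ℕ → R → Prop}

lemma additive_mem {M P : Type*} [AddGroup M] [AddGroup P]
    (f : M →+ P) {s : Set M} {Q : AddSubgroup P}
    (h : ∀ x ∈ s, f x ∈ Q) {x : M} (hx : x ∈ AddSubgroup.closure s) : f x ∈ Q :=
  (AddSubgroup.closure_le (Q.comap f)).mpr h hx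

lemma biadditive_mem {M N P : Type*} [AddGroup M] [AddGroup N] [AddCommGroup P]
    (f : M →+ N →+ P) {s : Set M} {t : Set N} {Q : AddSubgroup P}
    (h : ∀ x ∈ s, ∀ y ∈ t, f x y ∈ Q) {x : M} {y : N} (hx : x ∈ AddSubgroup.closure s)
    (hy : y ∈ AddSubgroup.closure t) : f x y ∈ Q :=
  additive_mem (f.flip y) (fun x' hx' => additive_mem (f x') (fun y' hy' => h x' hx' y' hy') hy) hx

lemma lieSpan_br {n k m l : ℕ} {x y : R} (hx : x ∈ lieSpan S n k) (hy : y ∈ lieSpan S m l) :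
    sbr k l x y ∈ lieSpan S (n + m) (k + l) :=
  biadditive_mem (sbrHom k l) (fun _ hx _ hy => AddSubgroup.subset_closure (LieMon.br hx hy)) hx hy

/-- Squaring is not additive, but its polarization on odd elements is the super commutator, which
stays in the span. -/
lemma lieSpan_sq {n k : ℕ} {x : R} (hk : Odd k) (hx : x ∈ lieSpan S n k) :
    x * x ∈ lieSpan S (n + n) (k + k) := by
  have hodd (x y : R) : sbr k k x y = x * y + y * x := by
    simp [sbr, (hk.mul hk).neg_one_pow]
  induction hx using AddSubgroup.closure_induction with
  | mem x hx => exact AddSubgroup.subset_closure (LieMon.sq hx hk)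
  | zero => simp
  | add x y hx hy h1 h2 =>
    have := AddSubgroup.add_mem _ (AddSubgroup.add_mem _ h1 h2) (lieSpan_br hx hy)
    rw [hodd] at this
    convert this using 1
    noncomm_ring
  | neg x hx h => simpa using h

lemma LieMon.pos {n k : ℕ} {x : R} (h : LieMon S n k x) : 1 ≤ n := by
  induction h with
  | letter => exact le_rfl
  | br _ _ h1 h2 => omega
  | sq _ _ h => omega

lemma LieMon.degree_le (hS : ∀ k x, S k x → k ≤ 1) {n k : ℕ} {x : R} (h : LieMon S n k x) :
    k ≤ n := by
  induction h with
  | letter h => exact hS _ _ h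
  | br _ _ h1 h2 => omega
  | sq _ _ h => omega

lemma lieSpan_map {R' : Type*} [Ring R'] {S' : ℕ → R' → Prop} (f : R →+* R')
    (hf : ∀ k x, S k x → f x ∈ lieSpan S' 1 k) {n k : ℕ} {x : R} (hx : x ∈ lieSpan S n k) :
    f x ∈ lieSpan S' n k := by
  refine additive_mem f.toAddMonoidHom (fun x hx => ?_) hx
  change f x ∈ _
  rename_i hx0; clear hx0
  induction hx with
  | letter h => exact hf _ _ h
  | br _ _ h1 h2 =>
    have := lieSpan_br h1 h2
    simpa [sbr] using this
  | sq _ hk h =>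
    rw [map_mul]
    exact lieSpan_sq hk h

lemma wordSpan_map {R' : Type*} [Ring R'] {S' : ℕ → R' → Prop} (f : R →+* R')
    (hf : ∀ k x, S k x → f x ∈ AddSubgroup.closure {y | S' k y}) {n k : ℕ} {x : R}
    (hx : x ∈ wordSpan S n k) : f x ∈ wordSpan S' n k := by
  refine additive_mem f.toAddMonoidHom (fun x hx => ?_) hx
  change f x ∈ _
  rename_i hx0; clear hx0
  induction hx with
  | nil => rw [map_one]; exact AddSubgroup.subset_closure WordMon.nil
  | cons h _ ih =>
    rw [map_mul]
    exact biadditive_mem AddMonoidHom.mul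
      (fun _ hx _ hy => AddSubgroup.subset_closure (WordMon.cons hx hy)) (hf _ _ h) ih

lemma WordMon.mul {n k m l : ℕ} {x y : R} (hx : WordMon S n k x) (hy : WordMon S m l y) :
    WordMon S (n + m) (k + l) (x * y) := by
  induction hx with
  | nil => simpa using hy
  | cons h _ ih => rw [mul_assoc, add_assoc, add_assoc]; exact WordMon.cons h ih

lemma WordMon.eq_one_or {n k : ℕ} {x : R} (h : WordMon S n k x) :
    (n = 0 ∧ k = 0 ∧ x = 1) ∨ ∃ m i l y w, n = m + 1 ∧ k = i + l ∧ x = y * w ∧ S i y ∧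
      WordMon S m l w := by
  obtain _ | ⟨h, h'⟩ := h
  · simp
  · exact Or.inr ⟨_, _, _, _, _, add_comm _ _, rfl, rfl, h, h'⟩

lemma wordSpan_mul {n k m l : ℕ} {x y : R} (hx : x ∈ wordSpan S n k) (hy : y ∈ wordSpan S m l) :
    x * y ∈ wordSpan S (n + m) (k + l) :=
  biadditive_mem AddMonoidHom.mul
    (fun _ hx _ hy => AddSubgroup.subset_closure (WordMon.mul hx hy)) hx hy

lemma LieMon.mem_wordSpan {n k : ℕ} {x : R} (h : LieMon S n k x) : x ∈ wordSpan S n k := by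
  induction h with
  | letter h =>
    have := WordMon.cons h WordMon.nil
    exact AddSubgroup.subset_closure (by simpa using this)
  | @br n k m l x y _ _ h1 h2 =>
    refine AddSubgroup.sub_mem _ (wordSpan_mul h1 h2) (AddSubgroup.zsmul_mem _ ?_ _)
    rw [add_comm n, add_comm k]
    exact wordSpan_mul h2 h1
  | sq _ _ h => exact wordSpan_mul h h

lemma lieSpan_le_wordSpan (n k : ℕ) : lieSpan S n k ≤ wordSpan S n k :=
  (AddSubgroup.closure_le _).mpr fun _ h => LieMon.mem_wordSpan h

lemma prodSpan_mono {j j' n k : ℕ} (hj : j ≤ j') : prodSpan S j n k ≤ prodSpan S j' n k :=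
  AddSubgroup.closure_mono fun _ ⟨i, hi, h⟩ => ⟨i, hi.trans hj, h⟩

lemma ProdMon.mem {j n k : ℕ} {x : R} (h : ProdMon S j n k x) : x ∈ prodSpan S j n k :=
  AddSubgroup.subset_closure ⟨j, le_rfl, h⟩

lemma ProdMon.mul {i j n k m l : ℕ} {x y : R} (hx : ProdMon S i n k x) (hy : ProdMon S j m l y) :
    ProdMon S (i + j) (n + m) (k + l) (x * y) := by
  induction hx with
  | nil => simpa using hy
  | @cons i _ _ _ _ _ _ h _ ih =>
    rw [mul_assoc, add_assoc, add_assoc]; convert ProdMon.cons h ih using 1 <;> omega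

lemma prodSpan_mul {i j n k m l : ℕ} {x y : R} (hx : x ∈ prodSpan S i n k)
    (hy : y ∈ prodSpan S j m l) : x * y ∈ prodSpan S (i + j) (n + m) (k + l) :=
  biadditive_mem AddMonoidHom.mul
    (by
      rintro _ ⟨i', hi, hx⟩ _ ⟨j', hj, hy⟩
      exact AddSubgroup.subset_closure ⟨i' + j', by omega, hx.mul hy⟩) hx hy

lemma LieMon.prodMon {n k : ℕ} {x : R} (h : LieMon S n k x) : ProdMon S 1 n k x := by
  simpa using ProdMon.cons h ProdMon.nil

/-- Positive weight excludes the empty product 1, which is not a Lie element. -/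
lemma prodSpan_one_le (n k : ℕ) (hn : 1 ≤ n) : prodSpan S 1 n k ≤ lieSpan S n k := by
  refine (AddSubgroup.closure_le _).mpr fun x ⟨i, hi, h⟩ => ?_
  obtain _ | ⟨h, h'⟩ := h
  · omega
  · obtain _ | _ := h'
    · rw [mul_one]
      exact AddSubgroup.subset_closure h
    · omega

lemma WordMon.prodMon {n k : ℕ} {x : R} (h : WordMon S n k x) : ProdMon S n n k x := by
  induction h with
  | nil => exact ProdMon.nil
  | cons h _ ih => rw [add_comm 1]; convert ProdMon.cons (LieMon.letter h) ih using 1; omega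

/-- Moving a Lie monomial across a product of Lie monomials. -/
lemma ProdMon.comm {n k : ℕ} {x : R} (hx : LieMon S n k x) {j m l : ℕ} {w : R}
    (hw : ProdMon S j m l w) :
    x * w - (-1 : ℤ) ^ (k * l) • (w * x) ∈ prodSpan S j (n + m) (k + l) := by
  induction hw with
  | nil => simp
  | @cons j n' k' m l y w hy hw ih =>
    have h1 : sbr k k' x y * w ∈ prodSpan S (1 + j) ((n + n') + m) ((k + k') + l) :=
      prodSpan_mul (LieMon.br hx hy).prodMon.mem hw.mem
    have h2 := prodSpan_mul hy.prodMon.mem ih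
    -- Leibniz rule for the super commutator with x. In the first term x and y merge into the one
    -- Lie monomial [x, y], so the number of factors does not grow.
    have h3 : x * (y * w) - (-1 : ℤ) ^ (k * (k' + l)) • (y * w * x) =
        sbr k k' x y * w +
          (-1 : ℤ) ^ (k * k') • (y * (x * w - (-1 : ℤ) ^ (k * l) • (w * x))) := by
      simp only [sbr, sub_mul, mul_sub, smul_sub, mul_add k, pow_add, smul_mul_assoc,
        mul_smul_comm, smul_smul, mul_assoc]
      abel
    rw [h3]
    refine AddSubgroup.add_mem _ ?_ (AddSubgroup.zsmul_mem _ ?_ _)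
    · convert h1 using 2 <;> omega
    · convert h2 using 2 <;> omega

end Monomials

/-! ### The tensor ring and its additive universal property -/

section TensorRing

variable {V V' V'' : Type*} [AddCommGroup V] [Module ℤ V] [AddCommGroup V'] [Module ℤ V']
  [AddCommGroup V''] [Module ℤ V'']

/-- The inclusion of the generators in the tensor ring. -/
noncomputable def tι : V →+ TensorAlgebra ℤ V := (TensorAlgebra.ι ℤ).toAddMonoidHom

/-- The ring homomorphism extending an additive map. -/
noncomputable def tlift {S : Type*} [Ring S] (f : V →+ S) : TensorAlgebra ℤ V →+* S :=
  (TensorAlgebra.lift ℤ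
    ({ toFun := f
       map_add' := map_add f
       map_smul' := fun c v => by simpa using map_intCast_smul f ℤ ℤ c v } : V →ₗ[ℤ] S)).toRingHom

lemma tlift_ι {S : Type*} [Ring S] (f : V →+ S) (v : V) : tlift f (tι v) = f v :=
  TensorAlgebra.lift_ι_apply _ _

@[elab_as_elim]
lemma tensor_induction {C : TensorAlgebra ℤ V → Prop} (one : C 1) (ι : ∀ v, C (tι v))
    (mul : ∀ x y, C x → C y → C (x * y)) (add : ∀ x y, C x → C y → C (x + y))
    (neg : ∀ x, C x → C (-x)) (x : TensorAlgebra ℤ V) : C x := by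
  have zero : C 0 := by rw [← add_neg_cancel 1]; exact add _ _ one (neg _ one)
  induction x using TensorAlgebra.induction with
  | algebraMap r =>
    rw [eq_intCast]
    induction r with
    | zero => simpa using zero
    | succ n h => rw [Int.cast_add, Int.cast_one]; exact add _ _ h one
    | pred n h => rw [Int.cast_sub, Int.cast_one, sub_eq_add_neg]; exact add _ _ h (neg _ one)
  | ι v => exact ι v
  | mul x y hx hy => exact mul x y hx hy
  | add x y hx hy => exact add x y hx hy

lemma tensor_hom_ext {S : Type*} [Ring S] {f g : TensorAlgebra ℤ V →+* S}
    (h : ∀ v, f (tι v) = g (tι v)) : f = g := by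
  ext x
  induction x using tensor_induction with
  | one => simp
  | ι v => exact h v
  | mul x y hx hy => simp [hx, hy]
  | add x y hx hy => simp [hx, hy]
  | neg x hx => simp [hx]

/-- Functoriality of the tensor ring. -/
noncomputable def tmap (f : V →+ V') : TensorAlgebra ℤ V →+* TensorAlgebra ℤ V' :=
  tlift (tι.comp f)

lemma tmap_ι (f : V →+ V') (v : V) : tmap f (tι v) = tι (f v) := tlift_ι _ _

lemma tmap_id_apply (x : TensorAlgebra ℤ V) : tmap (AddMonoidHom.id V) x = x :=
  RingHom.congr_fun (f := tmap (AddMonoidHom.id V)) (g := RingHom.id _)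
    (tensor_hom_ext fun v => tmap_ι _ v) x

lemma tmap_tmap (f : V →+ V') (g : V' →+ V'') (x : TensorAlgebra ℤ V) :
    tmap g (tmap f x) = tmap (g.comp f) x :=
  RingHom.congr_fun (f := (tmap g).comp (tmap f)) (g := tmap (g.comp f))
    (tensor_hom_ext fun v => by simp [tmap_ι]) x

end TensorRing

/-! ### Twisted derivations of a tensor ring -/

section TwistedDerivation

variable {V : Type*} [AddCommGroup V] [Module ℤ V]

/-- The ring homomorphism encoding a twisted derivation. -/
noncomputable def tderHom (γ : TensorAlgebra ℤ V →+* TensorAlgebra ℤ V)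
    (δ : V →+ TensorAlgebra ℤ V) :
    TensorAlgebra ℤ V →+* Matrix (Fin 2) (Fin 2) (TensorAlgebra ℤ V) :=
  tlift (AddMonoidHom.mk' (fun v => !![γ (tι v), δ v; 0, tι v]) fun v w => by
    ext i j
    fin_cases i <;> fin_cases j <;> simp)

/-- The additive map `D` extending `δ` such that `D (x * y) = D x * y + γ x * D y`. -/
noncomputable def tder (γ : TensorAlgebra ℤ V →+* TensorAlgebra ℤ V)
    (δ : V →+ TensorAlgebra ℤ V) : TensorAlgebra ℤ V →+ TensorAlgebra ℤ V :=
  AddMonoidHom.mk' (fun x => tderHom γ δ x 0 1) fun x y => by simp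

variable (γ : TensorAlgebra ℤ V →+* TensorAlgebra ℤ V) (δ : V →+ TensorAlgebra ℤ V)

lemma tder_ι (v : V) : tder γ δ (tι v) = δ v := by
  change tderHom γ δ (tι v) 0 1 = _
  rw [tderHom, tlift_ι]
  simp

/-- The matrices are upper triangular with diagonal (γ x, x), and the product of two such matrices
has the twisted Leibniz rule as its upper right entry. -/
lemma tderHom_apply (x : TensorAlgebra ℤ V) :
    tderHom γ δ x 0 0 = γ x ∧ tderHom γ δ x 1 0 = 0 ∧ tderHom γ δ x 1 1 = x := by
  induction x using tensor_induction with
  | one => simp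
  | ι v =>
    rw [tderHom, tlift_ι]
    simp
  | mul x y hx hy => simp [Matrix.mul_apply, Fin.sum_univ_two, hx, hy]
  | add x y hx hy => simp [hx, hy]
  | neg x hx => simp [hx]

lemma tder_mul (x y : TensorAlgebra ℤ V) :
    tder γ δ (x * y) = tder γ δ x * y + γ x * tder γ δ y := by
  change tderHom γ δ (x * y) 0 1 = tderHom γ δ x 0 1 * y + γ x * tderHom γ δ y 0 1
  rw [map_mul, Matrix.mul_apply, Fin.sum_univ_two, (tderHom_apply γ δ x).1,
    (tderHom_apply γ δ y).2.2, add_comm]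

lemma tder_one : tder γ δ 1 = 0 := by
  change tderHom γ δ 1 0 1 = 0
  simp

end TwistedDerivation

/-! ### Odd derivations, their anticommutators and the contraction of a tensor ring -/

section SuperDerivation

variable {V : Type*} [AddCommGroup V] [Module ℤ V]

/-- The derivation, twisted by the automorphism induced by `σ`, extending the linear map `f`. -/
noncomputable def der (σ f : V →+ V) : TensorAlgebra ℤ V →+ TensorAlgebra ℤ V :=
  tder (tmap σ) (tι.comp f)

lemma der_ι (σ f : V →+ V) (v : V) :
    der σ f (tι v) = tι (f v) := tder_ι _ _ _

lemma der_mul (σ f : V →+ V) (x y : TensorAlgebra ℤ V) :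
    der σ f (x * y) = der σ f x * y + tmap σ x * der σ f y := tder_mul _ _ _ _

lemma der_one (σ f : V →+ V) : der σ f 1 = 0 := tder_one _ _

lemma der_tmap {V' : Type*} [AddCommGroup V'] [Module ℤ V'] {σ f : V →+ V}
    {σ' f' : V' →+ V'} (g : V →+ V') (hσ : g.comp σ = σ'.comp g) (hf : g.comp f = f'.comp g)
    (x : TensorAlgebra ℤ V) : der σ' f' (tmap g x) = tmap g (der σ f x) := by
  induction x using tensor_induction with
  | one => simp [der_one]
  | neg x hx => simp [hx]
  | ι v =>
    rw [tmap_ι, der_ι, der_ι, tmap_ι]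
    exact congrArg _ (DFunLike.congr_fun hf v).symm
  | mul x y hx hy =>
    rw [map_mul, der_mul, der_mul, hx, hy, map_add, map_mul, map_mul, tmap_tmap,
      tmap_tmap, hσ]
  | add x y hx hy => simp [hx, hy]

variable {σ f g : V →+ V}

lemma tmap_der (hf : σ.comp f = -(f.comp σ)) (x : TensorAlgebra ℤ V) :
    tmap σ (der σ f x) = -der σ f (tmap σ x) := by
  induction x using tensor_induction with
  | one => simp [der_one]
  | neg x hx => simp [hx]
  | ι v =>
    rw [tmap_ι, der_ι, der_ι, tmap_ι, ← map_neg]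
    exact congrArg _ (DFunLike.congr_fun hf v)
  | mul x y hx hy =>
    rw [der_mul, map_add, map_mul, map_mul, map_mul, der_mul, hx, hy]
    noncomm_ring
  | add x y hx hy => simp [hx, hy]; abel

lemma der_der (hf : σ.comp f = -(f.comp σ)) (hff : f.comp f = 0)
    (x : TensorAlgebra ℤ V) : der σ f (der σ f x) = 0 := by
  induction x using tensor_induction with
  | one => simp [der_one]
  | neg x hx => simp [hx]
  | ι v =>
    rw [der_ι, der_ι, show f (f v) = 0 from DFunLike.congr_fun hff v, map_zero]
  | mul x y hx hy =>
    rw [der_mul, map_add, der_mul, der_mul, hx, hy, tmap_der hf]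
    noncomm_ring
  | add x y hx hy => simp [hx, hy]

/-- In the anticommutator of two odd derivations the cross terms cancel by the anticommutation with
σ, and the twist becomes σ² = 1. An ordinary derivation results, determined by its values on
generators. -/
lemma der_anticomm (hσ : σ.comp σ = AddMonoidHom.id V) (hf : σ.comp f = -(f.comp σ))
    (hg : σ.comp g = -(g.comp σ)) (x : TensorAlgebra ℤ V) :
    der σ f (der σ g x) + der σ g (der σ f x) =
      der (AddMonoidHom.id V) (f.comp g + g.comp f) x := by
  induction x using tensor_induction with
  | one => simp [der_one]
  | neg x hx => rw [map_neg, map_neg, map_neg, map_neg, map_neg, ← hx, neg_add]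
  | ι v => simp [der_ι]
  | mul x y hx hy =>
    have hσσ : tmap σ (tmap σ x) = x := by
      rw [tmap_tmap, hσ, tmap_id_apply]
    rw [der_mul, der_mul, map_add, map_add, der_mul, der_mul, der_mul, der_mul, der_mul,
      ← hx, ← hy, tmap_der hf, tmap_der hg, tmap_id_apply, hσσ]
    noncomm_ring
  | add x y hx hy => simp only [map_add, ← hx, ← hy]; abel

/-- The contraction of the tensor algebra of a complex `V` with differential `f`, obtained from
a homotopy `g` between `e` and the identity. -/
lemma der_contraction {e : V →+ V} (hfe : f.comp e = 0) (hef : e.comp f = 0)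
    (heσ : e.comp σ = e) (hσe : σ.comp e = e)
    (hg : σ.comp g = -(g.comp σ)) (h : f.comp g + g.comp f = AddMonoidHom.id V - e) (x : TensorAlgebra ℤ V) :
    der σ f (der e g x) + der e g (der σ f x) = x - tmap e x := by
  have h1 (x : TensorAlgebra ℤ V) : der σ f (tmap e x) = 0 := by
    induction x using tensor_induction with
    | one => simp [der_one]
    | neg x hx => simp [hx]
    | ι v =>
      rw [tmap_ι, der_ι, show f (e v) = 0 from DFunLike.congr_fun hfe v, map_zero]
    | mul x y hx hy => rw [map_mul, der_mul, hx, hy]; simp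
    | add x y hx hy => simp [hx, hy]
  have h2 (x : TensorAlgebra ℤ V) : tmap e (der σ f x) = 0 := by
    induction x using tensor_induction with
    | one => simp [der_one]
    | neg x hx => simp [hx]
    | ι v =>
      rw [der_ι, tmap_ι, show e (f v) = 0 from DFunLike.congr_fun hef v, map_zero]
    | mul x y hx hy => rw [der_mul, map_add, map_mul, map_mul, hx, hy]; simp
    | add x y hx hy => simp [hx, hy]
  have h3 (x : TensorAlgebra ℤ V) : tmap σ (der e g x) = -der e g (tmap σ x) := by
    induction x using tensor_induction with
    | one => simp [der_one]
    | neg x hx => simp [hx]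
    | ι v =>
      rw [tmap_ι, der_ι, der_ι, tmap_ι, ← map_neg]
      exact congrArg _ (DFunLike.congr_fun hg v)
    | mul x y hx hy =>
      rw [der_mul, map_add, map_mul, map_mul, map_mul, der_mul, hx, hy, tmap_tmap,
        tmap_tmap, heσ, hσe]
      noncomm_ring
    | add x y hx hy => simp [hx, hy]; abel
  induction x using tensor_induction with
  | one => simp [der_one]
  | neg x hx => simp only [map_neg]; rw [← neg_add, hx]; abel
  | ι v =>
    have := DFunLike.congr_fun h v
    simp only [AddMonoidHom.add_apply, AddMonoidHom.comp_apply, AddMonoidHom.sub_apply,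
      AddMonoidHom.id_apply] at this
    rw [der_ι, der_ι, der_ι, der_ι, ← map_add, this, tmap_ι, map_sub]
  | mul x y hx hy =>
    have h4 : tmap e (tmap σ x) = tmap e x := by rw [tmap_tmap, heσ]
    have h5 : tmap σ (tmap e x) = tmap e x := by rw [tmap_tmap, hσe]
    -- The operator dh + hd satisfies Φ(xy) = Φ(x) y + e(x) Φ(y). The difference of the identity and
    -- the ring homomorphism induced by e obeys the same rule, so it suffices to compare on
    -- generators.
    have e1 : der σ f (der e g (x * y)) + der e g (der σ f (x * y)) =
        (der σ f (der e g x) + der e g (der σ f x)) * y +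
          tmap e x * (der σ f (der e g y) + der e g (der σ f y)) := by
      rw [der_mul, der_mul, map_add, map_add, der_mul, der_mul, der_mul, der_mul, h1, h2, h3,
        h4, h5]
      noncomm_ring
    rw [e1, hx, hy, map_mul]
    noncomm_ring
  | add x y hx hy =>
    simp only [map_add]
    rw [add_add_add_comm, hx, hy]; abel

end SuperDerivation

/-! ### The bigraded Lie elements of the tensor ring of A × B and the differential -/

section Super

variable {A B : Type*} [AddCommGroup A] [AddCommGroup B]

/-- The generators of the tensor ring of `A × B`, the elements of `A` having the degree `1` and
the elements of `B` having the degree `0`. -/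
inductive Letter (A B : Type*) [AddCommGroup A] [AddCommGroup B] :
    ℕ → TensorAlgebra ℤ (A × B) → Prop
  | odd (a : A) : Letter A B 1 (tι (a, 0))
  | even (b : B) : Letter A B 0 (tι (0, b))

lemma Letter.le_one {k : ℕ} {x : TensorAlgebra ℤ (A × B)} (h : Letter A B k x) : k ≤ 1 := by
  obtain _ | _ := h <;> simp

variable (A B) in
/-- The parity automorphism of `A × B`. -/
def par : A × B →+ A × B :=
  (-AddMonoidHom.id A).prodMap (AddMonoidHom.id B)

lemma par_apply (x : A × B) : par A B x = (-x.1, x.2) := rfl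

lemma par_par : (par A B).comp (par A B) = AddMonoidHom.id _ := by
  ext x <;> simp [par_apply]

/-- The odd endomorphism of `A × B` given by a map `A → B`. -/
def lower (i : A →+ B) : A × B →+ A × B :=
  (AddMonoidHom.inr A B).comp (i.comp (AddMonoidHom.fst A B))

/-- The odd endomorphism of `A × B` given by a map `B → A`. -/
def raise (s : B →+ A) : A × B →+ A × B :=
  (AddMonoidHom.inl A B).comp (s.comp (AddMonoidHom.snd A B))

lemma lower_apply (i : A →+ B) (x : A × B) : lower i x = (0, i x.1) := rfl

lemma raise_apply (s : B →+ A) (x : A × B) : raise s x = (s x.2, 0) := rfl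

lemma par_lower (i : A →+ B) : (par A B).comp (lower i) = -(lower i).comp (par A B) := by
  ext x <;> simp [par_apply, lower_apply]

lemma par_raise (s : B →+ A) : (par A B).comp (raise s) = -(raise s).comp (par A B) := by
  ext x <;> simp [par_apply, raise_apply]

lemma lower_lower (i : A →+ B) : (lower i).comp (lower i) = 0 := by
  ext x <;> simp [lower_apply]

/-- The differential of the tensor ring of `A × B` extending a map `A → B`. -/
noncomputable def diff (i : A →+ B) : TensorAlgebra ℤ (A × B) →+ TensorAlgebra ℤ (A × B) :=
  der (par A B) (lower i)

/-- The odd derivation of the tensor ring of `A × B` extending a map `B → A`. -/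
noncomputable def raiseDer (s : B →+ A) : TensorAlgebra ℤ (A × B) →+ TensorAlgebra ℤ (A × B) :=
  der (par A B) (raise s)

lemma diff_diff (i : A →+ B) (x : TensorAlgebra ℤ (A × B)) : diff i (diff i x) = 0 :=
  der_der (par_lower i) (lower_lower i) x

lemma diff_mul (i : A →+ B) (x y : TensorAlgebra ℤ (A × B)) :
    diff i (x * y) = diff i x * y + tmap (par A B) x * diff i y := der_mul _ _ _ _

lemma diff_ι (i : A →+ B) (v : A × B) : diff i (tι v) = tι (0, i v.1) := der_ι _ _ _

lemma diff_raiseDer (i : A →+ B) (s : B →+ A) (x : TensorAlgebra ℤ (A × B)) :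
    diff i (raiseDer s x) + raiseDer s (diff i x) =
      der (AddMonoidHom.id _) ((s.comp i).prodMap (i.comp s)) x := by
  refine (der_anticomm par_par (par_lower i) (par_raise s) x).trans ?_
  congr 2
  ext x <;> simp [lower_apply, raise_apply]

lemma par_letter {k : ℕ} {x : TensorAlgebra ℤ (A × B)} (h : Letter A B k x) :
    tmap (par A B) x = (-1 : ℤ) ^ k • x := by
  obtain a | b := h
  · rw [tmap_ι, par_apply, pow_one, neg_one_smul, ← map_neg]; simp
  · rw [tmap_ι, par_apply, pow_zero, one_smul]; simp

lemma par_lieMon {n k : ℕ} {x : TensorAlgebra ℤ (A × B)} (h : LieMon (Letter A B) n k x) :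
    tmap (par A B) x = (-1 : ℤ) ^ k • x := by
  induction h with
  | letter h => exact par_letter h
  | br _ _ h1 h2 =>
    simp only [sbr, map_sub, map_mul, map_zsmul, h1, h2, smul_mul_assoc, mul_smul_comm, smul_smul,
      smul_sub, pow_add]
    ring_nf
  | sq _ _ h =>
    simp only [map_mul, h, smul_mul_assoc, mul_smul_comm, smul_smul, pow_add]

/-- The degrees k' and l' enter through their parities only. One formula therefore serves the
differential, which lowers degrees, and `raiseDer`, which raises them. -/
lemma odd_der_sbr {D : TensorAlgebra ℤ (A × B) →+ TensorAlgebra ℤ (A × B)}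
    (hD : ∀ x y, D (x * y) = D x * y + tmap (par A B) x * D y)
    {n k m l k' l' : ℕ} {x y : TensorAlgebra ℤ (A × B)} (hx : LieMon (Letter A B) n k x)
    (hy : LieMon (Letter A B) m l y) (hk : (-1 : ℤ) ^ k' = -(-1 : ℤ) ^ k)
    (hl : (-1 : ℤ) ^ l' = -(-1 : ℤ) ^ l) :
    D (sbr k l x y) = sbr k' l (D x) y + (-1 : ℤ) ^ k • sbr k l' x (D y) := by
  have h1 : (-1 : ℤ) ^ (k' * l) = (-1 : ℤ) ^ (k * l) * (-1 : ℤ) ^ l := by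
    rw [pow_mul, hk, pow_mul, neg_pow, mul_comm]
  have h2 : (-1 : ℤ) ^ (k * l') = (-1 : ℤ) ^ (k * l) * (-1 : ℤ) ^ k := by
    rw [mul_comm k, mul_comm k, pow_mul, hl, pow_mul, neg_pow, mul_comm]
  have h3 : (-1 : ℤ) ^ k * ((-1 : ℤ) ^ (k * l) * (-1 : ℤ) ^ k) = (-1 : ℤ) ^ (k * l) := by
    rw [mul_comm, mul_assoc, ← mul_pow]; simp
  simp only [sbr, map_sub, map_zsmul, hD, par_lieMon hx, par_lieMon hy, h1, h2, smul_sub,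
    smul_add, smul_mul_assoc, smul_smul, h3]
  abel

/-- An odd derivation is a derivation for super commutators, and on the square of an odd x it gives
dx * x - x * dx = [dx, x]. The degree 0 is separate because natural numbers offer no degree -1. -/
lemma diff_lieMon (i : A →+ B) {n k : ℕ} {x : TensorAlgebra ℤ (A × B)}
    (h : LieMon (Letter A B) n k x) :
    (k = 0 → diff i x = 0) ∧ ∀ k', k = k' + 1 → diff i x ∈ lieSpan (Letter A B) n k' := by
  have key (k' : ℕ) : (-1 : ℤ) ^ k' = -(-1 : ℤ) ^ (k' + 1) := by simp [pow_succ]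
  induction h with
  | letter h =>
    obtain a | b := h
    · refine ⟨by simp, fun k' hk' => ?_⟩
      obtain rfl : k' = 0 := by omega
      rw [diff_ι]
      exact AddSubgroup.subset_closure (.letter (.even _))
    · refine ⟨fun _ => ?_, by simp⟩
      rw [diff_ι, map_zero]
      exact map_zero _
  | @br n k m l x y hx hy h1 h2 =>
    obtain _ | k' := k
    · have h1' := h1.1 rfl
      obtain _ | l' := l
      · refine ⟨fun _ => ?_, by simp⟩
        rw [sbr, map_sub, map_zsmul, diff_mul, diff_mul, h1', h2.1 rfl]
        simp
      · refine ⟨by simp, fun j hj => ?_⟩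
        obtain rfl : j = l' := by omega
        rw [odd_der_sbr (diff_mul i) hx hy (k' := 1) (by simp) (key j), h1']
        have := lieSpan_br (AddSubgroup.subset_closure hx) (h2.2 _ rfl)
        simpa [sbr] using this
    · refine ⟨by simp, fun j hj => ?_⟩
      obtain _ | l' := l
      · have h2' := h2.1 rfl
        obtain rfl : j = k' := by omega
        rw [odd_der_sbr (diff_mul i) hx hy (l' := 1) (key j) (by simp), h2']
        have := lieSpan_br (h1.2 _ rfl) (AddSubgroup.subset_closure hy)
        simpa [sbr] using this
      · obtain rfl : j = k' + l' + 1 := by omega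
        rw [odd_der_sbr (diff_mul i) hx hy (key k') (key l')]
        refine AddSubgroup.add_mem _ ?_ (AddSubgroup.zsmul_mem _ ?_ _)
        · convert lieSpan_br (h1.2 _ rfl) (AddSubgroup.subset_closure hy) using 2; omega
        · convert lieSpan_br (AddSubgroup.subset_closure hx) (h2.2 _ rfl) using 2; omega
  | @sq n k x hx hk h =>
    refine ⟨fun h0 => ?_, fun j hj => ?_⟩
    · obtain rfl : k = 0 := by omega
      simp at hk
    · obtain ⟨m, rfl⟩ := hk
      have := lieSpan_br (h.2 _ rfl) (AddSubgroup.subset_closure hx)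
      rw [diff_mul, par_lieMon hx]
      convert this using 1
      · congr 1; omega
      · rw [sbr, Odd.neg_one_pow ⟨m, rfl⟩, Even.neg_one_pow (by simp [mul_assoc])]
        simp
        abel

lemma raiseDer_lieMon (s : B →+ A) {n k : ℕ} {x : TensorAlgebra ℤ (A × B)}
    (h : LieMon (Letter A B) n k x) : raiseDer s x ∈ lieSpan (Letter A B) n (k + 1) := by
  have key (k : ℕ) : (-1 : ℤ) ^ (k + 1) = -(-1 : ℤ) ^ k := by simp [pow_succ]
  have hmul (x y) : raiseDer s (x * y) = raiseDer s x * y + tmap (par A B) x * raiseDer s y :=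
    der_mul (par A B) (raise s) x y
  induction h with
  | letter h =>
    obtain a | b := h
    · rw [raiseDer, der_ι, raise_apply]
      rw [map_zero]
      exact (congrArg (· ∈ lieSpan _ _ _) (map_zero tι)).mpr (AddSubgroup.zero_mem _)
    · rw [raiseDer, der_ι, raise_apply]
      exact AddSubgroup.subset_closure (.letter (.odd _))
  | @br n k m l x y hx hy h1 h2 =>
    rw [odd_der_sbr hmul hx hy (key k) (key l)]
    refine AddSubgroup.add_mem _ ?_ (AddSubgroup.zsmul_mem _ ?_ _)
    · rw [add_right_comm k l 1]
      exact lieSpan_br h1 (AddSubgroup.subset_closure hy)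
    · rw [add_assoc k l 1]
      exact lieSpan_br (AddSubgroup.subset_closure hx) h2
  | @sq n k x hx hk h =>
    have := lieSpan_br h (AddSubgroup.subset_closure hx)
    rw [hmul, par_lieMon hx]
    convert this using 1
    · congr 1; omega
    · rw [sbr, hk.neg_one_pow, Even.neg_one_pow (hk.add_one.mul_right k)]
      simp
      abel

lemma diff_mem_lieSpan (i : A →+ B) {n k : ℕ} {x : TensorAlgebra ℤ (A × B)}
    (h : x ∈ lieSpan (Letter A B) n (k + 1)) : diff i x ∈ lieSpan (Letter A B) n k :=
  additive_mem (diff i) (fun _ hx => (diff_lieMon i hx).2 _ rfl) h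

lemma diff_eq_zero (i : A →+ B) {n : ℕ} {x : TensorAlgebra ℤ (A × B)}
    (h : x ∈ lieSpan (Letter A B) n 0) : diff i x = 0 :=
  additive_mem (diff i) (Q := ⊥) (fun _ hx => (diff_lieMon i hx).1 rfl) h

lemma raiseDer_mem_lieSpan (s : B →+ A) {n k : ℕ} {x : TensorAlgebra ℤ (A × B)}
    (h : x ∈ lieSpan (Letter A B) n k) : raiseDer s x ∈ lieSpan (Letter A B) n (k + 1) :=
  additive_mem (raiseDer s) (fun _ hx => raiseDer_lieMon s hx) h

lemma lieSpan_eq_bot {n k : ℕ} (h : n < k) : lieSpan (Letter A B) n k = ⊥ := by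
  rw [eq_bot_iff]
  refine (AddSubgroup.closure_le _).mpr fun x hx => ?_
  have := hx.degree_le fun _ _ => Letter.le_one
  omega

variable {A' B' : Type*} [AddCommGroup A'] [AddCommGroup B']

lemma tmap_mem_lieSpan (f : A →+ A') (g : B →+ B') {n k : ℕ} {x : TensorAlgebra ℤ (A × B)}
    (h : x ∈ lieSpan (Letter A B) n k) :
    tmap (f.prodMap g) x ∈ lieSpan (Letter A' B') n k := by
  refine lieSpan_map _ (fun k x hx => AddSubgroup.subset_closure (.letter ?_)) h
  obtain a | b := hx
  · rw [tmap_ι]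
    simpa using Letter.odd (B := B') (f a)
  · rw [tmap_ι]
    simpa using Letter.even (A := A') (g b)

lemma diff_tmap (i : A →+ B) (i' : A' →+ B') (f : A →+ A') (g : B →+ B')
    (h : g.comp i = i'.comp f) (x : TensorAlgebra ℤ (A × B)) :
    diff i' (tmap (f.prodMap g) x) = tmap (f.prodMap g) (diff i x) := by
  refine der_tmap _ ?_ ?_ x
  · ext x <;> simp [par_apply]
  · have (a : A) : g (i a) = i' (f a) := DFunLike.congr_fun h a
    ext x <;> simp [lower_apply, this]

end Super

/-! ### The super adjoint action and the Dynkin operator -/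

section Dynkin

variable {A B : Type*} [AddCommGroup A] [AddCommGroup B]

lemma iterate_par_mul (k : ℕ) (x y : TensorAlgebra ℤ (A × B)) :
    (tmap (par A B))^[k] (x * y) = (tmap (par A B))^[k] x * (tmap (par A B))^[k] y := by
  induction k generalizing x y with
  | zero => rfl
  | succ k ih => rw [Function.iterate_succ_apply, map_mul, ih]; rfl

lemma iterate_par_sub (k : ℕ) (x y : TensorAlgebra ℤ (A × B)) :
    (tmap (par A B))^[k] (x - y) = (tmap (par A B))^[k] x - (tmap (par A B))^[k] y := by
  induction k generalizing x y with
  | zero => rfl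
  | succ k ih => rw [Function.iterate_succ_apply, map_sub, ih]; rfl

lemma iterate_par_eq (k : ℕ) {l : ℕ} {x : TensorAlgebra ℤ (A × B)}
    (hx : tmap (par A B) x = (-1 : ℤ) ^ l • x) :
    (tmap (par A B))^[k] x = (-1 : ℤ) ^ (k * l) • x := by
  induction k with
  | zero => simp
  | succ k ih =>
    rw [Function.iterate_succ_apply', ih, map_zsmul, hx, smul_smul, ← pow_add, add_one_mul]

/-- The super adjoint action of a letter. -/
noncomputable def adLetter : A × B →+ AddMonoid.End (TensorAlgebra ℤ (A × B)) :=
  AddMonoidHom.mk' (fun w => AddMonoidHom.mk'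
    (fun x => tι w * x - tmap (par A B) x * tι (w.1, 0) - x * tι (0, w.2))
    fun x y => by simp only [mul_add, map_add, add_mul]; abel)
    fun v w => by
      ext x
      have h1 : (((v + w).1, 0) : A × B) = (v.1, 0) + (w.1, 0) := by simp
      have h2 : ((0, (v + w).2) : A × B) = (0, v.2) + (0, w.2) := by simp
      change tι (v + w) * x - tmap (par A B) x * tι ((v + w).1, 0) - x * tι (0, (v + w).2) =
        (tι v * x - tmap (par A B) x * tι (v.1, 0) - x * tι (0, v.2)) +
        (tι w * x - tmap (par A B) x * tι (w.1, 0) - x * tι (0, w.2))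
      rw [h1, h2, map_add, map_add, map_add]
      noncomm_ring

lemma adLetter_apply (w : A × B) (x : TensorAlgebra ℤ (A × B)) :
    adLetter w x = tι w * x - tmap (par A B) x * tι (w.1, 0) - x * tι (0, w.2) := rfl

variable (A B) in
/-- The super adjoint action. -/
noncomputable def superAd : TensorAlgebra ℤ (A × B) →+* AddMonoid.End (TensorAlgebra ℤ (A × B)) :=
  tlift adLetter

/-- On words the action is the iterated commutator with the letters. By the super Jacobi identity,
and by ad(x)² = ad(x²) for odd x, a Lie monomial acts as the super commutator with itself. -/
lemma superAd_lieMon {n k : ℕ} {x : TensorAlgebra ℤ (A × B)} (h : LieMon (Letter A B) n k x)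
    (z : TensorAlgebra ℤ (A × B)) :
    superAd A B x z = x * z - (tmap (par A B))^[k] z * x := by
  induction h generalizing z with
  | letter h =>
    obtain a | b := h
    · rw [superAd, tlift_ι, adLetter_apply]
      change _ - z * tι 0 = _
      rw [map_zero, mul_zero, sub_zero]
      rfl
    · rw [superAd, tlift_ι, adLetter_apply]
      change _ - tmap (par A B) z * tι 0 - _ = _
      rw [map_zero, mul_zero, sub_zero]
      rfl
  | @br n k m l x y hx hy h1 h2 =>
    have e1 : superAd A B (sbr k l x y) z = superAd A B x (superAd A B y z) -
        (-1 : ℤ) ^ (k * l) • superAd A B y (superAd A B x z) := by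
      rw [sbr, map_sub, map_zsmul, map_mul, map_mul]; rfl
    have e2 : (tmap (par A B))^[k] ((tmap (par A B))^[l] z) = (tmap (par A B))^[k + l] z :=
      (Function.iterate_add_apply _ _ _ _).symm
    have e3 : (tmap (par A B))^[l] ((tmap (par A B))^[k] z) = (tmap (par A B))^[k + l] z := by
      rw [add_comm]; exact (Function.iterate_add_apply _ _ _ _).symm
    rw [e1, h1, h2, h1, h2, iterate_par_sub, iterate_par_sub, iterate_par_mul, iterate_par_mul,
      iterate_par_mul, iterate_par_mul, e2, e3, iterate_par_eq k (par_lieMon hy),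
      iterate_par_eq l (par_lieMon hx), mul_comm l k, sbr]
    obtain h | h := neg_one_pow_eq_or ℤ (k * l) <;> rw [h] <;> noncomm_ring
  | @sq n k x hx hk h =>
    have e1 : superAd A B (x * x) z = superAd A B x (superAd A B x z) := by
      rw [map_mul]; rfl
    have e2 : (tmap (par A B))^[k] ((tmap (par A B))^[k] z) = (tmap (par A B))^[k + k] z :=
      (Function.iterate_add_apply _ _ _ _).symm
    rw [e1, h, h, iterate_par_sub, iterate_par_mul, iterate_par_mul, e2,
      iterate_par_eq k (par_lieMon hx), (hk.mul hk).neg_one_pow]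
    noncomm_ring

lemma superAd_lieMon_lieMon {n k m l : ℕ} {x y : TensorAlgebra ℤ (A × B)}
    (hx : LieMon (Letter A B) n k x) (hy : LieMon (Letter A B) m l y) :
    superAd A B x y = sbr k l x y := by
  rw [superAd_lieMon hx, iterate_par_eq k (par_lieMon hy), sbr, smul_mul_assoc]

/-- The action of letters on `ℤ × T` used to define the Dynkin operator. -/
noncomputable def dynkinLetter : A × B →+ AddMonoid.End (ℤ × TensorAlgebra ℤ (A × B)) :=
  AddMonoidHom.mk' (fun w => AddMonoidHom.mk' (fun x => (0, x.1 • tι w + adLetter w x.2))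
    fun x y => by
      simp only [Prod.fst_add, Prod.snd_add, add_smul, map_add, Prod.mk_add_mk, add_zero]
      congr 1; abel)
    fun v w => by
      ext x : 1
      change ((0, x.1 • tι (v + w) + adLetter (v + w) x.2) : ℤ × TensorAlgebra ℤ (A × B)) =
        (0, x.1 • tι v + adLetter v x.2) + (0, x.1 • tι w + adLetter w x.2)
      rw [map_add, map_add, smul_add]
      change (_, _ + (adLetter v x.2 + adLetter w x.2)) = _
      rw [Prod.mk_add_mk, add_zero]
      congr 1; abel

lemma dynkinLetter_apply (w : A × B) (x : ℤ × TensorAlgebra ℤ (A × B)) :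
    dynkinLetter w x = (0, x.1 • tι w + adLetter w x.2) := rfl

variable (A B) in
/-- The action on `ℤ × T` used to define the Dynkin operator. -/
noncomputable def dynkinHom :
    TensorAlgebra ℤ (A × B) →+* AddMonoid.End (ℤ × TensorAlgebra ℤ (A × B)) :=
  tlift dynkinLetter

variable (A B) in
/-- The Dynkin operator, sending a word to a right normed super commutator. -/
noncomputable def dynkin : TensorAlgebra ℤ (A × B) →+ TensorAlgebra ℤ (A × B) :=
  AddMonoidHom.mk' (fun x => (dynkinHom A B x (1, 0)).2) fun x y => by rw [map_add]; rfl

/-- The second factor is stable under the action and carries the adjoint action. The first factor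
only serves to start the iteration: on (1, 0) the last letter of a word gives itself, and the other
letters act by commutators. -/
lemma dynkinHom_snd (x v : TensorAlgebra ℤ (A × B)) :
    dynkinHom A B x (0, v) = (0, superAd A B x v) := by
  induction x using tensor_induction generalizing v with
  | one => simp
  | ι w => rw [dynkinHom, superAd, tlift_ι, tlift_ι, dynkinLetter_apply, zero_smul, zero_add]
  | mul x y hx hy =>
    rw [map_mul, map_mul]
    change dynkinHom A B x (dynkinHom A B y (0, v)) = _
    rw [hy, hx]; rfl
  | add x y hx hy =>
    rw [map_add, map_add]
    change dynkinHom A B x (0, v) + dynkinHom A B y (0, v) = _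
    rw [hx, hy]
    change _ = (0, superAd A B x v + superAd A B y v)
    simp
  | neg x hx =>
    rw [map_neg, map_neg]
    change - dynkinHom A B x (0, v) = _
    rw [hx]
    change _ = (0, - superAd A B x v)
    simp

/-- The coefficient of the first term is the augmentation of y. It vanishes for y of positive
weight, and then the Dynkin operator is linear over the adjoint action. -/
lemma dynkin_mul (x y : TensorAlgebra ℤ (A × B)) :
    dynkin A B (x * y) =
      (dynkinHom A B y (1, 0)).1 • dynkin A B x + superAd A B x (dynkin A B y) := by
  have e : dynkinHom A B y (1, 0) =
      (dynkinHom A B y (1, 0)).1 • (1, 0) + (0, dynkin A B y) := by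
    ext
    · simp
    · simp [dynkin]
  have e2 : dynkinHom A B (x * y) (1, 0) = dynkinHom A B x (dynkinHom A B y (1, 0)) := by
    rw [map_mul]; rfl
  change (dynkinHom A B (x * y) (1, 0)).2 = _
  rw [e2, e, map_add, map_zsmul, dynkinHom_snd]
  simp [dynkin]

lemma dynkin_ι (w : A × B) : dynkin A B (tι w) = tι w := by
  change (dynkinHom A B (tι w) (1, 0)).2 = _
  rw [dynkinHom, tlift_ι, dynkinLetter_apply]
  simp

lemma dynkin_one : dynkin A B 1 = 0 := by
  change (dynkinHom A B 1 (1, 0)).2 = _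
  rw [map_one]; rfl

lemma dynkinHom_mul_fst {x y : TensorAlgebra ℤ (A × B)} (hx : (dynkinHom A B x (1, 0)).1 = 0) :
    (dynkinHom A B (x * y) (1, 0)).1 = 0 := by
  have e : dynkinHom A B y (1, 0) =
      (dynkinHom A B y (1, 0)).1 • (1, 0) + (0, dynkin A B y) := by
    ext
    · simp
    · simp [dynkin]
  have e2 : dynkinHom A B (x * y) (1, 0) = dynkinHom A B x (dynkinHom A B y (1, 0)) := by
    rw [map_mul]; rfl
  rw [e2, e, map_add, map_zsmul, dynkinHom_snd]
  simp [hx]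

lemma dynkinHom_letter {k : ℕ} {x : TensorAlgebra ℤ (A × B)} (h : Letter A B k x) :
    (dynkinHom A B x (1, 0)).1 = 0 := by
  obtain _ | _ := h <;> rw [dynkinHom, tlift_ι, dynkinLetter_apply]

lemma dynkinHom_wordMon {n k : ℕ} {x : TensorAlgebra ℤ (A × B)}
    (h : WordMon (Letter A B) (n + 1) k x) : (dynkinHom A B x (1, 0)).1 = 0 := by
  obtain ⟨h, _⟩ | ⟨m, i, l, y, w, _, _, rfl, h, _⟩ := h.eq_one_or
  · omega
  · exact dynkinHom_mul_fst (dynkinHom_letter h)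

lemma dynkinHom_lieMon {n k : ℕ} {x : TensorAlgebra ℤ (A × B)} (h : LieMon (Letter A B) n k x) :
    (dynkinHom A B x (1, 0)).1 = 0 := by
  obtain ⟨n, rfl⟩ : ∃ m, n = m + 1 := ⟨n - 1, by have := h.pos; omega⟩
  exact additive_mem (Q := ⊥) (AddMonoidHom.mk' (fun x => (dynkinHom A B x (1, 0)).1)
    fun x y => by rw [map_add]; rfl) (fun x hx => dynkinHom_wordMon hx) h.mem_wordSpan

/-- The Dynkin–Specht–Wever identity. On [x, y] of weights n and m the two terms of the commutator
give m [x, y] and n [x, y]; on x² with x odd of weight n one gets n [x, x] = 2n x². -/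
lemma dynkin_lieMon {n k : ℕ} {x : TensorAlgebra ℤ (A × B)} (h : LieMon (Letter A B) n k x) :
    dynkin A B x = n • x := by
  induction h with
  | letter h => obtain _ | _ := h <;> rw [dynkin_ι, one_smul]
  | @br n k m l x y hx hy h1 h2 =>
    rw [sbr, map_sub, map_zsmul, dynkin_mul, dynkin_mul, h1, h2, dynkinHom_lieMon hx,
      dynkinHom_lieMon hy, map_nsmul, map_nsmul, superAd_lieMon_lieMon hx hy,
      superAd_lieMon_lieMon hy hx, zero_smul, zero_smul, zero_add, zero_add,
      sbr_symm l k, mul_comm l k, smul_neg, smul_neg, smul_comm n, neg_one_pow_smul_smul,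
      sub_neg_eq_add, add_comm, add_smul]
    rfl
  | @sq n k x hx hk h =>
    rw [dynkin_mul, h, dynkinHom_lieMon hx, zero_smul, zero_add, map_nsmul,
      superAd_lieMon_lieMon hx hx, sbr, (hk.mul hk).neg_one_pow, add_smul]
    simp

lemma dynkin_mem_lieSpan {n k : ℕ} {x : TensorAlgebra ℤ (A × B)} (hn : 1 ≤ n)
    (hx : x ∈ wordSpan (Letter A B) n k) : dynkin A B x ∈ lieSpan (Letter A B) n k := by
  refine additive_mem _ (fun x hx => ?_) hx
  change WordMon _ _ _ _ at hx
  rename_i hx0; clear hx0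
  induction hx with
  | nil => omega
  | @cons k n l x w hx hw ih =>
    rw [dynkin_mul]
    obtain _ | n := n
    · obtain ⟨_, rfl, rfl⟩ | ⟨m, _, _, _, _, h, _⟩ := hw.eq_one_or
      · have : dynkin A B x = x := by obtain _ | _ := hx <;> rw [dynkin_ι]
        have h1 : (1 : ℤ) • x + 0 = x := by simp
        rw [dynkin_one, map_zero, this, map_one]
        change (1 : ℤ) • x + 0 ∈ lieSpan (Letter A B) _ _
        rw [h1]
        exact AddSubgroup.subset_closure (.letter hx)
      · omega
    · rw [dynkinHom_wordMon hw, zero_smul, zero_add]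
      refine additive_mem
        (show TensorAlgebra ℤ (A × B) →+ TensorAlgebra ℤ (A × B) from superAd A B x) (fun y hy => ?_) (ih (by omega))
      have h := superAd_lieMon_lieMon (.letter hx) hy
      have h' : sbr k l x y ∈ lieSpan (Letter A B) (1 + (n + 1)) (k + l) :=
        AddSubgroup.subset_closure (.br (.letter hx) hy)
      rwa [← h] at h'

lemma diff_dynkin (i : A →+ B) (x : TensorAlgebra ℤ (A × B)) :
    diff i (dynkin A B x) = dynkin A B (diff i x) := by
  -- With the differential (m, z) ↦ (0, dz), the pair ℤ × T is a differential module over T: the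
  -- action obeys the Leibniz rule. Evaluating at the cycle (1, 0) gives the claim.
  have key (x : TensorAlgebra ℤ (A × B)) (y : ℤ × TensorAlgebra ℤ (A × B)) :
      ((0, diff i (dynkinHom A B x y).2) : ℤ × TensorAlgebra ℤ (A × B)) =
        dynkinHom A B (diff i x) y + dynkinHom A B (tmap (par A B) x) (0, diff i y.2) := by
    induction x using tensor_induction generalizing y with
    | one =>
      rw [show diff i 1 = 0 from der_one _ _, map_zero, map_one, map_one,
        map_one]
      exact (zero_add ((0, diff i y.2) : ℤ × TensorAlgebra ℤ (A × B))).symm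
    | ι w =>
      rw [diff_ι, tmap_ι, dynkinHom, tlift_ι, tlift_ι, tlift_ι, dynkinLetter_apply,
        dynkinLetter_apply, dynkinLetter_apply, zero_smul, zero_add, map_add, map_zsmul, diff_ι,
        adLetter_apply, adLetter_apply, adLetter_apply, map_sub, map_sub, diff_mul, diff_mul,
        diff_mul, diff_ι, diff_ι, diff_ι, tmap_ι, tmap_tmap, par_par, tmap_id_apply]
      have h1 : diff i (tmap (par A B) y.2) = - tmap (par A B) (diff i y.2) := by
        rw [diff, tmap_der (par_lower i), neg_neg]
      have h2 : tι (((par A B) w).1, (0 : B)) = - tι (w.1, (0 : B)) := by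
        rw [← map_neg, par_apply]; simp
      have h3 : tι (((0 : A), i (0 : A)) : A × B) = 0 := by rw [map_zero]; exact map_zero _
      have h4 : tι (((0 : A), (0 : B)) : A × B) = 0 := map_zero _
      have h5 : ((par A B) w).2 = w.2 := rfl
      rw [Prod.mk_add_mk, h1, h2, h3, h4, h5]
      congr 1
      noncomm_ring
    | mul x y' hx hy =>
      have e1 : ((0, diff i (dynkinHom A B (x * y') y).2) : ℤ × TensorAlgebra ℤ (A × B)) =
          (0, diff i (dynkinHom A B x (dynkinHom A B y' y)).2) := by rw [map_mul]; rfl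
      rw [e1, hx, hy, map_add, diff_mul, map_add, map_mul, map_mul, map_mul, map_mul, ← add_assoc]
      rfl
    | add x y' hx hy =>
      have e1 : ((0, diff i (dynkinHom A B (x + y') y).2) : ℤ × TensorAlgebra ℤ (A × B)) =
          (0, diff i (dynkinHom A B x y).2) + (0, diff i (dynkinHom A B y' y).2) := by
        rw [Prod.mk_add_mk, ← map_add, map_add]; rfl
      rw [e1, hx, hy, add_add_add_comm]
      simp only [map_add]
      rfl
    | neg x hx =>
      have e1 : ((0, diff i (dynkinHom A B (-x) y).2) : ℤ × TensorAlgebra ℤ (A × B)) =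
          -(0, diff i (dynkinHom A B x y).2) := by
        rw [Prod.neg_mk, ← map_neg, map_neg, neg_zero]; rfl
      rw [e1, hx, neg_add]
      simp only [map_neg]
      rfl
  have h1 := congrArg Prod.snd (key x (1, 0))
  rw [map_zero] at h1
  change _ = (dynkinHom A B (diff i x) (1, 0) + dynkinHom A B (tmap (par A B) x) 0).2 at h1
  rw [map_zero, add_zero] at h1
  exact h1

end Dynkin

open scoped TensorProduct

/-! ### The coproduct, convolution and the Adams operations -/

section Coproduct

variable {A B : Type*} [AddCommGroup A] [AddCommGroup B]

/-- The tensor square of a ring. -/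
abbrev Sq (R : Type*) [Ring R] : Type _ := R ⊗[ℤ] R

lemma sq_hom_ext {R M : Type*} [Ring R] [AddCommGroup M] {F G : Sq R →+ M}
    (h : ∀ x y, F (x ⊗ₜ y) = G (x ⊗ₜ y)) : F = G := by
  ext t
  induction t using TensorProduct.induction_on with
  | zero => simp
  | tmul x y => exact h x y
  | add x y hx hy => simp [hx, hy]

/-- The tensor product of two additive maps. -/
noncomputable def sqMap {R : Type*} [Ring R] (f g : R →+ R) : AddMonoid.End (Sq R) :=
  (TensorProduct.map f.toIntLinearMap g.toIntLinearMap).toAddMonoidHom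

lemma sqMap_add_left {R : Type*} [Ring R] (f f' g : R →+ R) :
    sqMap (f + f') g = sqMap f g + sqMap f' g :=
  sq_hom_ext fun x y => (TensorProduct.add_tmul (f x) (f' x) (g y))

lemma sqMap_add_right {R : Type*} [Ring R] (f g g' : R →+ R) :
    sqMap f (g + g') = sqMap f g + sqMap f g' :=
  sq_hom_ext fun x y => (TensorProduct.tmul_add (f x) (g y) (g' y))

/-- The additive map `x ⊗ y ↦ x * f y`. -/
noncomputable def sqMul {R : Type*} [Ring R] (f : R →+ R) : Sq R →+ R :=
  TensorProduct.liftAddHom (AddMonoidHom.mul.compr₂ (AddMonoidHom.id R) |>.compl₂ f)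
    fun r x y => by
      change (r • x) * f y = x * f (r • y)
      rw [map_zsmul, smul_mul_assoc, mul_smul_comm]

lemma sqMul_tmul {R : Type*} [Ring R] (f : R →+ R) (x y : R) :
    sqMul f (x ⊗ₜ y) = x * f y := rfl

/-- The action of a letter on the tensor square. -/
noncomputable def coLetter : A × B →+ AddMonoid.End (Sq (TensorAlgebra ℤ (A × B))) :=
  AddMonoidHom.mk' (fun w => sqMap (AddMonoidHom.mulLeft (tι w)) (AddMonoidHom.id _) +
      (sqMap (AddMonoidHom.id _) (AddMonoidHom.mulLeft (tι (0, w.2))) +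
        sqMap (tmap (par A B)).toAddMonoidHom (AddMonoidHom.mulLeft (tι (w.1, 0)))))
    fun v w => by
      have h1 : (((v + w).1, 0) : A × B) = (v.1, 0) + (w.1, 0) := by simp
      have h2 : ((0, (v + w).2) : A × B) = (0, v.2) + (0, w.2) := by simp
      have h (x y : TensorAlgebra ℤ (A × B)) : AddMonoidHom.mulLeft (x + y) =
          AddMonoidHom.mulLeft x + AddMonoidHom.mulLeft y := by ext; simp [add_mul]
      rw [h1, h2, map_add, map_add, map_add, h, h, h, sqMap_add_left, sqMap_add_right,
        sqMap_add_right]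
      abel

variable (A B) in
/-- The action of the tensor ring on its tensor square; it is the left multiplication by the
coproduct for which the generators are primitive. -/
noncomputable def coHom :
    TensorAlgebra ℤ (A × B) →+* AddMonoid.End (Sq (TensorAlgebra ℤ (A × B))) :=
  tlift coLetter

lemma coHom_ι (w : A × B) (x y : TensorAlgebra ℤ (A × B)) :
    coHom A B (tι w) (x ⊗ₜ y) = (tι w * x) ⊗ₜ y +
      (x ⊗ₜ (tι (0, w.2) * y) + tmap (par A B) x ⊗ₜ (tι (w.1, 0) * y)) := by
  rw [coHom, tlift_ι]; rfl

/-- Lie monomials are primitive, since primitive elements are closed under super commutators and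
under squares of odd elements. -/
lemma coHom_lieMon {n k : ℕ} {x : TensorAlgebra ℤ (A × B)} (h : LieMon (Letter A B) n k x)
    (y z : TensorAlgebra ℤ (A × B)) :
    coHom A B x (y ⊗ₜ z) = (x * y) ⊗ₜ z + (tmap (par A B))^[k] y ⊗ₜ (x * z) := by
  have add_app (t : AddMonoid.End (Sq (TensorAlgebra ℤ (A × B)))) (a b) :
    t (a + b) = t a + t b := map_add t a b
  induction h generalizing y z with
  | letter h =>
    obtain a | b := h
    · rw [coHom_ι]
      change _ + (y ⊗ₜ (tι 0 * z) + _) = _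
      rw [map_zero, zero_mul, TensorProduct.tmul_zero, zero_add]
      rfl
    · rw [coHom_ι]
      change _ + (_ + _ ⊗ₜ (tι 0 * z)) = _
      rw [map_zero, zero_mul, TensorProduct.tmul_zero, add_zero]
      rfl
  | @br n k m l x x' hx hy h1 h2 =>
    have e1 (t) : coHom A B (sbr k l x x') t = coHom A B x (coHom A B x' t) -
        (-1 : ℤ) ^ (k * l) • coHom A B x' (coHom A B x t) := by
      rw [sbr, map_sub, map_zsmul, map_mul, map_mul]; rfl
    have e2 : (tmap (par A B))^[k] ((tmap (par A B))^[l] y) = (tmap (par A B))^[k + l] y :=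
      (Function.iterate_add_apply _ _ _ _).symm
    have e3 : (tmap (par A B))^[l] ((tmap (par A B))^[k] y) = (tmap (par A B))^[k + l] y := by
      rw [add_comm]; exact (Function.iterate_add_apply _ _ _ _).symm
    rw [e1, h1, h2, add_app, add_app, h1, h1, h2, h2, iterate_par_mul, iterate_par_mul, e2, e3,
      iterate_par_eq k (par_lieMon hy), iterate_par_eq l (par_lieMon hx), mul_comm l k, sbr]
    obtain h | h := neg_one_pow_eq_or ℤ (k * l) <;> rw [h] <;>
      simp only [one_smul, neg_smul, sub_neg_eq_add, neg_mul, sub_mul, add_mul,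
        TensorProduct.sub_tmul, TensorProduct.add_tmul, TensorProduct.neg_tmul,
        TensorProduct.tmul_sub, TensorProduct.tmul_add, mul_assoc] <;> abel
  | @sq n k x hx hk h =>
    have e1 (t) : coHom A B (x * x) t = coHom A B x (coHom A B x t) := by
      rw [map_mul]; rfl
    have e2 : (tmap (par A B))^[k] ((tmap (par A B))^[k] y) = (tmap (par A B))^[k + k] y :=
      (Function.iterate_add_apply _ _ _ _).symm
    rw [e1, h, add_app, h, h, iterate_par_mul, e2,
      iterate_par_eq k (par_lieMon hx), (hk.mul hk).neg_one_pow]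
    simp only [neg_smul, one_smul, neg_mul, TensorProduct.neg_tmul, mul_assoc]
    abel

/-- The differential of the tensor square. -/
noncomputable def sqDiff (i : A →+ B) : AddMonoid.End (Sq (TensorAlgebra ℤ (A × B))) :=
  sqMap (diff i) (AddMonoidHom.id _) + sqMap (tmap (par A B)).toAddMonoidHom (diff i)

lemma sqDiff_tmul (i : A →+ B) (x y : TensorAlgebra ℤ (A × B)) :
    sqDiff i (x ⊗ₜ y) = diff i x ⊗ₜ y + tmap (par A B) x ⊗ₜ diff i y := rfl

/-- This says that the coproduct commutes with the differentials, written as a Leibniz rule for the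
action on the tensor square. -/
lemma sqDiff_coHom (i : A →+ B) (x : TensorAlgebra ℤ (A × B)) :
    sqDiff i * coHom A B x = coHom A B (diff i x) + coHom A B (tmap (par A B) x) * sqDiff i := by
  induction x using tensor_induction with
  | one =>
    rw [show diff i 1 = 0 from der_one _ _, map_zero, map_one, map_one, map_one, mul_one,
      one_mul, zero_add]
  | ι w =>
    refine sq_hom_ext fun x y => ?_
    change sqDiff i (coHom A B (tι w) (x ⊗ₜ y)) = coHom A B (diff i (tι w)) (x ⊗ₜ y) +
      coHom A B (tmap (par A B) (tι w)) (sqDiff i (x ⊗ₜ y))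
    have h1 : diff i (tmap (par A B) x) = - tmap (par A B) (diff i x) := by
      rw [diff, tmap_der (par_lower i), neg_neg]
    have h2 : tι (((par A B) w).1, (0 : B)) = - tι (w.1, (0 : B)) := by
      rw [← map_neg, par_apply]; simp
    have h3 : tι (((0 : A), i (0 : A)) : A × B) = 0 := by rw [map_zero]; exact map_zero _
    have h4 : tι (((0 : A), (0 : B)) : A × B) = 0 := map_zero _
    have h5 : ((par A B) w).2 = w.2 := rfl
    have h6 : tmap (par A B) (tmap (par A B) x) = x := by
      rw [tmap_tmap, par_par, tmap_id_apply]
    have h7 : tι (par A B w) = tι (0, w.2) - tι (w.1, 0) := by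
      rw [← map_sub]; simp [par_apply]
    have h8 : tι w = tι (0, w.2) + tι (w.1, 0) := by
      rw [← map_add]; simp
    rw [diff_ι, tmap_ι, sqDiff_tmul, map_add, coHom_ι, coHom_ι, coHom_ι, coHom_ι, map_add, map_add,
      sqDiff_tmul, sqDiff_tmul, sqDiff_tmul, diff_mul, diff_mul, diff_mul, diff_ι, diff_ι, diff_ι,
      map_mul, tmap_ι, tmap_ι, tmap_ι, h1, h2, h3, h5, h6, h7]
    have h9 : tι (par A B ((0 : A), w.2)) = tι (0, w.2) := by simp [par_apply]
    have h10 : tι (par A B (w.1, (0 : B))) = - tι (w.1, (0 : B)) := by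
      rw [← map_neg]; simp [par_apply]
    rw [h9, h10, h4, zero_mul, TensorProduct.tmul_zero]
    simp only [TensorProduct.add_tmul, TensorProduct.sub_tmul, TensorProduct.neg_tmul,
      TensorProduct.tmul_add, TensorProduct.tmul_neg, zero_add, sub_mul, neg_mul]
    abel
  | mul x y hx hy =>
    rw [map_mul, ← mul_assoc, hx, add_mul, mul_assoc, hy, diff_mul, map_add, map_mul, map_mul,
      map_mul, map_mul]
    noncomm_ring
  | add x y hx hy => rw [map_add, mul_add, hx, hy, map_add, map_add, map_add, map_add]; noncomm_ring
  | neg x hx =>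
    rw [map_neg, map_neg, map_neg, map_neg, map_neg]
    ext t
    have := DFunLike.congr_fun hx t
    change sqDiff i (-(coHom A B x t)) = -(coHom A B (diff i x) t) +
      -(coHom A B (tmap (par A B) x) (sqDiff i t))
    rw [map_neg, ← neg_add]
    exact congrArg Neg.neg this

/-- The convolution product of the identity and of `f`. -/
noncomputable def conv (f : TensorAlgebra ℤ (A × B) →+ TensorAlgebra ℤ (A × B)) :
    TensorAlgebra ℤ (A × B) →+ TensorAlgebra ℤ (A × B) :=
  AddMonoidHom.mk' (fun x => sqMul f (coHom A B x (1 ⊗ₜ 1))) fun x y => by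
    rw [map_add, ← map_add (sqMul f)]; rfl

/-- The convolution is the composite of the coproduct, of 1 ⊗ f and of the multiplication, all
compatible with the differentials; moreover 1 ⊗ 1 is a cycle. -/
lemma diff_conv (i : A →+ B) {f : TensorAlgebra ℤ (A × B) →+ TensorAlgebra ℤ (A × B)}
    (hf : ∀ x, diff i (f x) = f (diff i x)) (x : TensorAlgebra ℤ (A × B)) :
    diff i (conv f x) = conv f (diff i x) := by
  have h1 : (diff i).comp (sqMul f) = (sqMul f).comp (sqDiff i) := sq_hom_ext fun x y => by
    change diff i (x * f y) = sqMul f (sqDiff i (x ⊗ₜ y))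
    rw [diff_mul, hf, sqDiff_tmul, map_add]; rfl
  have h2 : sqDiff i (1 ⊗ₜ 1) = 0 := by
    rw [sqDiff_tmul, show diff i 1 = 0 from der_one _ _]; simp
  have h3 := DFunLike.congr_fun (sqDiff_coHom i x) (1 ⊗ₜ 1)
  change sqDiff i (coHom A B x (1 ⊗ₜ 1)) = coHom A B (diff i x) (1 ⊗ₜ 1) +
    coHom A B (tmap (par A B) x) (sqDiff i (1 ⊗ₜ 1)) at h3
  rw [h2] at h3
  refine (DFunLike.congr_fun h1 _).trans (congrArg (sqMul f) ?_)
  refine h3.trans ?_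
  simp

lemma par_prodMon {j n k : ℕ} {x : TensorAlgebra ℤ (A × B)} (h : ProdMon (Letter A B) j n k x) :
    tmap (par A B) x = (-1 : ℤ) ^ k • x := by
  induction h with
  | nil => simp
  | cons h _ ih =>
    simp only [map_mul, par_lieMon h, ih, smul_mul_assoc, mul_smul_comm, smul_smul, pow_add]
    rw [mul_comm]

/-- Each primitive factor goes to one of the two sides of the tensor product, so the numbers of
factors on the two sides add up to j. -/
lemma coHom_prodMon {j n k : ℕ} {x : TensorAlgebra ℤ (A × B)} (h : ProdMon (Letter A B) j n k x) :
    coHom A B x (1 ⊗ₜ 1) ∈ AddSubgroup.closure {t | ∃ i m n₁ n₂ k₁ k₂ y z,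
      ProdMon (Letter A B) i n₁ k₁ y ∧ ProdMon (Letter A B) m n₂ k₂ z ∧
      i + m = j ∧ n₁ + n₂ = n ∧ k₁ + k₂ = k ∧ t = y ⊗ₜ z} := by
  induction h with
  | nil =>
    rw [map_one]
    exact AddSubgroup.subset_closure ⟨0, 0, 0, 0, 0, 0, 1, 1, .nil, .nil, rfl, rfl, rfl, rfl⟩
  | @cons j n k m l ℓ x hℓ hx ih =>
    have e1 : coHom A B (ℓ * x) (1 ⊗ₜ 1) = coHom A B ℓ (coHom A B x (1 ⊗ₜ 1)) := by
      rw [map_mul]; rfl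
    rw [e1]
    refine additive_mem (show _ →+ _ from coHom A B ℓ) ?_ ih
    rintro _ ⟨i, q, n₁, n₂, k₁, k₂, y, z, hy, hz, hi, hn, hk, rfl⟩
    change coHom A B ℓ (y ⊗ₜ z) ∈ _
    rw [coHom_lieMon hℓ, iterate_par_eq k (par_prodMon hy)]
    rw [← TensorProduct.smul_tmul']
    refine AddSubgroup.add_mem _ (AddSubgroup.subset_closure ?_)
      (AddSubgroup.zsmul_mem _ (AddSubgroup.subset_closure ?_) _)
    · exact ⟨i + 1, q, _, _, _, _, _, _, .cons hℓ hy, hz, by omega, by omega, by omega, rfl⟩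
    · exact ⟨i, q + 1, _, _, _, _, _, _, hy, .cons hℓ hz, by omega, by omega, by omega, rfl⟩

/-- `f` preserves the filtration by the number of factors, and it acts as the multiplication
by `c ^ j` on its `j`th graded piece. -/
structure Scales (f : TensorAlgebra ℤ (A × B) →+ TensorAlgebra ℤ (A × B)) (c : ℤ) : Prop where
  one : f 1 = 1
  succ {j n k : ℕ} {x : TensorAlgebra ℤ (A × B)} (h : ProdMon (Letter A B) (j + 1) n k x) :
    f x - c ^ (j + 1) • x ∈ prodSpan (Letter A B) j n k

variable {f : TensorAlgebra ℤ (A × B) →+ TensorAlgebra ℤ (A × B)} {c : ℤ}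

lemma Scales.mem (hf : Scales f c) {j n k : ℕ} {x : TensorAlgebra ℤ (A × B)}
    (h : ProdMon (Letter A B) j n k x) : f x ∈ prodSpan (Letter A B) j n k := by
  obtain _ | j := j
  · obtain _ | _ := h
    rw [hf.one]
    exact ProdMon.nil.mem
  · rw [← sub_add_cancel (f x) (c ^ (j + 1) • x)]
    exact AddSubgroup.add_mem _ (prodSpan_mono (by omega) (hf.succ h))
      (AddSubgroup.zsmul_mem _ h.mem _)

/-- Up to products of fewer factors, f takes out one Lie factor at the cost of c: both sides agree
with c ^ (j + 1) times the product. -/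
lemma Scales.mul_sub_mem (hf : Scales f c) {n₁ k₁ j n k : ℕ} {ℓ x : TensorAlgebra ℤ (A × B)}
    (hℓ : LieMon (Letter A B) n₁ k₁ ℓ) (h : ProdMon (Letter A B) j n k x) :
    f (ℓ * x) - c • (ℓ * f x) ∈ prodSpan (Letter A B) j (n₁ + n) (k₁ + k) := by
  have h1 := hf.succ (ProdMon.cons hℓ h)
  obtain _ | j := j
  · obtain _ | _ := h
    rw [hf.one]
    simpa using h1
  · have h2 := prodSpan_mul hℓ.prodMon.mem (hf.succ h)
    rw [add_comm 1 j] at h2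
    have h3 := AddSubgroup.sub_mem _ h1 (AddSubgroup.zsmul_mem _ h2 c)
    rw [mul_sub, mul_smul_comm, smul_sub, smul_smul, ← pow_succ'] at h3
    rwa [sub_sub_sub_cancel_right] at h3

/-- The coproduct sends the primitive ℓ to the left, contributing 1, or to the right, where f scales
it by c. Bringing it back to the front costs only products of fewer factors, so the total is c + 1.
-/
lemma Scales.conv_mul (hf : Scales f c) {n₁ k₁ j n k : ℕ} {ℓ x : TensorAlgebra ℤ (A × B)}
    (hℓ : LieMon (Letter A B) n₁ k₁ ℓ) (h : ProdMon (Letter A B) j n k x) :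
    conv f (ℓ * x) - (c + 1) • (ℓ * conv f x) ∈ prodSpan (Letter A B) j (n₁ + n) (k₁ + k) := by
  have e1 : coHom A B (ℓ * x) (1 ⊗ₜ 1) = coHom A B ℓ (coHom A B x (1 ⊗ₜ 1)) := by
    rw [map_mul]; rfl
  change sqMul f _ - (c + 1) • (ℓ * sqMul f _) ∈ _
  rw [e1]
  refine additive_mem ((sqMul f).comp (show Sq (TensorAlgebra ℤ (A × B)) →+ _ from coHom A B ℓ) -
    (c + 1) • ((AddMonoidHom.mulLeft ℓ).comp (sqMul f))) ?_ (coHom_prodMon h)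
  rintro _ ⟨i, q, m₁, m₂, l₁, l₂, y, z, hy, hz, rfl, rfl, rfl, rfl⟩
  change sqMul f (coHom A B ℓ (y ⊗ₜ z)) - (c + 1) • (ℓ * (y * f z)) ∈ _
  rw [coHom_lieMon hℓ, iterate_par_eq k₁ (par_prodMon hy), map_add, sqMul_tmul, sqMul_tmul]
  -- `h1` replaces f (ℓ * z) by c • (ℓ * f z) behind y, and `h2` moves ℓ across y.
  have h1 := prodSpan_mul hy.mem (hf.mul_sub_mem hℓ hz)
  have h2 := prodSpan_mul (ProdMon.comm hℓ hy) (hf.mem hz)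
  rw [← add_assoc, ← add_assoc, add_comm m₁, add_comm l₁] at h1
  rw [← add_assoc, ← add_assoc]
  have h3 := AddSubgroup.sub_mem _ (AddSubgroup.zsmul_mem _ h1 ((-1) ^ (k₁ * l₁)))
    (AddSubgroup.zsmul_mem _ h2 c)
  convert h3 using 1
  simp only [mul_sub, sub_mul, smul_sub, smul_mul_assoc, mul_smul_comm, mul_assoc, add_smul,
    one_smul, smul_comm c ((-1 : ℤ) ^ (k₁ * l₁))]
  abel

lemma Scales.conv (hf : Scales f c) : Scales (conv f) (c + 1) := by
  have one : LieDecalage.conv f 1 = 1 := by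
    change sqMul f (coHom A B 1 (1 ⊗ₜ 1)) = 1
    rw [map_one]
    change 1 * f 1 = 1
    rw [hf.one, one_mul]
  refine ⟨one, fun {j n k x} h => ?_⟩
  generalize hj : j + 1 = j' at h
  induction h generalizing j with
  | nil => omega
  | @cons j' n k m l ℓ x hℓ hx ih =>
    obtain rfl : j = j' := by omega
    have h1 := hf.conv_mul hℓ hx
    obtain _ | j := j
    · obtain _ | _ := hx
      rw [one] at h1
      simpa using h1
    · have h2 := AddSubgroup.zsmul_mem _ (prodSpan_mul hℓ.prodMon.mem (ih rfl)) (c + 1)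
      rw [add_comm 1 j] at h2
      have h3 := AddSubgroup.add_mem _ h1 h2
      rw [mul_sub, mul_smul_comm, smul_sub, smul_smul, ← pow_succ'] at h3
      rwa [sub_add_sub_cancel] at h3

/-- The convolution powers of the identity. -/
noncomputable def adams :
    ℕ → TensorAlgebra ℤ (A × B) →+ TensorAlgebra ℤ (A × B)
  | 0 => (tmap 0).toAddMonoidHom
  | g + 1 => conv (adams g)

lemma diff_adams (i : A →+ B) (g : ℕ) (x : TensorAlgebra ℤ (A × B)) :
    diff i (adams g x) = adams g (diff i x) := by
  induction g generalizing x with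
  | zero =>
    have h (y : TensorAlgebra ℤ (A × B)) :
        diff i (tmap (0 : A × B →+ A × B) y) = 0 ∧ tmap (0 : A × B →+ A × B) (diff i y) = 0 := by
      induction y using tensor_induction with
      | one => rw [map_one, show diff i 1 = 0 from der_one _ _, map_zero]; exact ⟨rfl, rfl⟩
      | ι v => simp [tmap_ι, diff_ι]
      | mul x y hx hy => simp [diff_mul, hx, hy]
      | add x y hx hy => simp [hx, hy]
      | neg x hx => simp [hx]
    exact (h x).1.trans (h x).2.symm
  | succ g ih => exact diff_conv i ih x

/-- The zeroth power is the augmentation, which kills every Lie monomial; each further convolution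
with the identity raises the scaling factor by one. -/
lemma scales_adams (g : ℕ) : Scales (adams (A := A) (B := B) g) g := by
  induction g with
  | zero =>
    have h {n k : ℕ} {x : TensorAlgebra ℤ (A × B)} (h : LieMon (Letter A B) n k x) :
        (tmap 0 x : TensorAlgebra ℤ (A × B)) = 0 := by
      induction h with
      | letter h => obtain _ | _ := h <;> simp [tmap_ι]
      | br _ _ h1 h2 => simp [sbr, h1, h2]
      | sq _ _ h => simp [h]
    refine ⟨map_one (tmap 0), fun {j n k x} hx => ?_⟩
    obtain _ | ⟨h1, h2⟩ := hx
    rename_i ℓ w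
    have : adams 0 (ℓ * w) = 0 := by
      change tmap 0 (ℓ * w) = 0
      rw [map_mul, h h1, zero_mul]
    rw [this]
    simp
  | succ g ih =>
    rw [Nat.cast_succ]
    exact ih.conv

end Coproduct

/-! ### Projecting short products to Lie elements at a prime, and words in two letters -/

section Coproduct

variable {A B : Type*} [AddCommGroup A] [AddCommGroup B]

lemma prodSpan_zero {R : Type*} [Ring R] {S : ℕ → R → Prop} {n k : ℕ} (hn : 1 ≤ n) :
    prodSpan S 0 n k = ⊥ := by
  rw [eq_bot_iff]
  refine (AddSubgroup.closure_le _).mpr ?_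
  rintro x ⟨i, hi, h⟩
  obtain _ | _ := h
  · omega
  · omega

/-- For a single Lie factor the error term lies in the span of empty products, which is zero in
positive weight; the scaling is exact. -/
lemma adams_lieSpan (g : ℕ) {n k : ℕ} {x : TensorAlgebra ℤ (A × B)} (hn : 1 ≤ n)
    (hx : x ∈ lieSpan (Letter A B) n k) : adams g x = (g : ℤ) • x := by
  refine sub_eq_zero.mp (additive_mem (Q := ⊥) (adams g - (g : ℤ) • AddMonoidHom.id _)
    (fun y hy => ?_) hx)
  have := (scales_adams g).succ (LieMon.prodMon hy)
  rw [prodSpan_zero hn, zero_add, pow_one] at this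
  exact this

/-- A combination of Adams operations lowering the number of factors of a product. -/
noncomputable def adamsProd (g : ℕ) : ℕ → TensorAlgebra ℤ (A × B) →+ TensorAlgebra ℤ (A × B)
  | 0 => AddMonoidHom.id _
  | j + 1 => (adamsProd g j).comp (adams g - ((g : ℤ) ^ (j + 2)) • AddMonoidHom.id _)

lemma adamsProd_succ (g j : ℕ) (x : TensorAlgebra ℤ (A × B)) :
    adamsProd g (j + 1) x = adamsProd g j (adams g x - (g : ℤ) ^ (j + 2) • x) := rfl

lemma diff_adamsProd (i : A →+ B) (g j : ℕ) (x : TensorAlgebra ℤ (A × B)) :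
    diff i (adamsProd g j x) = adamsProd g j (diff i x) := by
  induction j generalizing x with
  | zero => rfl
  | succ j ih =>
    rw [adamsProd_succ, adamsProd_succ, ih, map_sub (diff i), diff_adams, map_zsmul]

lemma adamsProd_lieSpan (g j : ℕ) {n k : ℕ} {x : TensorAlgebra ℤ (A × B)} (hn : 1 ≤ n)
    (hx : x ∈ lieSpan (Letter A B) n k) :
    adamsProd g j x = (∏ l ∈ Finset.range j, ((g : ℤ) - (g : ℤ) ^ (l + 2))) • x := by
  induction j with
  | zero => simp [adamsProd]
  | succ j ih =>
    rw [adamsProd_succ, adams_lieSpan g hn hx, ← sub_smul, map_zsmul, ih, smul_smul,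
      Finset.prod_range_succ, mul_comm]

/-- The factor with the constant g ^ (j + 2) kills the graded piece of products of j + 2 Lie
elements; applied in turn, the factors lower the filtration to single Lie elements. -/
lemma adamsProd_mem (g j : ℕ) {n k : ℕ} {x : TensorAlgebra ℤ (A × B)} (hn : 1 ≤ n)
    (hx : x ∈ prodSpan (Letter A B) (j + 1) n k) :
    adamsProd g j x ∈ lieSpan (Letter A B) n k := by
  induction j generalizing x with
  | zero => exact prodSpan_one_le n k hn hx
  | succ j ih =>
    rw [adamsProd_succ]
    refine ih (additive_mem (adams g - (g : ℤ) ^ (j + 2) • AddMonoidHom.id _) ?_ hx)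
    rintro y ⟨i, hi, hy⟩
    change adams g y - (g : ℤ) ^ (j + 2) • y ∈ _
    obtain hi | rfl := Nat.lt_or_eq_of_le hi
    · exact AddSubgroup.sub_mem _ (prodSpan_mono (by omega) ((scales_adams g).mem hy))
        (AddSubgroup.zsmul_mem _ (prodSpan_mono (by omega) hy.mem) _)
    · exact (scales_adams g).succ hy

/-- Take g to be a primitive root modulo p. A congruence between g and g ^ (l + 2) would give g ^ (l
+ 1) = 1 with 0 < l + 1 < p - 1. -/
lemma exists_adams_coprime {p : ℕ} (hp : p.Prime) :
    ∃ g : ℕ, IsCoprime (∏ l ∈ Finset.range (p - 2), ((g : ℤ) - (g : ℤ) ^ (l + 2))) p := by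
  have : Fact p.Prime := ⟨hp⟩
  obtain ⟨ζ, hζ⟩ := IsCyclic.exists_generator (α := (ZMod p)ˣ)
  have ho : orderOf ζ = p - 1 := by
    rw [orderOf_eq_card_of_forall_mem_zpowers hζ, Nat.card_eq_fintype_card, ZMod.card_units]
  refine ⟨(ζ : ZMod p).val, IsCoprime.prod_left fun l hl => ?_⟩
  rw [Finset.mem_range] at hl
  refine IsCoprime.symm ((Nat.prime_iff_prime_int.mp hp).coprime_iff_not_dvd.mpr fun h => ?_)
  rw [← ZMod.intCast_zmod_eq_zero_iff_dvd] at h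
  push_cast at h
  rw [ZMod.natCast_zmod_val, sub_eq_zero, pow_succ', ← Units.val_pow_eq_pow_val, eq_comm] at h
  have h1 : ζ ^ (l + 1) = 1 := by
    ext
    simpa using h
  have h2 := Nat.le_of_dvd (by omega) (orderOf_dvd_of_pow_eq_one h1)
  omega

/-- The multiples of two fixed letters. -/
inductive TwoLetter (a : A) (b : B) : ℕ → TensorAlgebra ℤ (A × B) → Prop
  | odd : TwoLetter a b 1 (tι (a, 0))
  | even : TwoLetter a b 0 (tι (0, b))

lemma TwoLetter.letter {a : A} {b : B} {k : ℕ} {x : TensorAlgebra ℤ (A × B)}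
    (h : TwoLetter a b k x) : Letter A B k x := by
  obtain _ | _ := h
  · exact .odd a
  · exact .even b

lemma WordMon.mono {R : Type*} [Ring R] {S S' : ℕ → R → Prop} (h : ∀ k x, S k x → S' k x)
    {n k : ℕ} {x : R} (hx : WordMon S n k x) : WordMon S' n k x := by
  induction hx with
  | nil => exact .nil
  | cons h1 _ ih => exact .cons (h _ _ h1) ih

lemma WordMon.degree_le {R : Type*} [Ring R] {S : ℕ → R → Prop} (hS : ∀ k x, S k x → k ≤ 1)
    {n k : ℕ} {x : R} (h : WordMon S n k x) : k ≤ n := by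
  induction h with
  | nil => exact le_rfl
  | cons h1 _ ih => have := hS _ _ h1; omega

lemma TwoLetter.le_one {a : A} {b : B} (k : ℕ) (x : TensorAlgebra ℤ (A × B))
    (h : TwoLetter a b k x) : k ≤ 1 := h.letter.le_one

/-- The single odd letter is moved to the front. Each passage across b leaves a commutator [b, a], a
Lie element absorbing two letters, hence a product of at most n factors in weight n + 1. -/
lemma WordMon.exists_odd_mul {a : A} {b : B} {n : ℕ} {x : TensorAlgebra ℤ (A × B)}
    (h : WordMon (TwoLetter a b) (n + 1) 1 x) : ∃ v, WordMon (TwoLetter a b) n 0 v ∧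
      x - tι (a, 0) * v ∈ prodSpan (Letter A B) n (n + 1) 1 := by
  generalize hn : n + 1 = n' at h
  generalize hk : 1 = k at h
  induction h generalizing n with
  | nil => omega
  | @cons k m l y w hy hw ih =>
    obtain rfl : n = m := by omega
    obtain _ | _ := hy
    · obtain rfl : l = 0 := by omega
      exact ⟨w, hw, by simp⟩
    · obtain rfl : l = 1 := by omega
      have := hw.degree_le TwoLetter.le_one
      obtain ⟨n, rfl⟩ := Nat.exists_eq_add_of_le' this
      obtain ⟨v, hv, hv'⟩ := ih rfl rfl
      refine ⟨tι (0, b) * v, by rw [add_comm n 1]; exact .cons .even hv, ?_⟩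
      have h1 := prodSpan_mul (LieMon.prodMon (S := Letter A B) (.letter (.even b))).mem hv'
      have h2 := prodSpan_mul (LieMon.prodMon (LieMon.br (S := Letter A B) (.letter (.even b))
        (.letter (.odd a)))).mem (hv.mono fun _ _ h => h.letter).prodMon.mem
      rw [add_comm 1 (n + 1), zero_add, add_comm 1 n] at h1
      rw [show 1 + 1 + n = n + 1 + 1 by omega, zero_add, add_zero, add_comm 1 n] at h2
      have h3 := AddSubgroup.add_mem _ h1 h2
      rw [add_comm 1 (n + 1), zero_add]
      convert h3 using 1
      simp only [sbr, mul_sub, sub_mul, mul_assoc, zero_mul, pow_zero, one_smul]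
      abel

/-- Two odd letters of the word can be made adjacent modulo shorter products, and a * a is a single
Lie monomial because squares of odd elements are allowed. This saves one factor. -/
lemma WordMon.mem_prodSpan {a : A} {b : B} {n k : ℕ} {x : TensorAlgebra ℤ (A × B)}
    (h : WordMon (TwoLetter a b) (n + 1) (k + 2) x) :
    x ∈ prodSpan (Letter A B) n (n + 1) (k + 2) := by
  generalize hn : n + 1 = n' at h ⊢
  generalize hk : k + 2 = k' at h ⊢
  induction h generalizing n k with
  | nil => omega
  | @cons k'' m l y w hy hw ih =>
    obtain rfl : n = m := by omega
    have h1 := hw.degree_le TwoLetter.le_one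
    obtain ⟨n, rfl⟩ : ∃ n', n = n' + 1 := ⟨n - 1, by have := hy.le_one; omega⟩
    by_cases hl : 2 ≤ l
    · obtain ⟨l', rfl⟩ := Nat.exists_eq_add_of_le' hl
      have := prodSpan_mul (LieMon.letter hy.letter).prodMon.mem (ih rfl rfl)
      rwa [add_comm 1 n] at this
    · obtain rfl : l = 1 := by have := hy.le_one; omega
      obtain rfl : k'' = 1 := by have := hy.le_one; omega
      obtain _ | _ := hy
      obtain ⟨v, hv, hv'⟩ := hw.exists_odd_mul
      have h1 := prodSpan_mul (LieMon.prodMon (S := Letter A B) (.letter (.odd a))).mem hv'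
      have h2 := prodSpan_mul (LieMon.prodMon (LieMon.sq (S := Letter A B) (.letter (.odd a))
        (by simp))).mem (hv.mono fun _ _ h => h.letter).prodMon.mem
      rw [add_comm 1 n] at h1
      rw [show 1 + 1 + n = 1 + (n + 1) by omega, add_zero, add_comm 1 n] at h2
      have h3 := AddSubgroup.add_mem _ h1 h2
      rwa [mul_assoc, ← mul_add, sub_add_cancel] at h3

end Coproduct

/-! ### An eigenvalue argument modulo boundaries -/

section Eigenspaces

variable {M : Type*} [AddCommGroup M]

/-- The product of the endomorphisms `E - c` for `1 ≤ c ≤ m`. -/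
def descend (E : M →+ M) : ℕ → M →+ M
  | 0 => AddMonoidHom.id M
  | m + 1 => (E - ((m + 1 : ℕ) : ℤ) • AddMonoidHom.id M).comp (descend E m)

lemma descend_succ (E : M →+ M) (m : ℕ) (x : M) :
    descend E (m + 1) x = E (descend E m x) - ((m + 1 : ℕ) : ℤ) • descend E m x := rfl

lemma descend_eq_zero {E : M →+ M} {c m : ℕ} {x : M} (hx : E x = c • x) (hc : 1 ≤ c)
    (hm : c ≤ m) : descend E m x = 0 := by
  have h (m : ℕ) : E (descend E m x) = c • descend E m x := by
    induction m with
    | zero => exact hx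
    | succ m ih => rw [descend_succ, map_sub, map_zsmul, ih, map_nsmul, ih, smul_sub,
        smul_comm ((m + 1 : ℕ) : ℤ) c]
  induction m, hm using Nat.le_induction with
  | base =>
    obtain ⟨m, rfl⟩ := Nat.exists_eq_add_of_le' hc
    rw [descend_succ, h, natCast_zsmul, sub_self]
  | succ m _ ih => rw [descend_succ, ih]; simp

variable {E : M →+ M} {Z N : AddSubgroup M}

/-- Modulo N the endomorphism E is zero on Z, so the product of the E - c acts as the product of the
-c. -/
lemma descend_mem (hN : N ≤ Z) (hE : ∀ z ∈ Z, E z ∈ N) (m : ℕ) {z : M} (hz : z ∈ Z) :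
    descend E m z ∈ Z ∧ descend E m z - ((-1) ^ m * (m.factorial : ℤ)) • z ∈ N := by
  induction m with
  | zero => simpa [descend, N.zero_mem] using hz
  | succ m ih =>
    refine ⟨AddSubgroup.sub_mem _ (hN (hE _ ih.1)) (AddSubgroup.zsmul_mem _ ih.1 _), ?_⟩
    have := AddSubgroup.sub_mem _ (hE _ ih.1) (AddSubgroup.zsmul_mem _ ih.2 ((m + 1 : ℕ) : ℤ))
    rw [descend_succ]
    convert this using 1
    have h1 : (-1 : ℤ) ^ (m + 1) * ((m + 1).factorial : ℤ) =
        -(((m + 1 : ℕ) : ℤ) * ((-1) ^ m * m.factorial)) := by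
      rw [Nat.factorial_succ]; push_cast; ring
    rw [h1, neg_smul, smul_sub, smul_smul]
    abel

/-- The components of a cycle on which a nullhomotopic derivation has the eigenvalues
`1, …, p - 1` are boundaries, if the boundaries contain the `p`-fold multiples of all cycles. -/
lemma sub_sub_mem_of_eigen {p : ℕ} (hp : p.Prime) (hN : N ≤ Z) (hE : ∀ z ∈ Z, E z ∈ N)
    (hpZ : ∀ z ∈ Z, p • z ∈ N) {P Q : M →+ M} (hP : ∀ z ∈ Z, P z ∈ Z) (hQ : ∀ z ∈ Z, Q z ∈ Z)
    {W : ℕ → Set M} (hW : ∀ c, ∀ w ∈ W c, E w = c • w) (hP0 : ∀ c < p, ∀ w ∈ W c, P w = 0)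
    (hP1 : ∀ w ∈ W p, P w = w) (hQ0 : ∀ c, 1 ≤ c → ∀ w ∈ W c, Q w = 0)
    (hQ1 : ∀ w ∈ W 0, Q w = w) {x : M} (hx : x ∈ Z)
    (hxW : x ∈ AddSubgroup.closure {y | ∃ c ≤ p, y ∈ W c}) : x - P x - Q x ∈ N := by
  set y := x - P x - Q x with hy
  have hyZ : y ∈ Z := AddSubgroup.sub_mem _ (AddSubgroup.sub_mem _ hx (hP _ hx)) (hQ _ hx)
  -- Subtracting P x and Q x removes the eigenvalues p and 0; the remaining ones, from 1 to p - 1,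
  -- are annihilated by `descend`.
  have h0 : descend E (p - 1) y = 0 := by
    refine additive_mem (Q := ⊥) ((descend E (p - 1)).comp (AddMonoidHom.id M - P - Q)) ?_ hxW
    rintro w ⟨c, hc, hw⟩
    change descend E (p - 1) (w - P w - Q w) = 0
    obtain hc | rfl := Nat.lt_or_eq_of_le hc
    · rw [hP0 c hc w hw]
      obtain rfl | hc' := Nat.eq_zero_or_pos c
      · rw [hQ1 w hw]; simp
      · rw [hQ0 c hc' w hw, sub_zero, sub_zero]
        exact descend_eq_zero (hW c w hw) hc' (by omega)
    · rw [hP1 w hw, hQ0 _ hp.one_le w hw]; simp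
  have h1 := (descend_mem hN hE (p - 1) hyZ).2
  rw [h0, zero_sub, ← neg_smul] at h1
  -- Both (p - 1)! and p send y into N, up to sign, and they are coprime.
  have hco : IsCoprime (-((-1) ^ (p - 1) * ((p - 1).factorial : ℤ))) (p : ℤ) := by
    have : IsCoprime ((p - 1).factorial : ℤ) (p : ℤ) :=
      Nat.isCoprime_iff_coprime.mpr
        (hp.coprime_factorial_of_lt (by have := hp.pos; omega)).symm
    rw [← neg_mul]
    refine IsCoprime.mul_left ?_ this
    have hu : IsUnit (-(-1 : ℤ) ^ (p - 1)) := ((isUnit_one.neg).pow _).neg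
    exact isCoprime_of_dvd _ _ (fun h => hu.ne_zero h.1) fun z hz _ hzu _ =>
      hz (isUnit_of_dvd_unit hzu hu)
  obtain ⟨a, b, hab⟩ := hco
  have := AddSubgroup.add_mem _ (AddSubgroup.zsmul_mem _ h1 a)
    (AddSubgroup.zsmul_mem _ (hpZ y hyZ) b)
  rwa [← natCast_zsmul, smul_smul, smul_smul, ← add_smul, hab, one_smul] at this

end Eigenspaces

/-! ### Cycles and boundaries for a split injection A → B -/

section Koszul

variable {A B : Type*} [AddCommGroup A] [AddCommGroup B]

lemma tmap_zero_eq_zero {V V' : Type*} [AddCommGroup V] [AddCommGroup V'] [Module ℤ V]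
    [Module ℤ V'] {S : ℕ → TensorAlgebra ℤ V → Prop} (hS : ∀ k x, S k x → ∃ v, x = tι v)
    {f : V →+ V'} (hf : f = 0) {n k : ℕ}
    {x : TensorAlgebra ℤ V} (hn : 1 ≤ n) (hx : x ∈ wordSpan S n k) : tmap f x = 0 := by
  subst hf
  refine additive_mem (Q := ⊥) (tmap (0 : V →+ V')).toAddMonoidHom (fun w hw => ?_) hx
  change tmap 0 w = 0
  obtain ⟨h, _⟩ | ⟨m, i, l, y, w, _, _, rfl, h, _⟩ := WordMon.eq_one_or hw
  · omega
  · obtain ⟨v, rfl⟩ := hS _ _ h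
    rw [map_mul, tmap_ι]; simp

lemma Letter.exists_eq (k : ℕ) (x : TensorAlgebra ℤ (A × B)) (h : Letter A B k x) :
    ∃ v, x = tι v := by
  obtain a | b := h
  · exact ⟨_, rfl⟩
  · exact ⟨_, rfl⟩

variable (i : A →+ B) (r : B →+ A)

/-- The projection to the kernel of the retraction `r`. -/
def kerProj : A × B →+ A × B := (0 : A →+ A).prodMap (AddMonoidHom.id B - i.comp r)

/-- The endomorphism of `A × B` given by an endomorphism of `A`. -/
def spread (π : A →+ A) : A × B →+ A × B := π.prodMap (i.comp (π.comp r))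

lemma kerProj_apply (v : A × B) : kerProj i r v = (0, v.2 - i (r v.2)) := rfl

lemma spread_apply (π : A →+ A) (v : A × B) : spread i r π v = (π v.1, i (π (r v.2))) := rfl

/-- The cycles, in the given weight and degree, which the projection to the kernel of the
retraction kills. -/
noncomputable def cycles (n k : ℕ) : AddSubgroup (TensorAlgebra ℤ (A × B)) :=
  lieSpan (Letter A B) n k ⊓ ((diff i).ker ⊓ (tmap (kerProj i r)).toAddMonoidHom.ker)

variable {i r} in
lemma mem_cycles {n k : ℕ} {x : TensorAlgebra ℤ (A × B)} : x ∈ cycles i r n k ↔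
    x ∈ lieSpan (Letter A B) n k ∧ diff i x = 0 ∧ tmap (kerProj i r) x = 0 := Iff.rfl

/-- The boundaries, in the given weight and degree. -/
noncomputable def boundaries (n k : ℕ) : AddSubgroup (TensorAlgebra ℤ (A × B)) :=
  (lieSpan (Letter A B) n (k + 1)).map (diff i)

/-- The contracting homotopy of the tensor ring. -/
noncomputable def contraction : TensorAlgebra ℤ (A × B) →+ TensorAlgebra ℤ (A × B) :=
  der (kerProj i r) (raise r)

variable {i r}

lemma tmap_kerProj_diff (hr : ∀ a, r (i a) = a) (x : TensorAlgebra ℤ (A × B)) :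
    tmap (kerProj i r) (diff i x) = 0 := by
  induction x using tensor_induction with
  | one => rw [show diff i 1 = 0 from der_one _ _, map_zero]
  | ι v => rw [diff_ι, tmap_ι, kerProj_apply]; simp [hr, ← Prod.zero_eq_mk]
  | mul x y hx hy => rw [diff_mul, map_add, map_mul, map_mul, hx, hy]; simp
  | add x y hx hy => simp [hx, hy]
  | neg x hx => simp [hx]

lemma boundaries_le (hr : ∀ a, r (i a) = a) (n k : ℕ) : boundaries i n k ≤ cycles i r n k := by
  rintro _ ⟨x, hx, rfl⟩
  exact ⟨diff_mem_lieSpan i hx, diff_diff i x, tmap_kerProj_diff hr x⟩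

/-- Only words are preserved: twisted by `kerProj`, the contraction need not send Lie elements to
Lie elements. The Dynkin operator repairs this later. -/
lemma contraction_mem {n k : ℕ} {x : TensorAlgebra ℤ (A × B)}
    (hx : x ∈ wordSpan (Letter A B) n k) :
    contraction i r x ∈ wordSpan (Letter A B) n (k + 1) := by
  refine additive_mem (contraction i r) (fun w hw => ?_) hx
  replace hw : WordMon _ _ _ _ := hw
  clear hx
  induction hw with
  | nil =>
    rw [show contraction i r 1 = 0 from der_one _ _]
    exact AddSubgroup.zero_mem _
  | @cons l n k y w hy hw ih =>
    have hw' : w ∈ wordSpan (Letter A B) n k := AddSubgroup.subset_closure hw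
    have one {l : ℕ} {y : TensorAlgebra ℤ (A × B)} (hy : Letter A B l y) :
        y ∈ wordSpan (Letter A B) 1 l := (LieMon.letter hy).mem_wordSpan
    have e : contraction i r (y * w) =
        contraction i r y * w + tmap (kerProj i r) y * contraction i r w := der_mul _ _ _ _
    rw [e]
    obtain a | b := hy
    · have h1 : contraction i r (tι (a, 0)) = 0 := by
        rw [contraction, der_ι, raise_apply, map_zero, ← Prod.zero_eq_mk, map_zero]
      have h2 : tmap (kerProj i r) (tι (a, 0)) = 0 := by
        rw [tmap_ι, kerProj_apply]; simp [← Prod.zero_eq_mk]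
      rw [h1, h2]
      simp
    · have h1 : contraction i r (tι (0, b)) = tι (r b, 0) := der_ι _ _ _
      have h2 : tmap (kerProj i r) (tι (0, b)) = tι (0, b - i (r b)) := tmap_ι _ _
      rw [h1, h2]
      refine AddSubgroup.add_mem _ ?_ ?_
      · rw [add_right_comm, zero_add]
        exact wordSpan_mul (one (.odd _)) hw'
      · rw [add_assoc]
        exact wordSpan_mul (one (.even _)) ih

/-- In dh + hd = 1 - e, with e induced by `kerProj`, the terms hd and e vanish on cycles by
definition. -/
lemma diff_contraction (hr : ∀ a, r (i a) = a) {n k : ℕ} {x : TensorAlgebra ℤ (A × B)}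
    (hx : x ∈ cycles i r n k) : diff i (contraction i r x) = x := by
  have := der_contraction (σ := par A B) (f := lower i) (g := raise r) (e := kerProj i r)
    (by ext v <;> simp [lower_apply, kerProj_apply])
    (by ext v <;> simp [lower_apply, kerProj_apply, hr])
    (by ext v <;> simp [par_apply, kerProj_apply]) (by ext v <;> simp [par_apply, kerProj_apply])
    (par_raise r) (by ext v <;> simp [lower_apply, raise_apply, kerProj_apply, hr]) x
  obtain ⟨_, h1, h2⟩ := mem_cycles.mp hx
  rw [show der (par A B) (lower i) x = 0 from h1, map_zero, add_zero, h2, sub_zero] at this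
  exact this

/-- With the Dynkin operator D and the contraction h, a cycle x satisfies n x = D x = D d h x = d D
h x, and D h x is a Lie element. -/
lemma nsmul_mem_boundaries (hr : ∀ a, r (i a) = a) {n k : ℕ} (hn : 1 ≤ n)
    {x : TensorAlgebra ℤ (A × B)} (hx : x ∈ cycles i r n k) : n • x ∈ boundaries i n k := by
  refine ⟨dynkin A B (contraction i r x),
    dynkin_mem_lieSpan hn (contraction_mem (lieSpan_le_wordSpan _ _ hx.1)), ?_⟩
  rw [diff_dynkin, diff_contraction hr hx]
  refine sub_eq_zero.mp (additive_mem (Q := ⊥) (dynkin A B - n • AddMonoidHom.id _)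
    (fun y hy => ?_) hx.1)
  exact sub_eq_zero.mpr (dynkin_lieMon hy)

lemma tmap_prodMap_mem_cycles {n k : ℕ} {x : TensorAlgebra ℤ (A × B)} (hx : x ∈ cycles i r n k)
    {A' B' : Type*} [AddCommGroup A'] [AddCommGroup B'] {i' : A' →+ B'} {r' : B' →+ A'}
    (f : A →+ A') (g : B →+ B') (h : g.comp i = i'.comp f)
    (h' : (kerProj i' r').comp (f.prodMap g) = (f.prodMap g).comp (kerProj i r)) :
    tmap (f.prodMap g) x ∈ cycles i' r' n k := by
  obtain ⟨h1, h2, h3⟩ := mem_cycles.mp hx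
  refine ⟨tmap_mem_lieSpan f g h1, ?_, ?_⟩
  · exact (diff_tmap i i' f g h x).trans (by rw [h2, map_zero])
  · change tmap _ (tmap _ x) = 0
    rw [tmap_tmap, h', ← tmap_tmap, h3, map_zero]

lemma tmap_spread_mem_cycles (hr : ∀ a, r (i a) = a) {n k : ℕ} (hn : 1 ≤ n)
    {x : TensorAlgebra ℤ (A × B)} (hx : x ∈ cycles i r n k) (π : A →+ A) :
    tmap (spread i r π) x ∈ cycles i r n k := by
  obtain ⟨h1, h2, h3⟩ := mem_cycles.mp hx
  refine ⟨tmap_mem_lieSpan _ _ h1, ?_, ?_⟩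
  · exact (diff_tmap i i _ _ (by ext a; simp [hr]) x).trans (by rw [h2, map_zero])
  · change tmap _ (tmap _ x) = 0
    rw [tmap_tmap]
    exact tmap_zero_eq_zero Letter.exists_eq (by ext v <;> simp [kerProj_apply, spread_apply, hr])
      hn (lieSpan_le_wordSpan _ _ h1)

/-- The words of weight `n` in elements of the images of `e` and of `f`, with `c` factors of the
first kind. -/
inductive SplitLetter {V : Type*} [AddCommGroup V] [Module ℤ V] (e f : V →+ V) :
    ℕ → TensorAlgebra ℤ V → Prop
  | left (v : V) : SplitLetter e f 1 (tι (e v))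
  | right (v : V) : SplitLetter e f 0 (tι (f v))

section Split

variable {V : Type*} [AddCommGroup V] [Module ℤ V] {e f : V →+ V}

lemma mem_split_words {S : ℕ → TensorAlgebra ℤ V → Prop} (hS : ∀ k x, S k x → ∃ v, x = tι v)
    (hef : e + f = AddMonoidHom.id V) {n k : ℕ} {x : TensorAlgebra ℤ V} (hx : x ∈ wordSpan S n k) :
    x ∈ AddSubgroup.closure {y | ∃ c ≤ n, WordMon (SplitLetter e f) n c y} := by
  refine (AddSubgroup.closure_le _).mpr (fun w hw => ?_) hx
  replace hw : WordMon _ _ _ _ := hw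
  clear hx
  induction hw with
  | nil => exact AddSubgroup.subset_closure ⟨0, le_rfl, .nil⟩
  | @cons l n k y w hy hw ih =>
    obtain ⟨v, rfl⟩ := hS _ _ hy
    refine additive_mem (AddMonoidHom.mulLeft (tι v)) ?_ ih
    rintro z ⟨c, hc, hz⟩
    change tι v * z ∈ _
    have hv : v = e v + f v := (DFunLike.congr_fun hef v).symm
    rw [hv, map_add, add_mul]
    exact AddSubgroup.add_mem _ (AddSubgroup.subset_closure ⟨1 + c, by omega, .cons (.left v) hz⟩)
      (AddSubgroup.subset_closure ⟨0 + c, by omega, .cons (.right v) hz⟩)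

/-- The derivation extending the projection e counts the letters in its image. -/
lemma der_split (he : e.comp e = e) (hef : e.comp f = 0) {n c : ℕ} {x : TensorAlgebra ℤ V}
    (hx : WordMon (SplitLetter e f) n c x) : der (AddMonoidHom.id V) e x = c • x := by
  induction hx with
  | nil => rw [der_one, zero_smul]
  | cons hy _ ih =>
    rw [der_mul, ih, tmap_id_apply]
    obtain v | v := hy
    · rw [der_ι, show e (e v) = e v from DFunLike.congr_fun he v, add_smul, one_smul,
        mul_smul_comm]
    · rw [der_ι, show e (f v) = 0 from DFunLike.congr_fun hef v, map_zero, zero_mul, zero_add,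
        zero_add, mul_smul_comm]

lemma tmap_split_left (he : e.comp e = e) (hef : e.comp f = 0) {n c : ℕ} {x : TensorAlgebra ℤ V}
    (hx : WordMon (SplitLetter e f) n c x) : c ≤ n ∧ (c < n → tmap e x = 0) ∧
      (c = n → tmap e x = x) := by
  induction hx with
  | nil => simp
  | cons hy _ ih =>
    obtain v | v := hy
    · rw [map_mul, tmap_ι, show e (e v) = e v from DFunLike.congr_fun he v]
      refine ⟨by omega, fun h => by rw [ih.2.1 (by omega), mul_zero],
        fun h => by rw [ih.2.2 (by omega)]⟩
    · rw [map_mul, tmap_ι, show e (f v) = 0 from DFunLike.congr_fun hef v, map_zero, zero_mul]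
      exact ⟨by omega, fun _ => rfl, fun h => by omega⟩

lemma tmap_split_right (hf : f.comp f = f) (hfe : f.comp e = 0) {n c : ℕ}
    {x : TensorAlgebra ℤ V} (hx : WordMon (SplitLetter e f) n c x) :
    (1 ≤ c → tmap f x = 0) ∧ (c = 0 → tmap f x = x) := by
  induction hx with
  | nil => simp
  | cons hy _ ih =>
    obtain v | v := hy
    · rw [map_mul, tmap_ι, show f (e v) = 0 from DFunLike.congr_fun hfe v, map_zero, zero_mul]
      exact ⟨fun _ => rfl, fun h => by omega⟩
    · rw [map_mul, tmap_ι, show f (f v) = f v from DFunLike.congr_fun hf v]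
      exact ⟨fun h => by rw [ih.1 (by omega), mul_zero], fun h => by rw [ih.2 (by omega)]⟩

end Split

/-- The derivation extending `spread i r π` counts the letters in the image of π and in its copy in
B. It is the anticommutator of the differential with `raiseDer (π.comp r)`, which preserves Lie
elements, so it maps cycles to boundaries and the eigenvalue argument applies. -/
lemma sub_sub_mem_boundaries {p : ℕ} (hp : p.Prime) (hr : ∀ a, r (i a) = a) {π : A →+ A}
    (hπ : π.comp π = π) {k : ℕ} {x : TensorAlgebra ℤ (A × B)} (hx : x ∈ cycles i r p k)
    (hQ : ∀ z ∈ cycles i r p k,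
      tmap (AddMonoidHom.id (A × B) - spread i r π) z ∈ cycles i r p k) :
    x - tmap (spread i r π) x - tmap (AddMonoidHom.id (A × B) - spread i r π) x ∈
      boundaries i p k := by
  have hπ' (a) : π (π a) = π a := DFunLike.congr_fun hπ a
  have he : (spread i r π).comp (spread i r π) = spread i r π := by
    ext v <;> simp [spread_apply, hπ', hr]
  have hef : (spread i r π).comp (AddMonoidHom.id (A × B) - spread i r π) = 0 := by
    ext v <;> simp [spread_apply, hπ', hr]
  have hfe : (AddMonoidHom.id (A × B) - spread i r π).comp (spread i r π) = 0 := by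
    ext v <;> simp [spread_apply, hπ', hr]
  have hf : (AddMonoidHom.id (A × B) - spread i r π).comp (AddMonoidHom.id (A × B) - spread i r π)
      = AddMonoidHom.id (A × B) - spread i r π := by
    ext v <;> simp [spread_apply, hπ', hr]
  refine sub_sub_mem_of_eigen hp (boundaries_le hr p k)
    (E := der (AddMonoidHom.id _) (spread i r π))
    (P := (tmap (spread i r π)).toAddMonoidHom)
    (Q := (tmap (AddMonoidHom.id (A × B) - spread i r π)).toAddMonoidHom)
    (W := fun c => {y | WordMon (SplitLetter (spread i r π)
      (AddMonoidHom.id (A × B) - spread i r π)) p c y}) (fun z hz => ?_)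
    (fun z hz => nsmul_mem_boundaries hr hp.one_le hz)
    (fun z hz => tmap_spread_mem_cycles hr hp.one_le hz π) hQ
    (fun c w hw => der_split he hef hw) (fun c hc w hw => (tmap_split_left he hef hw).2.1 hc)
    (fun w hw => (tmap_split_left he hef hw).2.2 rfl)
    (fun c hc w hw => (tmap_split_right hf hfe hw).1 hc)
    (fun w hw => (tmap_split_right hf hfe hw).2 rfl) hx
    (mem_split_words Letter.exists_eq (by ext <;> simp) (lieSpan_le_wordSpan _ _ hx.1))
  refine ⟨raiseDer (π.comp r) z, raiseDer_mem_lieSpan _ hz.1, ?_⟩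
  have h1 := diff_raiseDer i (π.comp r) z
  rw [(mem_cycles.mp hz).2.1, map_zero, add_zero] at h1
  rw [h1]
  congr 2
  ext v <;> simp [spread_apply, hr]

/-- Cycles in the components spanned by one element are boundaries. -/
lemma tmap_spread_mem_boundaries {p : ℕ} (hp : p.Prime) (hr : ∀ a, r (i a) = a) {π : A →+ A}
    {a₀ : A} (hπ : ∀ a, ∃ m : ℤ, π a = m • a₀) {k : ℕ}
    {x : TensorAlgebra ℤ (A × B)} (hx : x ∈ cycles i r p k) :
    tmap (spread i r π) x ∈ boundaries i p k := by
  have hx' := tmap_spread_mem_cycles hr hp.one_le hx π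
  obtain _ | k := k
  -- In degree 0 all letters become multiples of one even letter, whose commutators with itself
  -- vanish; there is nothing of weight at least 2.
  · have key {n k : ℕ} {y : TensorAlgebra ℤ (A × B)} (hy : LieMon (Letter A B) n k y)
        (hk : k = 0) : ∃ m : ℤ, tmap (spread i r π) y = m • tι (0, i a₀) ∧ (2 ≤ n → m = 0) := by
      induction hy with
      | letter h =>
        obtain a | b := h
        · omega
        · obtain ⟨m, hm⟩ := hπ (r b)
          refine ⟨m, ?_, by omega⟩
          rw [tmap_ι, spread_apply, map_zero, hm, ← map_zsmul]
          simp
      | br _ _ h1 h2 =>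
        obtain ⟨m, hm, _⟩ := h1 (by omega)
        obtain ⟨m', hm', _⟩ := h2 (by omega)
        obtain ⟨rfl, rfl⟩ := Nat.add_eq_zero_iff.mp hk
        refine ⟨0, ?_, fun _ => rfl⟩
        rw [sbr, map_sub, map_zsmul, map_mul, map_mul, hm, hm']
        simp only [smul_mul_assoc, mul_smul_comm, smul_comm m m', mul_zero, pow_zero, one_smul,
          zero_smul, sub_self]
      | sq _ h =>
        obtain rfl := (Nat.add_eq_zero_iff.mp hk).1
        simp at h
    have : tmap (spread i r π) x = 0 := by
      refine additive_mem (Q := ⊥) (tmap (spread i r π)).toAddMonoidHom (fun y hy => ?_) hx.1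
      obtain ⟨m, hm, hm'⟩ := key hy rfl
      change tmap (spread i r π) y = 0
      rw [hm, hm' hp.two_le, zero_smul]
    rw [this]
    exact AddSubgroup.zero_mem _
  · set x' := tmap (spread i r π) x with hx'_def
    obtain ⟨q, rfl⟩ := Nat.exists_eq_add_of_le' hp.two_le
    -- The contraction raises the degree of the cycle to k + 2, so at least two odd letters occur in
    -- the words of y, and y is a combination of products of at most p - 1 Lie elements.
    set y := tmap (spread i r π) (contraction i r x) with hy
    have h1 : diff i y = x' := by
      rw [hy, spread, diff_tmap i i _ _ (by ext a; simp [hr]), diff_contraction hr hx]; rfl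
    have h2 : y ∈ wordSpan (TwoLetter a₀ (i a₀)) (q + 1 + 1) (k + 2) := by
      refine wordSpan_map _ ?_ (contraction_mem (lieSpan_le_wordSpan _ _ hx.1))
      rintro l z (a | b)
      · obtain ⟨m, hm⟩ := hπ a
        rw [tmap_ι, spread_apply, hm]
        have : tι (m • a₀, i (π (r 0))) = m • tι (a₀, (0 : B)) := by rw [← map_zsmul]; simp
        rw [this]
        exact AddSubgroup.zsmul_mem _ (AddSubgroup.subset_closure .odd) _
      · obtain ⟨m, hm⟩ := hπ (r b)
        rw [tmap_ι, spread_apply, hm]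
        have : tι (π 0, i (m • a₀)) = m • tι ((0 : A), i a₀) := by rw [← map_zsmul]; simp
        rw [this]
        exact AddSubgroup.zsmul_mem _ (AddSubgroup.subset_closure .even) _
    have h3 : y ∈ prodSpan (Letter A B) (q + 1) (q + 1 + 1) (k + 2) :=
      (AddSubgroup.closure_le _).mpr (fun _ h => WordMon.mem_prodSpan h) h2
    obtain ⟨g, a, b, hab⟩ := exists_adams_coprime hp
    rw [Nat.add_sub_cancel] at hab
    -- The Adams product turns y into a Lie element and commutes with d, so it exhibits this
    -- multiple of x' = dy as a boundary. The multiplier is prime to p, and p x' is a boundary as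
    -- well.
    have h4 : (∏ l ∈ Finset.range q, ((g : ℤ) - (g : ℤ) ^ (l + 2))) • x' ∈
        boundaries i (q + 2) (k + 1) := by
      refine ⟨adamsProd g q y, adamsProd_mem g q (by omega) h3, ?_⟩
      rw [diff_adamsProd, h1, adamsProd_lieSpan g q (by omega) hx'.1]
    have h5 := nsmul_mem_boundaries hr hp.one_le hx'
    have := AddSubgroup.add_mem _ (AddSubgroup.zsmul_mem _ h4 a) (AddSubgroup.zsmul_mem _ h5 b)
    rwa [← natCast_zsmul, smul_smul, smul_smul, ← add_smul, hab, one_smul] at this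

/-- For π = 1 the complementary projection is `kerProj`, which kills cycles by definition. -/
lemma mem_boundaries_of_spread_id {p : ℕ} (hp : p.Prime) (hr : ∀ a, r (i a) = a) {k : ℕ}
    {x : TensorAlgebra ℤ (A × B)} (hx : x ∈ cycles i r p k)
    (h : tmap (spread i r (AddMonoidHom.id A)) x ∈ boundaries i p k) : x ∈ boundaries i p k := by
  have e : AddMonoidHom.id (A × B) - spread i r (AddMonoidHom.id A) = kerProj i r := by
    ext v <;> simp [spread_apply, kerProj_apply]
  have h1 (z) (hz : z ∈ cycles i r p k) :
      tmap (AddMonoidHom.id (A × B) - spread i r (AddMonoidHom.id A)) z = 0 := by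
    rw [e]; exact (mem_cycles.mp hz).2.2
  have h2 := sub_sub_mem_boundaries hp hr (π := AddMonoidHom.id A) rfl hx
    fun z hz => by rw [h1 z hz]; exact AddSubgroup.zero_mem _
  rw [h1 x hx, sub_zero] at h2
  have := AddSubgroup.add_mem _ h2 h
  rwa [sub_add_cancel] at this

end Koszul

/-! ### Exactness when A is free, by induction on basis elements -/

section Free

variable {I B : Type*} [AddCommGroup B]

open Classical in
/-- The projection to the span of some basis elements of a free abelian group. -/
noncomputable def coordProj (s : Finset I) : (I →₀ ℤ) →+ (I →₀ ℤ) :=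
  Finsupp.filterAddHom (· ∈ s)

lemma coordProj_apply [DecidableEq I] (s : Finset I) (a : I →₀ ℤ) (b : I) :
    coordProj s a b = if b ∈ s then a b else 0 := by
  classical
  rw [coordProj]
  simp [Finsupp.filterAddHom, Finsupp.filter_apply]

lemma coordProj_comp [DecidableEq I] (s t : Finset I) :
    (coordProj s).comp (coordProj t) = coordProj (s ∩ t) := by
  refine AddMonoidHom.ext fun a => Finsupp.ext fun b => ?_
  simp only [AddMonoidHom.comp_apply, coordProj_apply, Finset.mem_inter, ite_and]

lemma coordProj_empty : coordProj (∅ : Finset I) = 0 := by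
  classical
  refine AddMonoidHom.ext fun a => Finsupp.ext fun b => ?_
  simp [coordProj_apply]

lemma coordProj_apply_eq {s : Finset I} {a : I →₀ ℤ} (h : a.support ⊆ s) : coordProj s a = a := by
  classical
  refine Finsupp.ext fun b => ?_
  rw [coordProj_apply]
  split_ifs with hb
  · rfl
  · exact (Finsupp.notMem_support_iff.mp fun h' => hb (h h')).symm

lemma coordProj_singleton (b : I) (a : I →₀ ℤ) :
    coordProj {b} a = a b • Finsupp.single b 1 := by
  classical
  refine Finsupp.ext fun c => ?_
  rw [coordProj_apply]
  by_cases h : c = b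
  · simp [h]
  · simp [h]

lemma coordProj_insert [DecidableEq I] {b : I} {s : Finset I} (h : b ∉ s) :
    coordProj (insert b s) = coordProj {b} + coordProj s := by
  refine AddMonoidHom.ext fun a => Finsupp.ext fun c => ?_
  rw [AddMonoidHom.add_apply, Finsupp.add_apply, coordProj_apply, coordProj_apply, coordProj_apply]
  by_cases h1 : c = b
  · subst h1; simp [h]
  · simp [h1]

variable {i : (I →₀ ℤ) →+ B} {r : B →+ (I →₀ ℤ)}

lemma exists_finset_spread (x : TensorAlgebra ℤ ((I →₀ ℤ) × B)) :
    ∃ s : Finset I, ∀ t, s ⊆ t → tmap (spread i r (coordProj t)) x =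
      tmap (spread i r (AddMonoidHom.id _)) x := by
  classical
  induction x using tensor_induction with
  | one => exact ⟨∅, fun t _ => by simp⟩
  | ι v =>
    refine ⟨v.1.support ∪ (r v.2).support, fun t ht => ?_⟩
    rw [tmap_ι, tmap_ι, spread_apply, spread_apply,
      coordProj_apply_eq (Finset.union_subset_left ht),
      coordProj_apply_eq (Finset.union_subset_right ht)]
    rfl
  | mul x y hx hy =>
    obtain ⟨s, hs⟩ := hx
    obtain ⟨t, ht⟩ := hy
    refine ⟨s ∪ t, fun u hu => ?_⟩
    rw [map_mul, map_mul, hs u (Finset.union_subset_left hu), ht u (Finset.union_subset_right hu)]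
  | add x y hx hy =>
    obtain ⟨s, hs⟩ := hx
    obtain ⟨t, ht⟩ := hy
    refine ⟨s ∪ t, fun u hu => ?_⟩
    rw [map_add, map_add, hs u (Finset.union_subset_left hu), ht u (Finset.union_subset_right hu)]
  | neg x hx =>
    obtain ⟨s, hs⟩ := hx
    exact ⟨s, fun u hu => by rw [map_neg, map_neg, hs u hu]⟩

lemma spread_comp {A B : Type*} [AddCommGroup A] [AddCommGroup B] {i : A →+ B} {r : B →+ A}
    (hr : ∀ a, r (i a) = a) (π π' : A →+ A) :
    (spread i r π).comp (spread i r π') = spread i r (π.comp π') := by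
  ext v <;> simp [spread_apply, hr]

/-- Cycles are boundaries if the first group is free. -/
lemma cycles_le_boundaries_free {p : ℕ} (hp : p.Prime) (hr : ∀ a, r (i a) = a) (k : ℕ) :
    cycles i r p k ≤ boundaries i p k := by
  classical
  -- A new basis element b splits the projected cycle into its part on s, its part on b and mixed
  -- components. These are boundaries by induction, by the case of one element and by the eigenvalue
  -- argument.
  have key (s : Finset I) : ∀ x ∈ cycles i r p k,
      tmap (spread i r (coordProj s)) x ∈ boundaries i p k := by
    induction s using Finset.induction_on with
    | empty =>
      intro x hx
      rw [tmap_zero_eq_zero Letter.exists_eq (by rw [coordProj_empty]; ext <;> simp [spread_apply])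
        hp.one_le (lieSpan_le_wordSpan _ _ hx.1)]
      exact AddSubgroup.zero_mem _
    | insert b s hb ih =>
      intro x hx
      have hx' := tmap_spread_mem_cycles hr hp.one_le hx (coordProj (insert b s))
      have h1 := sub_sub_mem_boundaries hp hr (π := coordProj {b}) (by rw [coordProj_comp]; simp)
        hx' fun z hz => ?_
      · have e1 : (spread i r (coordProj {b})).comp (spread i r (coordProj (insert b s))) =
            spread i r (coordProj {b}) := by
          rw [spread_comp hr, coordProj_comp, Finset.singleton_inter_of_mem (Finset.mem_insert_self b s)]
        have e2 : (AddMonoidHom.id _ - spread i r (coordProj {b})).comp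
            (spread i r (coordProj (insert b s))) = spread i r (coordProj s) := by
          rw [AddMonoidHom.sub_comp, e1, coordProj_insert hb]
          ext v <;> simp [spread_apply]
        rw [tmap_tmap, tmap_tmap, e1, e2] at h1
        have h2 := tmap_spread_mem_boundaries hp hr (a₀ := Finsupp.single b 1)
          (π := coordProj {b}) (fun a => ⟨a b, coordProj_singleton b a⟩) hx
        have := AddSubgroup.add_mem _ (AddSubgroup.add_mem _ h1 (ih x hx)) h2
        rwa [sub_add_cancel, sub_add_cancel] at this
      · have e : AddMonoidHom.id ((I →₀ ℤ) × B) - spread i r (coordProj {b}) =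
            (AddMonoidHom.id (I →₀ ℤ) - coordProj {b}).prodMap
              (AddMonoidHom.id B - i.comp ((coordProj {b}).comp r)) := by
          ext <;> simp [spread_apply]
        rw [e]
        refine tmap_prodMap_mem_cycles hz _ _ ?_ ?_
        · refine AddMonoidHom.ext fun a => ?_
          simp [hr]
        · refine AddMonoidHom.ext fun a => ?_
          simp [hr, kerProj_apply]
  intro x hx
  obtain ⟨s, hs⟩ := exists_finset_spread (i := i) (r := r) x
  refine mem_boundaries_of_spread_id hp hr hx ?_
  rw [← hs s subset_rfl]
  exact key s x hx

end Free

/-! ### Exactness when A is projective -/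

section Projective

variable {A B : Type*} [AddCommGroup A] [AddCommGroup B] {i : A →+ B} {r : B →+ A}

/-- Cycles are boundaries if the first group is projective. -/
theorem cycles_le_boundaries {p : ℕ} (hp : p.Prime) (hr : ∀ a, r (i a) = a)
    {I : Type*} (j : A →+ (I →₀ ℤ)) (q : (I →₀ ℤ) →+ A) (hq : ∀ a, q (j a) = a) (k : ℕ) :
    cycles i r p k ≤ boundaries i p k := by
  intro x hx
  -- The injection A → B is a retract of the inclusion of the free group F into F × B. The map `jB`
  -- sends i(A) to F by j and the kernel of r identically to B; `qB` is a retraction.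
  let jB : B →+ (I →₀ ℤ) × B := (j.comp r).prod (AddMonoidHom.id B - i.comp r)
  let qB : (I →₀ ℤ) × B →+ B := (i.comp q).coprod (AddMonoidHom.id B - i.comp r)
  have h1 := tmap_prodMap_mem_cycles hx (i' := AddMonoidHom.inl (I →₀ ℤ) B)
    (r' := AddMonoidHom.fst (I →₀ ℤ) B) j jB
    (by refine AddMonoidHom.ext fun a => ?_; simp [jB, hr])
    (by refine AddMonoidHom.ext fun a => ?_; simp [jB, hr, kerProj_apply])
  obtain ⟨z, hz, hzx⟩ := cycles_le_boundaries_free hp (fun _ => rfl) k h1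
  refine ⟨tmap (q.prodMap qB) z, tmap_mem_lieSpan _ _ hz, ?_⟩
  have e : (q.prodMap qB).comp (j.prodMap jB) = AddMonoidHom.id (A × B) := by
    refine AddMonoidHom.ext fun v => ?_
    refine Prod.ext (hq v.1) ?_
    change i (q (j (r v.2))) + ((v.2 - i (r v.2)) - i (r (v.2 - i (r v.2)))) = v.2
    rw [hq, map_sub r, hr, sub_self, map_zero, sub_zero, add_sub_cancel]
  rw [diff_tmap (AddMonoidHom.inl (I →₀ ℤ) B) i q qB
    (by refine AddMonoidHom.ext fun a => ?_; simp [qB]), hzx, tmap_tmap, e, tmap_id_apply]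

end Projective

/-! ### Identities in graded Lie rings with squares -/

namespace GLRS

variable {B : ℕ → Type v} [∀ n, AddCommGroup (B n)] [GLRS B]

lemma sq_zero {i k : ℕ} (hi : Odd i) (h : i + i = k) : sq hi h (0 : B i) = 0 := by
  have := sq_smul hi h 0 (0 : B i)
  simpa using this

lemma sq_neg {i k : ℕ} (hi : Odd i) (h : i + i = k) (x : B i) : sq hi h (-x) = sq hi h x := by
  have := sq_smul hi h (-1) x
  simpa using this

/-- Expand the square of 2x both by homogeneity and by additivity: 4 x^[2] = 2 x^[2] + {x, x}. -/
lemma br_self_eq {i k : ℕ} (hi : Odd i) (h : i + i = k) (x : B i) :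
    br h x x = (2 : ℤ) • sq hi h x := by
  have h1 := sq_smul hi h 2 x
  rw [two_smul, sq_add] at h1
  have h2 : ((2 : ℤ) ^ 2) • sq hi h x = (2 : ℤ) • sq hi h x + (2 : ℤ) • sq hi h x := by
    rw [← add_smul]; norm_num
  rw [h2, ← two_smul ℤ (sq hi h x)] at h1
  exact add_left_cancel h1

lemma br_comm_eq {i j k : ℕ} (h : i + j = k) (h' : j + i = k) (x : B i) (y : B j) :
    br h x y = -((-1 : ℤ) ^ (i * j) • br h' y x) :=
  eq_neg_of_add_eq_zero_left (br_comm h h' x y)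

/-- The cyclic Jacobi identity rewritten as the compatibility of the adjoint action with brackets.
-/
lemma br_br_eq {i j k a b n : ℕ} (hij : i + j = a) (hjk : j + k = b) (ha : a + k = n)
    (hb : i + b = n) {c : ℕ} (hik : i + k = c) (hc : j + c = n) (x : B i) (y : B j) (z : B k) :
    br ha (br hij x y) z = br hb x (br hjk y z) - (-1 : ℤ) ^ (i * j) • br hc y (br hik x z) := by
  subst hij hjk hik ha
  have h1 := jacobi (n := i + j + k) rfl rfl (add_comm k i) rfl (by omega) (by omega) x y z
  rw [br_comm_eq (show (j + k) + i = i + j + k by omega) hb (br rfl y z) x,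
    br_comm_eq (show (i + k) + j = i + j + k by omega) hc _ y,
    br_comm_eq (add_comm k i) rfl z x] at h1
  simp only [map_neg, map_zsmul, smul_neg, smul_smul, neg_neg] at h1
  have e1 : (-1 : ℤ) ^ (j * i) * (-1) ^ ((j + k) * i) = (-1) ^ (i * k) := by
    rw [add_mul, pow_add, ← mul_assoc, ← mul_pow]; simp [mul_comm]
  have e2 : (-1 : ℤ) ^ (k * j) * ((-1) ^ ((i + k) * j) * (-1) ^ (k * i)) =
      (-1) ^ (i * k) * (-1) ^ (i * j) := by
    rw [add_mul, pow_add, mul_comm ((-1 : ℤ) ^ (i * j)), ← mul_assoc, ← mul_assoc, ← mul_pow]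
    simp [mul_comm]
  rw [e1, e2, mul_smul, ← smul_neg, ← smul_add, ← smul_add] at h1
  have h2 : (-1 : ℤ) ^ (i * k) • (-1 : ℤ) ^ (i * k) •
      (br rfl (br rfl x y) z + -br hb x (br rfl y z) +
        (-1 : ℤ) ^ (i * j) • br hc y (br rfl x z)) = 0 := by
    rw [h1, smul_zero]
  rw [smul_smul, ← mul_pow] at h2
  simp only [mul_neg, mul_one, neg_neg, one_pow, one_smul] at h2
  refine (eq_of_sub_eq_zero ?_)
  rw [← h2]
  abel

/-- The counterpart for squares: the adjoint action of x^[2] is the square of that of x. -/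
lemma sq_br_eq {i j a b n : ℕ} (hi : Odd i) (h : i + i = a) (ha : a + j = n) (hb : i + j = b)
    (hn : i + b = n) (x : B i) (y : B j) : br ha (sq hi h x) y = br hn x (br hb x y) := by
  subst h hb hn
  rw [br_comm_eq ha (by omega), br_sq hi rfl (by omega) (add_comm j i) (by omega) x y,
    br_comm_eq (show (i + j) + i = i + (i + j) by omega) rfl,
    br_comm_eq (add_comm j i) rfl]
  have e1 : (-1 : ℤ) ^ ((i + i) * j) = 1 := by
    rw [add_mul, pow_add, ← mul_pow]; simp
  have e2 : (-1 : ℤ) ^ ((i + j) * i) * (-1 : ℤ) ^ (j * i) = -1 := by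
    rw [add_mul, pow_add, mul_assoc, ← mul_pow, (hi.mul hi).neg_one_pow]; simp
  simp only [map_neg, map_zsmul, smul_neg, smul_smul, neg_neg, e1]
  rw [e2]
  simp

end GLRS

/-! ### The super commutator and squaring in a ring satisfy the same axioms -/

section SuperCommutator

variable {R : Type v} [Ring R]

/-- The identity holds for each of the eight choices of the signs (-1)^(ij), (-1)^(ik) and
(-1)^(jk). -/
lemma sbr_jacobi (i j k : ℕ) (x y z : R) :
    (-1 : ℤ) ^ (i * k) • sbr (i + j) k (sbr i j x y) z +
      (-1 : ℤ) ^ (j * i) • sbr (j + k) i (sbr j k y z) x +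
      (-1 : ℤ) ^ (k * j) • sbr (k + i) j (sbr k i z x) y = 0 := by
  simp only [sbr, add_mul, pow_add]
  rw [mul_comm k i, mul_comm j i, mul_comm k j]
  obtain h1 | h1 := neg_one_pow_eq_or ℤ (i * j) <;>
    obtain h2 | h2 := neg_one_pow_eq_or ℤ (i * k) <;>
    obtain h3 | h3 := neg_one_pow_eq_or ℤ (j * k) <;> rw [h1, h2, h3] <;>
    simp only [one_smul, neg_smul, mul_neg, mul_one, neg_neg] <;> noncomm_ring

lemma sbr_self_self (i : ℕ) (x : R) : sbr (i + i) i (sbr i i x x) x = 0 := by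
  have e : (-1 : ℤ) ^ ((i + i) * i) = 1 := by rw [add_mul, pow_add, ← mul_pow]; simp
  rw [sbr, sbr, e]
  obtain h1 | h1 := neg_one_pow_eq_or ℤ (i * i) <;> rw [h1] <;> noncomm_ring

lemma sbr_sq {i : ℕ} (hi : Odd i) (j : ℕ) (x y : R) :
    sbr j (i + i) y (x * x) = sbr (j + i) i (sbr j i y x) x := by
  have e1 : (-1 : ℤ) ^ (j * (i + i)) = 1 := by
    rw [mul_add, pow_add, ← mul_pow]; simp
  have e2 : (-1 : ℤ) ^ ((j + i) * i) = - (-1 : ℤ) ^ (j * i) := by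
    rw [add_mul, pow_add, (hi.mul hi).neg_one_pow]; simp
  rw [sbr, sbr, sbr, e1, e2]
  obtain h1 | h1 := neg_one_pow_eq_or ℤ (j * i) <;> rw [h1] <;>
    simp only [one_smul, neg_smul, neg_neg] <;> noncomm_ring

lemma sbr_add_comm (i j : ℕ) (x y : R) : sbr i j x y + (-1 : ℤ) ^ (i * j) • sbr j i y x = 0 := by
  rw [sbr_symm i j, neg_add_cancel]

lemma sbr_self {i : ℕ} (hi : Even i) (x : R) : sbr i i x x = 0 := by
  rw [sbr, (hi.mul_right i).neg_one_pow, one_smul, sub_self]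

lemma add_mul_self_eq {i : ℕ} (hi : Odd i) (x y : R) :
    (x + y) * (x + y) = x * x + y * y + sbr i i x y := by
  rw [sbr, (hi.mul hi).neg_one_pow]
  noncomm_ring

lemma smul_mul_self_eq (a : ℤ) (x : R) : (a • x) * (a • x) = a ^ 2 • (x * x) := by
  rw [smul_mul_smul_comm, pow_two]

end SuperCommutator

/-- The constant family with value `R`. -/
def ConstFam (R : Type v) (_ : ℕ) : Type v := R

instance (R : Type v) [Ring R] (n : ℕ) : AddCommGroup (ConstFam R n) :=
  inferInstanceAs (AddCommGroup R)

/-- A ring as a graded Lie ring with squares, all of whose components are the ring itself. -/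
instance (R : Type v) [Ring R] : GLRS (ConstFam R) where
  br {i j _} _ := (sbrHom i j : R →+ R →+ R)
  sq _ _ x := (show R from x) * (show R from x)
  br_comm {i j k} _ _ x y := sbr_add_comm (R := R) i j x y
  br_self hi _ x := sbr_self (R := R) hi x
  jacobi {i j k a b c n} hij hjk hki ha hb hc x y z := by
    subst hij hjk hki
    exact sbr_jacobi (R := R) i j k x y z
  br_br_self {i j k} h h' x := by
    subst h
    exact sbr_self_self (R := R) i x
  sq_smul _ _ a x := smul_mul_self_eq (R := R) a x
  sq_add hi _ x y := add_mul_self_eq (R := R) hi x y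
  br_sq {i j a b n} hi h ha hb hn x y := by
    subst h hb
    exact sbr_sq (R := R) hi j x y

/-! ### The comparison of the free graded Lie ring with squares with a tensor ring -/

namespace FreeGLRS

section

variable {A : Type u} [AddCommGroup A]

instance (priority := 2000) instZSMul (n : ℕ) : SMul ℤ (FreeGLRS A n) :=
  (AddCommGroup.toIntModule (FreeGLRS A n)).toSMul

/-- Monomials in the free graded Lie ring with squares, with a count of the generators. -/
inductive Mon (S : ℕ → A → Prop) : ∀ {n : ℕ}, ℕ → FreeGLRS A n → Prop
  | of {c : ℕ} {a : A} : S c a → Mon S c (of a)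
  | br {i j k : ℕ} (h : i + j = k) {c d : ℕ} {x : FreeGLRS A i} {y : FreeGLRS A j} :
      Mon S c x → Mon S d y → Mon S (c + d) (GLRS.br h x y)
  | sq {i k : ℕ} (hi : Odd i) (h : i + i = k) {c : ℕ} {x : FreeGLRS A i} :
      Mon S c x → Mon S (c + c) (GLRS.sq hi h x)

lemma sq_mem_closure {s : ∀ n, Set (FreeGLRS A n)} {i k : ℕ} (hi : Odd i) (h : i + i = k)
    (hbr : ∀ x ∈ s i, ∀ y ∈ s i, GLRS.br h x y ∈ s k) (hsq : ∀ x ∈ s i, GLRS.sq hi h x ∈ s k)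
    {x : FreeGLRS A i} (hx : x ∈ AddSubgroup.closure (s i)) :
    GLRS.sq hi h x ∈ AddSubgroup.closure (s k) := by
  induction hx using AddSubgroup.closure_induction with
  | mem x hx => exact AddSubgroup.subset_closure (hsq x hx)
  | zero => rw [GLRS.sq_zero]; exact AddSubgroup.zero_mem _
  | add x y hx hy h1 h2 =>
    rw [GLRS.sq_add]
    exact AddSubgroup.add_mem _ (AddSubgroup.add_mem _ h1 h2)
      (biadditive_mem (GLRS.br h)
        (fun x hx y hy => AddSubgroup.subset_closure (hbr x hx y hy)) hx hy)
  | neg x hx h1 => rwa [GLRS.sq_neg]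

lemma map_map {A' A'' : Type u} [AddCommGroup A'] [AddCommGroup A''] (f : A →+ A') (g : A' →+ A'')
    {n : ℕ} (x : FreeGLRS A n) : (map g).app n ((map f).app n x) = (map (g.comp f)).app n x := by
  have h : (map g).comp (map f) = map (g.comp f) := hom_ext fun a => rfl
  rw [← h]; rfl

lemma map_id {n : ℕ} (x : FreeGLRS A n) : (map (AddMonoidHom.id A)).app n x = x := by
  have h : map (AddMonoidHom.id A) = GLRSHom.id (FreeGLRS A) := hom_ext fun a => rfl
  rw [h]; rfl

lemma map_mem_closure_mon {A' : Type u} [AddCommGroup A'] {S : ℕ → A' → Prop} (f : A →+ A')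
    (hS : ∀ a, f a ∈ AddSubgroup.closure {a | ∃ c ≤ 1, S c a}) {n : ℕ} (x : FreeGLRS A n) :
    (map f).app n x ∈ AddSubgroup.closure {y | ∃ c ≤ n, Mon S c y} := by
  induction x using ind with | h x =>
  induction x with
  | of a =>
    refine additive_mem (Q := AddSubgroup.closure _) of ?_ (hS a)
    rintro a ⟨c, hc, ha⟩
    exact AddSubgroup.subset_closure ⟨c, hc, .of ha⟩
  | zero n => exact AddSubgroup.zero_mem _
  | add x y hx hy => rw [mk_add, map_add]; exact AddSubgroup.add_mem _ hx hy
  | smul a x hx => exact AddSubgroup.zsmul_mem _ hx a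
  | br h x y hx hy =>
    rw [show mk (Expr.br h x y) = GLRS.br h (mk x) (mk y) from rfl, (map f).map_br]
    refine biadditive_mem (GLRS.br (B := FreeGLRS A') h) ?_ hx hy
    rintro x ⟨c, hc, hx⟩ y ⟨d, hd, hy⟩
    exact AddSubgroup.subset_closure ⟨c + d, by omega, .br h hx hy⟩
  | sq hi h x hx =>
    rw [show mk (Expr.sq hi h x) = GLRS.sq hi h (mk x) from rfl, (map f).map_sq]
    refine sq_mem_closure (s := fun n => {y | ∃ c ≤ n, Mon S c y}) hi h ?_ ?_ hx
    · rintro x ⟨c, hc, hx⟩ y ⟨d, hd, hy⟩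
      exact ⟨c + d, by omega, .br h hx hy⟩
    · rintro x ⟨c, hc, hx⟩
      exact ⟨c + c, by omega, .sq hi h hx⟩

lemma mem_closure_mon {S : ℕ → A → Prop}
    (hS : ∀ a, a ∈ AddSubgroup.closure {a | ∃ c ≤ 1, S c a}) {n : ℕ} (x : FreeGLRS A n) :
    x ∈ AddSubgroup.closure {y | ∃ c ≤ n, Mon S c y} := by
  rw [← map_id x]
  exact map_mem_closure_mon _ hS x

variable (A) in
/-- The comparison of the free graded Lie ring with squares with a tensor ring. -/
noncomputable def toTensor (B : Type v) [AddCommGroup B] :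
    GLRSHom (FreeGLRS A) (ConstFam (TensorAlgebra ℤ (A × B))) :=
  lift (B := ConstFam (TensorAlgebra ℤ (A × B))) (tι.comp (AddMonoidHom.inl A B))

variable (A) in
/-- The component of weight `n` of `toTensor`. -/
noncomputable def toT (B : Type v) [AddCommGroup B] (n : ℕ) :
    FreeGLRS A n →+ TensorAlgebra ℤ (A × B) := (toTensor A B).app n

variable {B : Type v} [AddCommGroup B]

lemma toT_of (a : A) : toT A B 1 (of a) = tι (a, 0) := rfl

lemma toT_br {i j k : ℕ} (h : i + j = k) (x : FreeGLRS A i) (y : FreeGLRS A j) :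
    toT A B k (GLRS.br h x y) = sbr i j (toT A B i x) (toT A B j y) :=
  (toTensor A B).map_br h x y

lemma toT_sq {i k : ℕ} (hi : Odd i) (h : i + i = k) (x : FreeGLRS A i) :
    toT A B k (GLRS.sq hi h x) = toT A B i x * toT A B i x :=
  (toTensor A B).map_sq hi h x

lemma toT_map {A' : Type u} [AddCommGroup A'] {B' : Type v} [AddCommGroup B'] (f : A →+ A')
    (g : B →+ B') {n : ℕ} (x : FreeGLRS A n) :
    toT A' B' n ((map f).app n x) = tmap (f.prodMap g) (toT A B n x) := by
  have h1 (n : ℕ) (x : Expr A n) :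
      toT A' B' n ((map f).app n (mk x)) = tmap (f.prodMap g) (toT A B n (mk x)) := by
    induction x with
    | of a =>
      refine (toT_of (B := B') (f a)).trans ?_
      rw [show toT A B 1 (mk (Expr.of a)) = tι (a, 0) from rfl, tmap_ι]
      simp
    | zero n =>
      have (m : ℕ) : mk (Expr.zero m : Expr A m) = 0 := rfl
      simp [this]
    | add x y hx hy => rw [mk_add, map_add, map_add, map_add, map_add, hx, hy]
    | smul a x hx =>
      have h (ψ : FreeGLRS A _ →+ TensorAlgebra ℤ (A' × B')) :
        ψ (mk (Expr.smul a x)) = a • ψ (mk x) := map_zsmul ψ a (mk x)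
      refine (h ((toT A' B' _).comp ((map f).app _))).trans ?_
      refine Eq.trans ?_ (h ((tmap (f.prodMap g)).toAddMonoidHom.comp (toT A B _))).symm
      exact congrArg (a • ·) hx
    | br h x y hx hy =>
      rw [show mk (Expr.br h x y) = GLRS.br h (mk x) (mk y) from rfl, (map f).map_br, toT_br,
        toT_br, hx, hy, sbr, sbr, map_sub, map_zsmul, map_mul, map_mul]
    | sq hi h x hx =>
      rw [show mk (Expr.sq hi h x) = GLRS.sq hi h (mk x) from rfl, (map f).map_sq, toT_sq,
        toT_sq, hx, map_mul]
  induction x using ind with | h x =>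
  exact h1 n x

lemma toT_mem {n : ℕ} (x : FreeGLRS A n) : toT A B n x ∈ lieSpan (Letter A B) n n := by
  induction x using ind with | h x =>
  induction x with
  | of a => exact AddSubgroup.subset_closure (.letter (.odd a))
  | zero n => exact AddSubgroup.zero_mem _
  | add x y hx hy => rw [mk_add, map_add]; exact AddSubgroup.add_mem _ hx hy
  | smul a x hx =>
    exact (congrArg (· ∈ lieSpan _ _ _) (map_zsmul (toT A B _) a (mk x))).mpr
      (AddSubgroup.zsmul_mem _ hx a)
  | br h x y hx hy =>
    rw [show mk (Expr.br h x y) = GLRS.br h (mk x) (mk y) from rfl, toT_br]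
    subst h
    exact lieSpan_br hx hy
  | sq hi h x hx =>
    rw [show mk (Expr.sq hi h x) = GLRS.sq hi h (mk x) from rfl, toT_sq]
    subst h
    exact lieSpan_sq hi hx

/-- The degree never exceeds the weight, so equality forces it in every submonomial: all letters are
elements of A. -/
lemma exists_toT_eq {n : ℕ} {x : TensorAlgebra ℤ (A × B)} (hx : x ∈ lieSpan (Letter A B) n n) :
    ∃ y, toT A B n y = x := by
  have key {n k : ℕ} {x : TensorAlgebra ℤ (A × B)} (hx : LieMon (Letter A B) n k x) (h : k = n) :
      ∃ y, toT A B n y = x := by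
    induction hx with
    | letter hx =>
      obtain a | b := hx
      · exact ⟨of a, toT_of a⟩
      · omega
    | br hx hy h1 h2 =>
      have := hx.degree_le fun _ _ => Letter.le_one
      have := hy.degree_le fun _ _ => Letter.le_one
      obtain ⟨x', rfl⟩ := h1 (by omega)
      obtain ⟨y', rfl⟩ := h2 (by omega)
      refine ⟨GLRS.br rfl x' y', ?_⟩
      rw [toT_br]
      congr 1 <;> omega
    | @sq n k x hx hk h1 =>
      obtain rfl : k = n := by omega
      obtain ⟨x', rfl⟩ := h1 rfl
      exact ⟨GLRS.sq hk rfl x', toT_sq _ _ _⟩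
  exact additive_mem (Q := (toT A B n).range) (AddMonoidHom.id _) (fun y hy => key hy rfl) hx

/-- The action of a letter on the direct sum of the integers and of the components of the free
graded Lie ring with squares. -/
noncomputable def adLetter (e : A →+ A) :
    A × B →+ AddMonoid.End (ℤ × DirectSum ℕ (FreeGLRS A)) :=
  AddMonoidHom.mk' (fun v => show _ →+ _ from
    (AddMonoidHom.inr ℤ (DirectSum ℕ (FreeGLRS A))).comp
      (((AddMonoidHom.mk' (fun m : ℤ => m • DirectSum.of (FreeGLRS A) 1 (of (e v.1)))
        (fun a b => add_smul a b _)).coprod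
        (DirectSum.toAddMonoid fun m => (DirectSum.of (FreeGLRS A) (1 + m)).comp
          (GLRS.br (B := FreeGLRS A) rfl (of v.1))))))
    fun v w => by
      refine AddMonoidHom.ext fun x => Prod.ext rfl ?_
      obtain ⟨m, z⟩ := x
      change m • DirectSum.of (FreeGLRS A) 1 (of (e (v.1 + w.1))) + DirectSum.toAddMonoid _ z =
        (m • DirectSum.of (FreeGLRS A) 1 (of (e v.1)) + DirectSum.toAddMonoid _ z) +
        (m • DirectSum.of (FreeGLRS A) 1 (of (e w.1)) + DirectSum.toAddMonoid _ z)
      rw [map_add, map_add, map_add, smul_add, add_add_add_comm]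
      congr 1
      induction z using DirectSum.induction_on with
      | zero => simp
      | of k z =>
        rw [DirectSum.toAddMonoid_of, DirectSum.toAddMonoid_of, DirectSum.toAddMonoid_of]
        simp
      | add x y hx hy => rw [map_add, map_add, map_add, hx, hy]; abel

lemma adLetter_one (e : A →+ A) (v : A × B) :
    adLetter e v (1, 0) = (0, DirectSum.of (FreeGLRS A) 1 (of (e v.1))) := by
  refine Prod.ext rfl ?_
  refine (congrArg₂ (fun x y : DirectSum ℕ (FreeGLRS A) => x + y)
    (one_smul ℤ _) (map_zero (DirectSum.toAddMonoid fun m =>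
      (DirectSum.of (FreeGLRS A) (1 + m)).comp
        (GLRS.br (B := FreeGLRS A) rfl (of v.1))))).trans (add_zero _)

lemma adLetter_of (e : A →+ A) (v : A × B) {m : ℕ} (z : FreeGLRS A m) :
    adLetter e v (0, DirectSum.of (FreeGLRS A) m z) =
      (0, DirectSum.of (FreeGLRS A) (1 + m) (GLRS.br rfl (of v.1) z)) := by
  refine Prod.ext rfl ?_
  refine (congrArg₂ (fun x y : DirectSum ℕ (FreeGLRS A) => x + y)
    (zero_smul ℤ _) (DirectSum.toAddMonoid_of _ _ _)).trans (zero_add _)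

/-- The action of the tensor ring extending the action of the letters. -/
noncomputable def adHom (e : A →+ A) :
    TensorAlgebra ℤ (A × B) →+* AddMonoid.End (ℤ × DirectSum ℕ (FreeGLRS A)) :=
  tlift (adLetter e)

lemma of_zsmul {k : ℕ} (c : ℤ) (x : FreeGLRS A k) :
    ((0, DirectSum.of (FreeGLRS A) k (c • x)) : ℤ × DirectSum ℕ (FreeGLRS A)) =
      c • (0, DirectSum.of (FreeGLRS A) k x) := by
  rw [map_zsmul]; simp

lemma of_sub {k : ℕ} (x y : FreeGLRS A k) :
    ((0, DirectSum.of (FreeGLRS A) k (x - y)) : ℤ × DirectSum ℕ (FreeGLRS A)) =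
      (0, DirectSum.of (FreeGLRS A) k x) - (0, DirectSum.of (FreeGLRS A) k y) := by
  rw [map_sub]; simp

lemma adHom_sbr (e : A →+ A) (i j : ℕ) (x y : TensorAlgebra ℤ (A × B))
    (t : ℤ × DirectSum ℕ (FreeGLRS A)) : adHom e (sbr i j x y) t =
      adHom e x (adHom e y t) - (-1 : ℤ) ^ (i * j) • adHom e y (adHom e x t) := by
  rw [sbr, map_sub, map_zsmul, map_mul, map_mul]; rfl

/-- The tensor ring acts on the free object through iterated brackets with generators; by the Jacobi
identity and its analogue for squares, the image of x acts as the bracket with x. -/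
lemma adHom_of (e : A →+ A) {S : ℕ → A → Prop} {n c : ℕ} {x : FreeGLRS A n} (hx : Mon S c x)
    {m k : ℕ} (hk : n + m = k) (z : FreeGLRS A m) :
    adHom e (toT A B n x) (0, DirectSum.of (FreeGLRS A) m z) =
      (0, DirectSum.of (FreeGLRS A) k (GLRS.br hk x z)) := by
  induction hx generalizing m k with
  | of _ =>
    subst hk
    rw [toT_of, adHom, tlift_ι, adLetter_of]
  | @br i j l h c d x y _ _ h1 h2 =>
    rw [toT_br, adHom_sbr, h2 rfl, h1 (k := k) (by omega), h1 rfl, h2 (k := k) (by omega),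
      GLRS.br_br_eq h rfl hk (by omega) rfl (by omega), of_sub, of_zsmul]
  | @sq i l hi h c x _ h1 =>
    rw [toT_sq, map_mul]
    change adHom e (toT A B i x) (adHom e (toT A B i x) _) = _
    rw [h1 rfl, h1 (k := k) (by omega), GLRS.sq_br_eq hi h hk rfl (by omega)]

/-- An analogue of the Dynkin operator: acting on (1, 0), the last letter is replaced by its image
under e. The sum over a bracket reproduces the derivation extending e, which multiplies x by its
number c of counted generators. -/
lemma adHom_one (e : A →+ A) {S : ℕ → A → Prop} (hS : ∀ c a, S c a → e a = c • a) {n c : ℕ}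
    {x : FreeGLRS A n} (hx : Mon S c x) :
    adHom e (toT A B n x) (1, 0) = (0, DirectSum.of (FreeGLRS A) n (c • x)) := by
  induction hx with
  | of h =>
    rw [toT_of, adHom, tlift_ι, adLetter_one, hS _ _ h, map_nsmul]
  | @br i j l h c d x y hx hy h1 h2 =>
    have h' : j + i = l := by omega
    rw [toT_br, adHom_sbr, h1, h2, adHom_of e hx h, adHom_of e hy h', ← of_zsmul, ← of_sub,
      map_nsmul, map_nsmul, GLRS.br_comm_eq h h' x y, add_smul]
    congr 3
    module
  | @sq i l hi h c x hx h1 =>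
    rw [toT_sq, map_mul]
    change adHom e (toT A B i x) (adHom e (toT A B i x) _) = _
    have : GLRS.br h x (c • x) = (c + c) • GLRS.sq hi h x := by
      rw [map_nsmul, GLRS.br_self_eq hi]
      module
    rw [h1, adHom_of e hx h, this]

end

end FreeGLRS

/-! ### Injectivity of the comparison in prime weight -/

namespace FreeGLRS

section Injectivity

variable {A : Type u} [AddCommGroup A] {B : Type v} [AddCommGroup B]

/-- The endomorphism of the component of weight `n` extending an endomorphism of `A` as a
derivation; it factors through the tensor ring. -/
noncomputable def derOfT (B : Type v) [AddCommGroup B] (e : A →+ A) (n : ℕ) :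
    FreeGLRS A n →+ FreeGLRS A n :=
  AddMonoidHom.mk' (fun x => (adHom (B := B) e (toT A B n x) (1, 0)).2 n) fun x y => by
    rw [map_add, map_add]; rfl

/-- Each derivation is computed from the image in the tensor ring, so it annihilates the kernel of
the comparison. -/
lemma derOfT_eq_zero (e : A →+ A) {n : ℕ} {x : FreeGLRS A n} (hx : toT A B n x = 0) :
    derOfT B e n x = 0 := by
  change (adHom (B := B) e (toT A B n x) (1, 0)).2 n = 0
  rw [hx, map_zero]
  rfl

lemma derOfT_mon (e : A →+ A) {S : ℕ → A → Prop} (hS : ∀ c a, S c a → e a = c • a) {n c : ℕ}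
    {x : FreeGLRS A n} (hx : Mon S c x) : derOfT B e n x = c • x := by
  change (adHom (B := B) e (toT A B n x) (1, 0)).2 n = _
  rw [adHom_one e hS hx]
  exact DirectSum.of_eq_same _ _

/-- The elements of the images of two endomorphisms. -/
inductive SplitGen (e f : A →+ A) : ℕ → A → Prop
  | left (a : A) : SplitGen e f 1 (e a)
  | right (a : A) : SplitGen e f 0 (f a)

lemma SplitGen.le_one {e f : A →+ A} {c : ℕ} {a : A} (h : SplitGen e f c a) : c ≤ 1 := by
  obtain _ | _ := h <;> simp

lemma Mon.le {S : ℕ → A → Prop} (hS : ∀ c a, S c a → c ≤ 1) {n c : ℕ} {x : FreeGLRS A n}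
    (hx : Mon S c x) : c ≤ n := by
  induction hx with
  | of h => exact hS _ _ h
  | br _ _ _ _ _ => omega
  | sq _ _ _ _ => omega

lemma mem_closure_split {e f : A →+ A} (hef : e + f = AddMonoidHom.id A) {n : ℕ}
    (x : FreeGLRS A n) : x ∈ AddSubgroup.closure {y | ∃ c ≤ n, Mon (SplitGen e f) c y} := by
  refine mem_closure_mon (fun a => ?_) x
  have ha : e a + f a = a := DFunLike.congr_fun hef a
  have h1 : e a ∈ AddSubgroup.closure {a | ∃ c ≤ 1, SplitGen e f c a} :=
    AddSubgroup.subset_closure ⟨1, le_rfl, .left a⟩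
  have h2 : f a ∈ AddSubgroup.closure {a | ∃ c ≤ 1, SplitGen e f c a} :=
    AddSubgroup.subset_closure ⟨0, by omega, .right a⟩
  have := AddSubgroup.add_mem _ h1 h2
  rwa [ha] at this

lemma map_of {A' : Type u} [AddCommGroup A'] (g : A →+ A') (a : A) :
    (map g).app 1 (of a) = of (g a) := rfl

lemma map_split_left {e f : A →+ A} (he : e.comp e = e) (hef : e.comp f = 0) {n c : ℕ}
    {x : FreeGLRS A n} (hx : Mon (SplitGen e f) c x) :
    (c < n → (map e).app n x = 0) ∧ (c = n → (map e).app n x = x) := by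
  induction hx with
  | of h =>
    rw [map_of]
    obtain a | a := h
    · exact ⟨fun h => absurd h (by omega), fun _ => congrArg of (DFunLike.congr_fun he a)⟩
    · exact ⟨fun _ => (congrArg of (DFunLike.congr_fun hef a)).trans (map_zero of),
        fun h => absurd h (by omega)⟩
  | @br i j k h c d x y hx hy h1 h2 =>
    have := hx.le fun _ _ => SplitGen.le_one
    have := hy.le fun _ _ => SplitGen.le_one
    rw [(map e).map_br]
    refine ⟨fun hc => ?_, fun hc => by rw [h1.2 (by omega), h2.2 (by omega)]⟩
    by_cases hci : c < i
    · rw [h1.1 hci]; simp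
    · rw [h2.1 (by omega)]; simp
  | sq hi h hx h1 =>
    rw [(map e).map_sq]
    exact ⟨fun hc => by rw [h1.1 (by omega), GLRS.sq_zero], fun hc => by rw [h1.2 (by omega)]⟩

lemma map_split_right {e f : A →+ A} (hf : f.comp f = f) (hfe : f.comp e = 0) {n c : ℕ}
    {x : FreeGLRS A n} (hx : Mon (SplitGen e f) c x) :
    (1 ≤ c → (map f).app n x = 0) ∧ (c = 0 → (map f).app n x = x) := by
  induction hx with
  | of h =>
    rw [map_of]
    obtain a | a := h
    · exact ⟨fun _ => (congrArg of (DFunLike.congr_fun hfe a)).trans (map_zero of),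
        fun h => absurd h (by omega)⟩
    · exact ⟨fun h => absurd h (by omega), fun _ => congrArg of (DFunLike.congr_fun hf a)⟩
  | @br i j k h c d x y hx hy h1 h2 =>
    rw [(map f).map_br]
    refine ⟨fun hc => ?_, fun hc => by rw [h1.2 (by omega), h2.2 (by omega)]⟩
    by_cases hci : 1 ≤ c
    · rw [h1.1 hci]; simp
    · rw [h2.1 (by omega)]; simp
  | sq hi h hx h1 =>
    rw [(map f).map_sq]
    exact ⟨fun hc => by rw [h1.1 (by omega), GLRS.sq_zero], fun hc => by rw [h1.2 (by omega)]⟩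

lemma map_mem_ker {A' : Type u} [AddCommGroup A'] (f : A →+ A') {n : ℕ} {x : FreeGLRS A n}
    (hx : x ∈ (toT A B n).ker) : (map f).app n x ∈ (toT A' B n).ker := by
  change toT A' B n _ = 0
  rw [toT_map f (AddMonoidHom.id B), show toT A B n x = 0 from hx, map_zero]

/-- The derivation extending the identity of A is multiplication by the weight n. -/
lemma nsmul_eq_zero_of_ker {n : ℕ} {x : FreeGLRS A n} (hx : x ∈ (toT A B n).ker) :
    n • x = 0 := by
  have h1 := derOfT_eq_zero (AddMonoidHom.id A) hx
  have h2 : x ∈ AddSubgroup.closure {y : FreeGLRS A n | ∃ c ≤ n, Mon (fun c _ => c = 1) c y} :=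
    mem_closure_mon (fun a => AddSubgroup.subset_closure ⟨1, le_rfl, rfl⟩) x
  have h3 {m c : ℕ} {y : FreeGLRS A m} (hy : Mon (fun c (_ : A) => c = 1) c y) : c = m := by
    induction hy with
    | of h => exact h
    | br _ _ _ _ _ => omega
    | sq _ _ _ _ => omega
  rw [← h1]
  refine (sub_eq_zero.mp (additive_mem (Q := ⊥) (derOfT B (AddMonoidHom.id A) n -
    n • AddMonoidHom.id (FreeGLRS A n)) ?_ h2)).symm
  rintro y ⟨c, _, hy⟩
  obtain rfl := h3 hy
  refine sub_eq_zero.mpr (derOfT_mon (AddMonoidHom.id A) (fun c a h => ?_) hy)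
  rw [h, one_smul]; rfl

/-- The eigenvalue argument with the kernel as cycles and no boundaries: mixed components of kernel
elements vanish. -/
lemma eq_map_add_map {p : ℕ} (hp : p.Prime) {e f : A →+ A} (hef' : e + f = AddMonoidHom.id A)
    (he : e.comp e = e) {x : FreeGLRS A p} (hx : x ∈ (toT A B p).ker) :
    x - (map e).app p x - (map f).app p x = 0 := by
  have hf0 : f = AddMonoidHom.id A - e := (sub_eq_of_eq_add' hef'.symm).symm
  have hee (a) : e (e a) = e a := DFunLike.congr_fun he a
  have hef : e.comp f = 0 := by subst hf0; ext a; simp [hee]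
  have hfe : f.comp e = 0 := by subst hf0; ext a; simp [hee]
  have hf : f.comp f = f := by subst hf0; ext a; simp [hee]
  refine sub_sub_mem_of_eigen hp (Z := (toT A B p).ker) (N := ⊥) bot_le
    (E := derOfT B e p) (P := (map e).app p) (Q := (map f).app p)
    (W := fun c => {y | Mon (SplitGen e f) c y}) (fun z hz => derOfT_eq_zero e hz)
    (fun z hz => nsmul_eq_zero_of_ker hz) (fun z hz => map_mem_ker e hz)
    (fun z hz => map_mem_ker f hz)
    (fun c w hw => derOfT_mon e ?_ hw) (fun c hc w hw => (map_split_left he hef hw).1 hc)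
    (fun w hw => (map_split_left he hef hw).2 rfl)
    (fun c hc w hw => (map_split_right hf hfe hw).1 hc)
    (fun w hw => (map_split_right hf hfe hw).2 rfl) hx (mem_closure_split hef' x)
  rintro c a (a | a)
  · rw [one_smul]; exact hee a
  · rw [zero_smul]; exact DFunLike.congr_fun hef a

/-- The monomials in one generator. -/
lemma mon_singleton {a₀ : A} {S : ℕ → A → Prop} (hS : ∀ c a, S c a → a = a₀) {n c : ℕ}
    {x : FreeGLRS A n} (hx : Mon S c x) :
    (∃ h : 1 = n, x = h ▸ of a₀) ∨ (∃ (h : 2 = n) (m : ℤ),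
      x = m • (GLRS.sq (B := FreeGLRS A) (i := 1) odd_one h (of a₀))) ∨ x = 0 := by
  -- Weight 3 vanishes on one generator a, since {a, a^[2]} = {{a, a}, a} = 0. Thus only a and
  -- multiples of a^[2] survive.
  have key {k : ℕ} (h : 1 + 2 = k) :
      GLRS.br h (of a₀) (GLRS.sq odd_one (rfl : 1 + 1 = 2) (of a₀)) = 0 := by
    subst h
    rw [GLRS.br_sq odd_one rfl rfl rfl rfl, GLRS.br_br_self]
  induction hx with
  | of h => left; exact ⟨rfl, congrArg of (hS _ _ h)⟩
  | br h _ _ h1 h2 =>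
    right
    obtain ⟨rfl, rfl⟩ | ⟨rfl, m, rfl⟩ | rfl := h1
    · obtain ⟨rfl, rfl⟩ | ⟨rfl, m, rfl⟩ | rfl := h2
      · left
        exact ⟨h, 2, GLRS.br_self_eq odd_one h _⟩
      · right
        rw [map_zsmul]
        exact (congrArg (m • ·) (key h)).trans (smul_zero m)
      · right; simp
    · right
      obtain ⟨rfl, rfl⟩ | ⟨rfl, m', rfl⟩ | rfl := h2
      · rw [GLRS.br_comm_eq h (by omega), map_zsmul]
        have := key (show 1 + 2 = _ by omega)
        refine (congrArg (fun t => -((-1 : ℤ) ^ (2 * 1) • m • t)) this).trans ?_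
        simp
      · rw [map_zsmul, map_zsmul, AddMonoidHom.zsmul_apply, GLRS.br_self even_two]
        simp
      · simp
    · right; simp
  | sq hi h _ h1 =>
    right
    obtain ⟨rfl, rfl⟩ | ⟨rfl, m, rfl⟩ | rfl := h1
    · left
      exact ⟨h, 1, (one_smul ℤ _).symm⟩
    · exact absurd hi (by decide)
    · right
      exact GLRS.sq_zero hi h

end Injectivity

/-! ### The kernel of the comparison for free and projective groups -/

section Free

variable {I : Type u} {B : Type v} [AddCommGroup B]

lemma map_singleton_eq_zero {p : ℕ} (hp : p.Prime) (b : I) {x : FreeGLRS (I →₀ ℤ) p}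
    (hx : x ∈ (toT (I →₀ ℤ) B p).ker) : (map (coordProj {b})).app p x = 0 := by
  have h1 : toT (I →₀ ℤ) B p ((map (coordProj {b})).app p x) = 0 := map_mem_ker _ hx
  have h2 : (map (coordProj {b})).app p x ∈ AddSubgroup.closure
      {y | ∃ c ≤ p, Mon (fun _ (a : I →₀ ℤ) => a = Finsupp.single b 1) c y} := by
    refine map_mem_closure_mon _ (fun a => ?_) x
    rw [coordProj_singleton]
    refine AddSubgroup.zsmul_mem _ (AddSubgroup.subset_closure ?_) _
    exact ⟨0, by omega, rfl⟩
  by_cases h2p : 2 = p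
  · subst h2p
    have h3 : (map (coordProj {b})).app 2 x ∈ AddSubgroup.zmultiples
        (GLRS.sq (B := FreeGLRS (I →₀ ℤ)) odd_one (rfl : 1 + 1 = 2)
          (of (Finsupp.single b (1 : ℤ)))) := by
      refine (AddSubgroup.closure_le _).mpr ?_ h2
      rintro y ⟨c, _, hy⟩
      obtain ⟨h, _⟩ | ⟨h, m, rfl⟩ | rfl := mon_singleton (fun _ _ h => h) hy
      · omega
      · exact ⟨m, rfl⟩
      · exact AddSubgroup.zero_mem _
    obtain ⟨m, hm⟩ := h3
    have hm' : m • GLRS.sq (B := FreeGLRS (I →₀ ℤ)) odd_one (rfl : 1 + 1 = 2)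
          (of (Finsupp.single b (1 : ℤ))) = (map (coordProj {b})).app 2 x := hm
    rw [← hm', map_zsmul, toT_sq, toT_of] at h1
    -- For p = 2 a multiple of the square of a basis element has to be detected: the coordinate b
    -- defines a map to ℤ[X] sending the square to X².
    let φ : TensorAlgebra ℤ ((I →₀ ℤ) × B) →+* Polynomial ℤ :=
      tlift (AddMonoidHom.mk' (fun v => v.1 b • Polynomial.X) fun v w => by
        rw [Prod.fst_add, Finsupp.add_apply, add_smul])
    have h4 : φ (tι (Finsupp.single b (1 : ℤ), (0 : B))) = Polynomial.X := by
      refine (tlift_ι _ _).trans ?_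
      simp
    have h5 := congrArg φ h1
    rw [map_zsmul, map_mul, h4, map_zero, smul_eq_zero] at h5
    rw [← hm', h5.resolve_right (mul_ne_zero Polynomial.X_ne_zero Polynomial.X_ne_zero)]
    exact zero_smul ℤ _
  · refine (AddSubgroup.closure_le (⊥ : AddSubgroup (FreeGLRS (I →₀ ℤ) p))).mpr ?_ h2
    rintro y ⟨c, _, hy⟩
    obtain ⟨h, _⟩ | ⟨h, _⟩ | rfl := mon_singleton (fun _ _ h => h) hy
    · exact absurd h.symm hp.ne_one
    · exact absurd h h2p
    · rfl

lemma exists_finset_map {n : ℕ} (x : FreeGLRS (I →₀ ℤ) n) :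
    ∃ s : Finset I, ∀ t, s ⊆ t → (map (coordProj t)).app n x = x := by
  classical
  induction x using ind with | h x =>
  induction x with
  | of a => exact ⟨a.support, fun t ht => congrArg of (coordProj_apply_eq ht)⟩
  | zero n => exact ⟨∅, fun t _ => rfl⟩
  | add x y hx hy =>
    obtain ⟨s, hs⟩ := hx
    obtain ⟨t, ht⟩ := hy
    refine ⟨s ∪ t, fun u hu => ?_⟩
    rw [mk_add, map_add, hs u (Finset.union_subset_left hu), ht u (Finset.union_subset_right hu)]
  | smul a x hx =>
    obtain ⟨s, hs⟩ := hx
    exact ⟨s, fun u hu => congrArg (a • ·) (hs u hu)⟩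
  | br h x y hx hy =>
    obtain ⟨s, hs⟩ := hx
    obtain ⟨t, ht⟩ := hy
    refine ⟨s ∪ t, fun u hu => ?_⟩
    rw [show mk (Expr.br h x y) = GLRS.br h (mk x) (mk y) from rfl, (map _).map_br,
      hs u (Finset.union_subset_left hu), ht u (Finset.union_subset_right hu)]
  | sq hi h x hx =>
    obtain ⟨s, hs⟩ := hx
    refine ⟨s, fun u hu => ?_⟩
    rw [show mk (Expr.sq hi h x) = GLRS.sq hi h (mk x) from rfl, (map _).map_sq, hs u hu]

lemma map_zero_eq_zero {A A' : Type u} [AddCommGroup A] [AddCommGroup A'] {n : ℕ}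
    (x : FreeGLRS A n) : (map (0 : A →+ A')).app n x = 0 := by
  have h1 := map_mem_closure_mon (S := fun _ _ => False) (0 : A →+ A')
    (fun a => AddSubgroup.zero_mem _) x
  have h2 {m c : ℕ} {y : FreeGLRS A' m} (hy : Mon (fun _ _ => False) c y) : False := by
    induction hy with
    | of h => exact h
    | br _ _ _ _ h => exact h
    | sq _ _ _ h => exact h
  refine (AddSubgroup.closure_le (⊥ : AddSubgroup (FreeGLRS A' n))).mpr ?_ h1
  rintro y ⟨c, _, hy⟩
  exact (h2 hy).elim

lemma toT_injective_free {p : ℕ} (hp : p.Prime) {x : FreeGLRS (I →₀ ℤ) p}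
    (hx : x ∈ (toT (I →₀ ℤ) B p).ker) : x = 0 := by
  classical
  have key (s : Finset I) : (map (coordProj s)).app p x = 0 := by
    induction s using Finset.induction_on with
    | empty => rw [coordProj_empty, map_zero_eq_zero]
    | insert b s hb ih =>
      have e1 : (coordProj {b}).comp (coordProj (insert b s)) = coordProj {b} := by
        rw [coordProj_comp, Finset.singleton_inter_of_mem (Finset.mem_insert_self b s)]
      have e2 : (AddMonoidHom.id _ - coordProj {b}).comp (coordProj (insert b s)) =
          coordProj s := by
        rw [AddMonoidHom.sub_comp, e1, coordProj_insert hb, AddMonoidHom.id_comp,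
          add_sub_cancel_left]
      have h := eq_map_add_map hp (e := coordProj {b}) (f := AddMonoidHom.id _ - coordProj {b})
        (by abel) (by rw [coordProj_comp, Finset.inter_self])
        (map_mem_ker (coordProj (insert b s)) hx)
      rw [map_map, map_map, e1, e2, ih, sub_zero, map_singleton_eq_zero hp b hx, sub_zero] at h
      exact h
  obtain ⟨s, hs⟩ := exists_finset_map x
  rw [← hs s subset_rfl, key]

end Free

/-- The comparison with the tensor ring is injective for projective groups. -/
theorem toT_injective {A : Type u} [AddCommGroup A] {B : Type v} [AddCommGroup B] {p : ℕ}
    (hp : p.Prime) {I : Type u} (j : A →+ (I →₀ ℤ)) (q : (I →₀ ℤ) →+ A) (hq : ∀ a, q (j a) = a) :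
    Function.Injective (toT A B p) := by
  refine (injective_iff_map_eq_zero _).mpr fun x hx => ?_
  have h := toT_injective_free hp (map_mem_ker (B := B) j hx)
  have e : q.comp j = AddMonoidHom.id A := AddMonoidHom.ext hq
  rw [← map_id x, ← e, ← map_map, h, map_zero]

end FreeGLRS

/-! ### Degree zero: the Lie functor in terms of Lie monomials -/

section LieComponent

attribute [local instance] LieRing.ofAssociativeRing

variable {B : Type u} [AddCommGroup B] [Module ℤ B]

/-- The generators of the tensor ring, in the degree `0`. -/
inductive Gen (B : Type u) [AddCommGroup B] [Module ℤ B] : ℕ → TensorAlgebra ℤ B → Prop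
  | ι (b : B) : Gen B 0 (tι b)

lemma LieMon.degree_eq_zero {n k : ℕ} {x : TensorAlgebra ℤ B} (h : LieMon (Gen B) n k x) :
    k = 0 := by
  induction h with
  | letter h => obtain ⟨⟩ := h; rfl
  | br _ _ h1 h2 => omega
  | sq _ _ h => omega

lemma sbr_zero_zero {R : Type*} [Ring R] (x y : R) : sbr 0 0 x y = x * y - y * x := by
  simp [sbr]

lemma lieMon_mem_pow {n k : ℕ} {x : TensorAlgebra ℤ B} (h : LieMon (Gen B) n k x) :
    x ∈ LinearMap.range (TensorAlgebra.ι ℤ (M := B)) ^ n := by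
  induction h with
  | letter h =>
    obtain ⟨b⟩ := h
    rw [pow_one]
    exact ⟨b, rfl⟩
  | @br n k m l x y hx hy h1 h2 =>
    obtain rfl := hx.degree_eq_zero
    obtain rfl := hy.degree_eq_zero
    rw [sbr_zero_zero]
    refine Submodule.sub_mem _ ?_ ?_
    · rw [pow_add]; exact Submodule.mul_mem_mul h1 h2
    · rw [add_comm, pow_add]; exact Submodule.mul_mem_mul h2 h1
  | sq _ _ h => rw [pow_add]; exact Submodule.mul_mem_mul h h

lemma lieMon_mem_lieComponent {n k : ℕ} {x : TensorAlgebra ℤ B} (h : LieMon (Gen B) n k x) :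
    x ∈ lieComponent n B := by
  refine ⟨?_, lieMon_mem_pow h⟩
  induction h with
  | letter h =>
    obtain ⟨b⟩ := h
    exact LieSubalgebra.subset_lieSpan ⟨b, rfl⟩
  | @br n k m l x y hx hy h1 h2 =>
    obtain rfl := hx.degree_eq_zero
    obtain rfl := hy.degree_eq_zero
    rw [sbr_zero_zero]
    exact LieSubalgebra.lie_mem _ h1 h2
  | @sq n k x hx hk _ =>
    obtain rfl := hx.degree_eq_zero
    simp at hk

/-- The Lie monomials of all weights span a Lie subring containing the generators, and they are
homogeneous, so the component of weight n is spanned by those of weight n. -/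
lemma mem_lieSpan_of_mem_lieComponent {n : ℕ} {x : TensorAlgebra ℤ B}
    (hx : x ∈ lieComponent n B) : x ∈ lieSpan (Gen B) n 0 := by
  obtain ⟨h1, h2⟩ := hx
  have h3 : x ∈ AddSubgroup.closure {y | ∃ m, LieMon (Gen B) m 0 y} := by
    let L : LieSubalgebra ℤ (TensorAlgebra ℤ B) :=
      { carrier := AddSubgroup.closure {y | ∃ m, LieMon (Gen B) m 0 y}
        add_mem' := AddSubgroup.add_mem _
        zero_mem' := AddSubgroup.zero_mem _
        smul_mem' := fun c x hx => by
          have : c • x = (AddCommGroup.toIntModule (TensorAlgebra ℤ B)).toSMul.smul c x :=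
            int_smul_eq_zsmul _ c x
          rw [this]
          exact AddSubgroup.zsmul_mem _ hx c
        lie_mem' := fun {x y} hx hy => by
          have h := biadditive_mem (sbrHom 0 0) (Q := AddSubgroup.closure
            {y | ∃ m, LieMon (Gen B) m 0 y}) ?_ hx hy
          · rw [sbrHom_apply, sbr_zero_zero] at h
            exact h
          · rintro x ⟨m, hx⟩ y ⟨m', hy⟩
            exact AddSubgroup.subset_closure ⟨m + m', LieMon.br hx hy⟩ }
    have hL : LieSubalgebra.lieSpan ℤ (TensorAlgebra ℤ B) (Set.range (TensorAlgebra.ι ℤ)) ≤ L := by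
      rw [LieSubalgebra.lieSpan_le]
      rintro _ ⟨b, rfl⟩
      exact AddSubgroup.subset_closure ⟨1, .letter (.ι b)⟩
    exact hL h1
  let 𝒜 : ℕ → Submodule ℤ (TensorAlgebra ℤ B) :=
    fun n => LinearMap.range (TensorAlgebra.ι ℤ (M := B)) ^ n
  -- The projection to weight n fixes x, and it keeps the monomials of weight n and kills the
  -- others.
  have h4 : GradedRing.proj 𝒜 n x ∈ lieSpan (Gen B) n 0 := by
    refine additive_mem (GradedRing.proj 𝒜 n) ?_ h3
    rintro y ⟨m, hy⟩
    rw [GradedRing.proj_apply, DirectSum.decompose_of_mem 𝒜 (lieMon_mem_pow hy)]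
    by_cases hmn : m = n
    · subst hmn
      rw [DirectSum.of_eq_same]
      exact AddSubgroup.subset_closure hy
    · rw [DirectSum.of_eq_of_ne _ _ _ (Ne.symm hmn)]
      exact AddSubgroup.zero_mem _
  rwa [GradedRing.proj_apply, DirectSum.decompose_of_mem_same 𝒜 h2] at h4

lemma tmap_eq_tensorMap {B' : Type u} [AddCommGroup B'] [Module ℤ B'] (f : B →ₗ[ℤ] B')
    (x : TensorAlgebra ℤ B) : tmap f.toAddMonoidHom x = tensorMap f x :=
  RingHom.congr_fun (f := tmap f.toAddMonoidHom) (g := (tensorMap f).toRingHom)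
    (tensor_hom_ext fun v => (tmap_ι _ _).trans (tensorMap_ι f v).symm) x

variable {A : Type v} [AddCommGroup A]

lemma tmap_inr_mem {n : ℕ} {x : TensorAlgebra ℤ B} (hx : x ∈ lieComponent n B) :
    tmap (AddMonoidHom.inr A B) x ∈ lieSpan (Letter A B) n 0 := by
  refine lieSpan_map (tmap (AddMonoidHom.inr A B)) ?_ (mem_lieSpan_of_mem_lieComponent hx)
  rintro k _ ⟨b⟩
  rw [tmap_ι]
  exact AddSubgroup.subset_closure (.letter (.even b))

/-- Monomials of degree 0 contain neither letters of A nor squares, so nothing is lost in passing to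
the tensor ring of B. -/
lemma tmap_snd_mem {n : ℕ} {x : TensorAlgebra ℤ (A × B)} (hx : x ∈ lieSpan (Letter A B) n 0) :
    tmap (AddMonoidHom.snd A B) x ∈ lieComponent n B ∧
      tmap (AddMonoidHom.inr A B) (tmap (AddMonoidHom.snd A B) x) = x := by
  have key {n k : ℕ} {x : TensorAlgebra ℤ (A × B)} (hx : LieMon (Letter A B) n k x) (hk : k = 0) :
      LieMon (Gen B) n 0 (tmap (AddMonoidHom.snd A B) x) ∧
      tmap (AddMonoidHom.inr A B) (tmap (AddMonoidHom.snd A B) x) = x := by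
    induction hx with
    | letter h =>
      obtain a | b := h
      · omega
      · rw [tmap_ι, tmap_ι]
        exact ⟨.letter (.ι b), rfl⟩
    | br _ _ h1 h2 =>
      obtain ⟨rfl, rfl⟩ := Nat.add_eq_zero_iff.mp hk
      obtain ⟨h1, h1'⟩ := h1 rfl
      obtain ⟨h2, h2'⟩ := h2 rfl
      rw [sbr, map_sub, map_sub, map_zsmul, map_zsmul, map_mul, map_mul, map_mul, map_mul, h1', h2']
      exact ⟨.br h1 h2, rfl⟩
    | sq _ hk' _ =>
      obtain rfl := (Nat.add_eq_zero_iff.mp hk).1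
      simp at hk'
  refine ⟨?_, ?_⟩
  · exact additive_mem (Q := (lieComponent n B).toAddSubgroup)
      (tmap (AddMonoidHom.snd A B)).toAddMonoidHom
      (fun y hy => lieMon_mem_lieComponent (key hy rfl).1) hx
  · exact sub_eq_zero.mp (additive_mem (Q := ⊥) ((tmap (AddMonoidHom.inr A B)).toAddMonoidHom.comp
      (tmap (AddMonoidHom.snd A B)).toAddMonoidHom - AddMonoidHom.id _)
      (fun y hy => sub_eq_zero.mpr (key hy rfl).2) hx)

end LieComponent

/-! ### The components of the Lie superring as functors -/

section Graded

variable (A B : Type u) [AddCommGroup A] [AddCommGroup B] (p k : ℕ)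

/-- The component of weight `p` and of degree `k` of the Lie superring generated by `A` in the
degree `1` and by `B` in the degree `0`. -/
abbrev LieGr : Type u := lieSpan (Letter A B) p k

variable {A B} {A' B' : Type u} [AddCommGroup A'] [AddCommGroup B']

/-- Functoriality of the components of a Lie superring. -/
noncomputable def LieGr.map (f : A →+ A') (g : B →+ B') : LieGr A B p k →+ LieGr A' B' p k :=
  AddMonoidHom.mk' (fun x => ⟨tmap (f.prodMap g) x.1, tmap_mem_lieSpan f g x.2⟩) fun _ _ =>
    Subtype.ext (map_add _ _ _)

lemma tmap_prodMap_id (x : TensorAlgebra ℤ (A × B)) :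
    tmap ((AddMonoidHom.id A).prodMap (AddMonoidHom.id B)) x = x := by
  have h : (AddMonoidHom.id A).prodMap (AddMonoidHom.id B) = AddMonoidHom.id (A × B) :=
    AddMonoidHom.ext fun _ => rfl
  rw [h, tmap_id_apply]

lemma tmap_prodMap_comp {A'' B'' : Type u} [AddCommGroup A''] [AddCommGroup B''] (f : A →+ A')
    (g : B →+ B') (f' : A' →+ A'') (g' : B' →+ B'') (x : TensorAlgebra ℤ (A × B)) :
    tmap ((f'.comp f).prodMap (g'.comp g)) x = tmap (f'.prodMap g') (tmap (f.prodMap g) x) := by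
  have h : (f'.comp f).prodMap (g'.comp g) = (f'.prodMap g').comp (f.prodMap g) :=
    AddMonoidHom.ext fun _ => rfl
  rw [h, tmap_tmap]

lemma LieGr.map_id_apply (x : LieGr A B p k) :
    LieGr.map p k (AddMonoidHom.id A) (AddMonoidHom.id B) x = x :=
  Subtype.ext (tmap_prodMap_id x.1)

lemma LieGr.map_comp_apply {A'' B'' : Type u} [AddCommGroup A''] [AddCommGroup B''] (f : A →+ A')
    (g : B →+ B') (f' : A' →+ A'') (g' : B' →+ B'') (x : LieGr A B p k) :
    LieGr.map p k (f'.comp f) (g'.comp g) x = LieGr.map p k f' g' (LieGr.map p k f g x) :=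
  Subtype.ext (tmap_prodMap_comp _ _ _ _ x.1)

/-- The group of the boundaries. -/
abbrev BdGr (i : A →+ B) : Type u := boundaries i p k

/-- Functoriality of the boundaries. -/
noncomputable def BdGr.map {i : A →+ B} {i' : A' →+ B'} (f : A →+ A') (g : B →+ B')
    (h : g.comp i = i'.comp f) : BdGr p k i →+ BdGr p k i' :=
  AddMonoidHom.mk' (fun x => ⟨tmap (f.prodMap g) x.1, by
    obtain ⟨_, y, hy, rfl⟩ := x
    exact ⟨tmap (f.prodMap g) y, tmap_mem_lieSpan f g hy, diff_tmap i i' f g h y⟩⟩) fun _ _ =>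
    Subtype.ext (map_add _ _ _)

lemma BdGr.map_id_apply {i : A →+ B} (x : BdGr p k i) :
    BdGr.map p k (AddMonoidHom.id A) (AddMonoidHom.id B) rfl x = x :=
  Subtype.ext (tmap_prodMap_id x.1)

lemma BdGr.map_comp_apply {A'' B'' : Type u} [AddCommGroup A''] [AddCommGroup B''] {i : A →+ B}
    {i' : A' →+ B'} {i'' : A'' →+ B''} (f : A →+ A') (g : B →+ B') (f' : A' →+ A'') (g' : B' →+ B'')
    (h : g.comp i = i'.comp f) (h' : g'.comp i' = i''.comp f')
    (h'' : (g'.comp g).comp i = i''.comp (f'.comp f)) (x : BdGr p k i) :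
    BdGr.map p k (f'.comp f) (g'.comp g) h'' x = BdGr.map p k f' g' h' (BdGr.map p k f g h x) :=
  Subtype.ext (tmap_prodMap_comp _ _ _ _ x.1)

/-- The inclusion of the boundaries. -/
noncomputable def BdGr.incl (i : A →+ B) : BdGr p k i →+ LieGr A B p k :=
  AddMonoidHom.mk' (fun x => ⟨x.1, by
    obtain ⟨_, y, hy, rfl⟩ := x
    exact diff_mem_lieSpan i hy⟩) fun _ _ => rfl

/-- The differential, with values in the boundaries. -/
noncomputable def LieGr.d (i : A →+ B) : LieGr A B p (k + 1) →+ BdGr p k i :=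
  AddMonoidHom.mk' (fun x => ⟨diff i x.1, x.1, x.2, rfl⟩) fun _ _ =>
    Subtype.ext (map_add _ _ _)

/-- The map to the component of the Lie ring generated by a quotient of `B`. -/
noncomputable def LieGr.augment [Module ℤ B] {D : Type u} [AddCommGroup D] [Module ℤ D]
    (g : B →ₗ[ℤ] D) : LieGr A B p 0 →+ lieComponent p D :=
  AddMonoidHom.mk' (fun x => ⟨tensorMap g (tmap (AddMonoidHom.snd A B) x.1),
    lieComponent_map p g _ (tmap_snd_mem x.2).1⟩) fun x y => Subtype.ext (by
      change tensorMap g (tmap _ (x.1 + y.1)) = tensorMap g (tmap _ x.1) + tensorMap g (tmap _ y.1)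
      rw [map_add, map_add])

/-- The map from the free graded Lie ring with squares. -/
noncomputable def LieGr.ofFree (A B : Type u) [AddCommGroup A] [AddCommGroup B] :
    FreeGLRS A p →+ LieGr A B p p :=
  AddMonoidHom.mk' (fun x => ⟨FreeGLRS.toT A B p x, FreeGLRS.toT_mem x⟩) fun _ _ =>
    Subtype.ext (map_add _ _ _)

/-- `kerProj` kills the letters of A, and one occurs in every monomial of positive degree. The extra
condition on cycles is thus felt only in degree 0. -/
lemma tmap_kerProj_eq_zero {i : A →+ B} {r : B →+ A} {n k : ℕ} {x : TensorAlgebra ℤ (A × B)}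
    (hx : x ∈ lieSpan (Letter A B) n (k + 1)) : tmap (kerProj i r) x = 0 := by
  have key {n k : ℕ} {x : TensorAlgebra ℤ (A × B)} (hx : LieMon (Letter A B) n k x) (hk : 1 ≤ k) :
      tmap (kerProj i r) x = 0 := by
    induction hx with
    | letter h =>
      obtain a | b := h
      · rw [tmap_ι, kerProj_apply]
        simp [← Prod.zero_eq_mk]
      · omega
    | @br n k m l x y _ _ h1 h2 =>
      rw [sbr, map_sub, map_zsmul, map_mul, map_mul]
      by_cases h : 1 ≤ k
      · rw [h1 h]; simp
      · rw [h2 (by omega)]; simp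
    | sq _ _ h => rw [map_mul, h (by omega), mul_zero]
  exact additive_mem (Q := ⊥) (tmap (kerProj i r)).toAddMonoidHom
    (fun y hy => key hy (by omega)) hx

/-- A monomial of degree less than its weight contains a letter of B. This makes the components
below the top degree contractible when B is. -/
lemma LieGr.map_zero {n k : ℕ} (h : k < n) (f : A →+ A') :
    LieGr.map n k f (0 : B →+ B') = 0 := by
  have key {n k : ℕ} {x : TensorAlgebra ℤ (A × B)} (hx : LieMon (Letter A B) n k x) :
      k < n → tmap (f.prodMap (0 : B →+ B')) x = 0 := by
    induction hx with
    | letter h =>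
      obtain a | b := h
      · omega
      · intro _
        rw [tmap_ι]
        simp [← Prod.zero_eq_mk]
    | @br n k m l x y _ _ h1 h2 =>
      intro h
      rw [sbr, map_sub, map_zsmul, map_mul, map_mul]
      by_cases h' : k < n
      · rw [h1 h']; simp
      · rw [h2 (by omega)]; simp
    | sq _ _ h => intro h'; rw [map_mul, h (by omega), mul_zero]
  ext x
  exact additive_mem (Q := ⊥) (tmap (f.prodMap (0 : B →+ B'))).toAddMonoidHom
    (fun y hy => key hy h) x.2

end Graded

/-! ### The short exact sequences of boundaries, natural in the extension -/

section Functors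

/-- The functor `LieGr` on pairs of abelian groups. -/
noncomputable def lieGrPair (p k : ℕ) : Ab.{u} × Ab.{u} ⥤ Ab.{u} where
  obj X := ModuleCat.of ℤ (LieGr X.1 X.2 p k)
  map φ := ModuleCat.ofHom
    (LieGr.map p k φ.1.hom.toAddMonoidHom φ.2.hom.toAddMonoidHom).toIntLinearMap
  map_id _ := ModuleCat.hom_ext (LinearMap.ext fun x => LieGr.map_id_apply p k x)
  map_comp φ ψ := ModuleCat.hom_ext (LinearMap.ext fun x =>
    LieGr.map_comp_apply p k φ.1.hom.toAddMonoidHom φ.2.hom.toAddMonoidHom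
      ψ.1.hom.toAddMonoidHom ψ.2.hom.toAddMonoidHom x)

/-- The functor `LieGr` on short complexes. -/
noncomputable def lieGrFunctor (p k : ℕ) : ShortComplex Ab.{u} ⥤ Ab.{u} :=
  (ShortComplex.π₁.prod' ShortComplex.π₂) ⋙ lieGrPair p k

lemma comm_addHom {S T : ShortComplex Ab.{u}} (φ : S ⟶ T) :
    φ.τ₂.hom.toAddMonoidHom.comp S.f.hom.toAddMonoidHom =
      T.f.hom.toAddMonoidHom.comp φ.τ₁.hom.toAddMonoidHom :=
  AddMonoidHom.ext fun a => (ConcreteCategory.congr_hom φ.comm₁₂ a).symm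

/-- The functor of the boundaries on short complexes. -/
noncomputable def bdFunctor (p k : ℕ) : ShortComplex Ab.{u} ⥤ Ab.{u} where
  obj S := ModuleCat.of ℤ (BdGr p k S.f.hom.toAddMonoidHom)
  map φ := ModuleCat.ofHom
    (BdGr.map p k φ.τ₁.hom.toAddMonoidHom φ.τ₂.hom.toAddMonoidHom (comm_addHom φ)).toIntLinearMap
  map_id _ := ModuleCat.hom_ext (LinearMap.ext fun x => BdGr.map_id_apply p k x)
  map_comp φ ψ := ModuleCat.hom_ext (LinearMap.ext fun x =>
    BdGr.map_comp_apply p k _ _ _ _ (comm_addHom φ) (comm_addHom ψ) (comm_addHom (φ ≫ ψ)) x)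

/-- The inclusion of the boundaries. -/
noncomputable def bdIncl (p k : ℕ) : bdFunctor.{u} p k ⟶ lieGrFunctor p k where
  app S := ModuleCat.ofHom (BdGr.incl p k S.f.hom.toAddMonoidHom).toIntLinearMap
  naturality _ _ _ := rfl

/-- The differential. -/
noncomputable def lieGrD (p k : ℕ) : lieGrFunctor.{u} p (k + 1) ⟶ bdFunctor p k where
  app S := ModuleCat.ofHom (LieGr.d p k S.f.hom.toAddMonoidHom).toIntLinearMap
  naturality S _ φ := ModuleCat.hom_ext (LinearMap.ext fun x : LieGr S.X₁ S.X₂ p (k + 1) =>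
    Subtype.ext (diff_tmap _ _ _ _ (comm_addHom φ) x.1))

lemma tensorMap_comp_tmap {A B A' B' D D' : Type u} [AddCommGroup A] [AddCommGroup B]
    [AddCommGroup A'] [AddCommGroup B'] [AddCommGroup D] [AddCommGroup D']
    [Module ℤ B] [Module ℤ B'] [Module ℤ D] [Module ℤ D'] (f : A →+ A') (g : B →ₗ[ℤ] B')
    (q : B →ₗ[ℤ] D) (q' : B' →ₗ[ℤ] D') (h : D →ₗ[ℤ] D') (hq : q' ∘ₗ g = h ∘ₗ q)
    (x : TensorAlgebra ℤ (A × B)) :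
    tensorMap q' (tmap (AddMonoidHom.snd A' B') (tmap (f.prodMap g.toAddMonoidHom) x)) =
      tensorMap h (tensorMap q (tmap (AddMonoidHom.snd A B) x)) := by
  rw [← tmap_eq_tensorMap, ← tmap_eq_tensorMap, ← tmap_eq_tensorMap, tmap_tmap, tmap_tmap,
    tmap_tmap, tmap_tmap]
  congr 2
  exact AddMonoidHom.ext fun v => LinearMap.congr_fun hq v.2

/-- The augmentation. -/
noncomputable def lieGrAugment (p : ℕ) :
    lieGrFunctor.{u} p 0 ⟶ ShortComplex.π₃ ⋙ lieFunctor p where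
  app S := ModuleCat.ofHom (LieGr.augment p S.g.hom).toIntLinearMap
  naturality S T φ := ModuleCat.hom_ext (LinearMap.ext fun x : LieGr S.X₁ S.X₂ p 0 =>
    Subtype.ext (tensorMap_comp_tmap φ.τ₁.hom.toAddMonoidHom φ.τ₂.hom S.g.hom T.g.hom
      φ.τ₃.hom (congrArg ModuleCat.Hom.hom φ.comm₂₃) x.1))

/-- The comparison with the free graded Lie rings with squares. -/
noncomputable def superLieToGr (p : ℕ) :
    ShortComplex.π₁ ⋙ superLieFunctor.{u} p ⟶ lieGrFunctor p p where
  app S := ModuleCat.ofHom (LieGr.ofFree p S.X₁ S.X₂).toIntLinearMap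
  naturality _ _ _ := ModuleCat.hom_ext (LinearMap.ext fun x =>
    Subtype.ext (FreeGLRS.toT_map _ _ x))

/-- Short exact sequences with projective outer terms. -/
structure IsProjSES (S : ShortComplex Ab.{u}) : Prop where
  exact : S.ShortExact
  proj₁ : Projective S.X₁
  proj₃ : Projective S.X₃

variable {S : ShortComplex Ab.{u}}

lemma exists_retract_finsupp (X : Ab.{u}) [Projective X] :
    ∃ (j : X →+ (X →₀ ℤ)) (q : (X →₀ ℤ) →+ X), ∀ a, q (j a) = a := by
  let q : ModuleCat.of ℤ (X →₀ ℤ) ⟶ X := ModuleCat.ofHom (Finsupp.linearCombination ℤ id)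
  have : Epi q := by
    rw [ModuleCat.epi_iff_surjective]
    intro x
    exact ⟨Finsupp.single x 1, (Finsupp.linearCombination_single ℤ 1 x).trans
    (@one_smul ℤ X _ X.isModule.toMulAction x)⟩
  refine ⟨(Projective.factorThru (𝟙 X) q).hom.toAddMonoidHom, q.hom.toAddMonoidHom, fun a => ?_⟩
  exact ConcreteCategory.congr_hom (Projective.factorThru_comp (𝟙 X) q) a

lemma IsProjSES.exists_splitting (hS : IsProjSES S) : ∃ (r : S.X₂ →+ S.X₁) (t : S.X₃ →ₗ[ℤ] S.X₂),
    (∀ a, r (S.f.hom a) = a) ∧ (∀ d, S.g.hom (t d) = d) ∧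
    ∀ b, b - S.f.hom (r b) = t (S.g.hom b) := by
  have := hS.proj₃
  let s := hS.exact.splittingOfProjective
  refine ⟨s.r.hom.toAddMonoidHom, s.s.hom, fun a => ConcreteCategory.congr_hom s.f_r a,
    fun d => ConcreteCategory.congr_hom s.s_g d, fun b => ?_⟩
  have h : S.f.hom (s.r.hom b) + s.s.hom (S.g.hom b) = b := ConcreteCategory.congr_hom s.id b
  exact sub_eq_iff_eq_add'.mpr h.symm

lemma IsProjSES.mem_boundaries (hS : IsProjSES S) {p : ℕ} (hp : p.Prime) {k : ℕ}
    {x : LieGr S.X₁ S.X₂ p (k + 1)} (hx : diff S.f.hom.toAddMonoidHom x.1 = 0) :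
    x.1 ∈ boundaries S.f.hom.toAddMonoidHom p (k + 1) := by
  obtain ⟨r, t, hr, ht, hrt⟩ := hS.exists_splitting
  have := hS.proj₁
  obtain ⟨j, q, hq⟩ := exists_retract_finsupp S.X₁
  exact cycles_le_boundaries hp (r := r) hr j q hq _
    (mem_cycles.mpr ⟨x.2, hx, tmap_kerProj_eq_zero x.2⟩)

lemma injective_of_val_eq {G H : Type*} {T : Type*} {i : G → H} {a : G → T} {b : H → T}
    (ha : Function.Injective a) (h : ∀ x, b (i x) = a x) : Function.Injective i :=
  fun x y hxy => ha (by rw [← h, ← h, hxy])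

lemma bdIncl_comp_lieGrD (p k : ℕ) : bdIncl.{u} p (k + 1) ≫ lieGrD p k = 0 := by
  ext S x
  obtain ⟨_, y, hy, rfl⟩ := x
  exact Subtype.ext (diff_diff _ y)

lemma diff_one {A B : Type*} [AddCommGroup A] [AddCommGroup B] (i : A →+ B) : diff i 1 = 0 :=
  der_one _ _

lemma tensorMap_snd_diff {A B D : Type u} [AddCommGroup A] [AddCommGroup B] [Module ℤ B]
    [AddCommGroup D] [Module ℤ D] (f : A →+ B) (g : B →ₗ[ℤ] D) (h : ∀ a, g (f a) = 0)
    (x : TensorAlgebra ℤ (A × B)) :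
    tensorMap g (tmap (AddMonoidHom.snd A B) (diff f x)) = 0 := by
  induction x using tensor_induction with
  | one => rw [diff_one, map_zero, map_zero]
  | ι v =>
    rw [diff_ι, tmap_ι, ← tmap_eq_tensorMap, tmap_ι]
    change tι (g (f v.1)) = 0
    rw [h, map_zero]
  | mul x y hx hy =>
    rw [diff_mul, map_add, map_add, map_mul, map_mul, map_mul, map_mul, hx, hy, zero_mul, mul_zero,
      add_zero]
  | add x y hx hy => rw [map_add, map_add, map_add, hx, hy, add_zero]
  | neg x hx => rw [map_neg, map_neg, map_neg, hx, neg_zero]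

lemma bdIncl_comp_lieGrAugment (p : ℕ) : bdIncl.{u} p 0 ≫ lieGrAugment p = 0 := by
  ext S x
  obtain ⟨_, y, hy, rfl⟩ := x
  exact Subtype.ext (tensorMap_snd_diff S.f.hom.toAddMonoidHom S.g.hom
    (fun a => ConcreteCategory.congr_hom S.zero a) y)

/-- Exactness of the Koszul complex in the degree k + 1, stated by means of its boundaries. -/
lemma IsProjSES.bd_shortExact (hS : IsProjSES S) {p : ℕ} (hp : p.Prime) (k : ℕ) :
    (ShortComplex.mk ((bdIncl p (k + 1)).app S) ((lieGrD p k).app S)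
      (congr_app (bdIncl_comp_lieGrD p k) S)).ShortExact := by
  refine ShortComplex.ShortExact.mk' ?_ ?_ ?_
  · rw [ShortComplex.moduleCat_exact_iff]
    intro x hx
    exact ⟨⟨x.1, hS.mem_boundaries hp (congrArg Subtype.val hx)⟩, rfl⟩
  · rw [ModuleCat.mono_iff_injective]
    exact injective_of_val_eq Subtype.val_injective (b := Subtype.val) fun _ => rfl
  · rw [ModuleCat.epi_iff_surjective]
    rintro ⟨_, y, hy, rfl⟩
    exact ⟨⟨y, hy⟩, rfl⟩

lemma exists_augment_eq {A B D : Type u} [AddCommGroup A] [AddCommGroup B] [Module ℤ B]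
    [AddCommGroup D] [Module ℤ D] (g : B →ₗ[ℤ] D) (t : D →ₗ[ℤ] B) (h : ∀ d, g (t d) = d) {p : ℕ}
    (y : lieComponent p D) : ∃ x, LieGr.augment (A := A) p g x = y := by
  refine ⟨⟨_, tmap_inr_mem (lieComponent_map p t _ y.2)⟩, Subtype.ext ?_⟩
  change tensorMap g (tmap (AddMonoidHom.snd A B) (tmap (AddMonoidHom.inr A B) (tensorMap t y.1))) =
    y.1
  rw [← tmap_eq_tensorMap, ← tmap_eq_tensorMap, tmap_tmap, tmap_tmap, tmap_tmap]
  refine Eq.trans ?_ (tmap_id_apply y.1)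
  congr 2
  exact AddMonoidHom.ext h

/-- As 1 - f r = t g, the map induced by `kerProj` factors through the augmentation. Hence the
kernel of the augmentation consists of cycles. -/
lemma mem_cycles_of_augment_eq_zero {A B D : Type u} [AddCommGroup A] [AddCommGroup B] [Module ℤ B]
    [AddCommGroup D] [Module ℤ D] (f : A →+ B) (g : B →ₗ[ℤ] D) (r : B →+ A) (t : D →ₗ[ℤ] B)
    (h : ∀ b, b - f (r b) = t (g b)) {p : ℕ} (x : LieGr A B p 0)
    (hx : LieGr.augment p g x = 0) : x.1 ∈ cycles f r p 0 := by
  refine mem_cycles.mpr ⟨x.2, diff_eq_zero f x.2, ?_⟩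
  replace hx : tensorMap g (tmap (AddMonoidHom.snd A B) x.1) = 0 := congrArg Subtype.val hx
  have e : tmap (kerProj f r) x.1 = tmap (AddMonoidHom.inr A B) (tensorMap t
      (tensorMap g (tmap (AddMonoidHom.snd A B) x.1))) := by
    rw [← tmap_eq_tensorMap, ← tmap_eq_tensorMap, tmap_tmap, tmap_tmap, tmap_tmap]
    congr 2
    exact AddMonoidHom.ext fun v => (kerProj_apply f r v).trans (Prod.ext rfl (h v.2))
  rw [e, hx, map_zero, map_zero]

lemma IsProjSES.augment_shortExact (hS : IsProjSES S) {p : ℕ} (hp : p.Prime) :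
    (ShortComplex.mk ((bdIncl p 0).app S) ((lieGrAugment p).app S)
      (congr_app (bdIncl_comp_lieGrAugment p) S)).ShortExact := by
  obtain ⟨r, t, hr, ht, hrt⟩ := hS.exists_splitting
  refine ShortComplex.ShortExact.mk' ?_ ?_ ?_
  · rw [ShortComplex.moduleCat_exact_iff]
    intro x hx
    have := hS.proj₁
    obtain ⟨j, q, hq⟩ := exists_retract_finsupp S.X₁
    exact ⟨⟨x.1, cycles_le_boundaries hp (r := r) hr j q hq _
      (mem_cycles_of_augment_eq_zero _ S.g.hom r t hrt x hx)⟩, rfl⟩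
  · rw [ModuleCat.mono_iff_injective]
    exact injective_of_val_eq Subtype.val_injective (b := Subtype.val) fun _ => rfl
  · rw [ModuleCat.epi_iff_surjective]
    exact exists_augment_eq S.g.hom t ht

/-- At the top degree p there are no boundaries, since the degree cannot exceed the weight; so
exactness there means injectivity of the differential. -/
lemma lieGrD_bijective {A B : Type u} [AddCommGroup A] [AddCommGroup B] {p k : ℕ} {f : A →+ B}
    (h : ∀ x : LieGr A B p (k + 1), diff f x.1 = 0 → x.1 ∈ boundaries f p (k + 1))
    (hp : p = k + 1) : Function.Bijective (LieGr.d p k f) := by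
  refine ⟨(injective_iff_map_eq_zero _).mpr fun x hx => ?_, ?_⟩
  · obtain ⟨y, hy, e⟩ := h x (congrArg Subtype.val hx)
    rw [SetLike.mem_coe, lieSpan_eq_bot (by omega), AddSubgroup.mem_bot] at hy
    refine Subtype.ext (e.symm.trans ?_)
    rw [hy, map_zero]
    rfl
  · rintro ⟨_, y, hy, rfl⟩
    exact ⟨⟨y, hy⟩, rfl⟩

lemma isIso_of_bijective {X Y : Ab.{u}} (f : X ⟶ Y) (h : Function.Bijective f.hom) : IsIso f :=
  (ConcreteCategory.isIso_iff_bijective f).mpr h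

lemma IsProjSES.isIso_lieGrD (hS : IsProjSES S) {p k : ℕ} (hp : p.Prime) (hk : p = k + 1) :
    IsIso ((lieGrD p k).app S) :=
  isIso_of_bijective _ (lieGrD_bijective (fun _ hx => hS.mem_boundaries hp hx) hk)

lemma IsProjSES.isIso_superLieToGr (hS : IsProjSES S) {p : ℕ} (hp : p.Prime) :
    IsIso ((superLieToGr p).app S) := by
  have := hS.proj₁
  obtain ⟨j, q, hq⟩ := exists_retract_finsupp S.X₁
  refine isIso_of_bijective _ ⟨?_, fun x => ?_⟩
  · exact injective_of_val_eq (FreeGLRS.toT_injective (B := S.X₂) hp j q hq) (b := Subtype.val)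
      fun _ => rfl
  · obtain ⟨y, hy⟩ := FreeGLRS.exists_toT_eq x.2
    exact ⟨y, Subtype.ext hy⟩

end Functors

/-! ### Shifts from short exact sequences with zero middle term -/

section Step

variable {J : Type*} [Category* J] {C : Type*} [Category* C] [Abelian C]

lemma shortExact_of_isZero {S : ShortComplex C} (h₁ : IsZero S.X₁) (h₂ : IsZero S.X₂)
    (h₃ : IsZero S.X₃) : S.ShortExact where
  exact := S.exact_of_isZero_X₂ h₂
  mono_f := ⟨fun _ _ _ => h₁.eq_of_tgt _ _⟩
  epi_g := ⟨fun _ _ _ => h₃.eq_of_src _ _⟩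

lemma extend_shortExact {S : ShortComplex (ChainComplex C ℕ)}
    (h : ∀ n, (S.map (HomologicalComplex.eval C _ n)).ShortExact) :
    (S.map (ComplexShape.embeddingDownNat.extendFunctor C)).ShortExact := by
  refine HomologicalComplex.shortExact_of_degreewise_shortExact _ fun i => ?_
  by_cases hi : ∃ n, ComplexShape.embeddingDownNat.f n = i
  · obtain ⟨n, hn⟩ := hi
    refine ShortComplex.shortExact_of_iso (ShortComplex.isoMk
      (HomologicalComplex.extendXIso S.X₁ _ hn).symm (HomologicalComplex.extendXIso S.X₂ _ hn).symm
      (HomologicalComplex.extendXIso S.X₃ _ hn).symm ?_ ?_) (h n)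
    · exact ((Iso.inv_comp_eq _).mpr (HomologicalComplex.extendMap_f S.f _ hn))
    · exact ((Iso.inv_comp_eq _).mpr (HomologicalComplex.extendMap_f S.g _ hn))
  · push Not at hi
    exact shortExact_of_isZero (S.X₁.isZero_extend_X _ i hi) (S.X₂.isZero_extend_X _ i hi)
      (S.X₃.isZero_extend_X _ i hi)

variable [HasDerivedCategory.{w} C]

/-- A functorial short exact sequence of complexes, the middle term of which vanishes in the derived
category, induces an isomorphism with a shift. -/
noncomputable def shiftIsoOfShortExact {X Y Z : J ⥤ CochainComplex C ℤ} (f : X ⟶ Y) (g : Y ⟶ Z)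
    (w : ∀ j, f.app j ≫ g.app j = 0) (h : ∀ j, (ShortComplex.mk (f.app j) (g.app j) (w j)).ShortExact)
    (hY : ∀ j, IsZero (DerivedCategory.Q.obj (Y.obj j))) :
    Z ⋙ DerivedCategory.Q ≅ X ⋙ DerivedCategory.Q ⋙ shiftFunctor (DerivedCategory C) (1 : ℤ) :=
  -- In the distinguished triangle X → Y → Z → X[1] the object Y is zero, so the connecting
  -- morphism, natural in the sequence, is invertible.
  have (j : J) : IsIso (DerivedCategory.triangleOfSESδ (h j)) :=
    (Pretriangulated.Triangle.isZero₂_iff_isIso₃ _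
      (DerivedCategory.triangleOfSES_distinguished (h j))).mp (hY j)
  NatIso.ofComponents (fun j => asIso (DerivedCategory.triangleOfSESδ (h j))) fun {j j'} φ =>
    (DerivedCategory.triangleOfSESδ_naturality (h j) (h j')
      { τ₁ := X.map φ
        τ₂ := Y.map φ
        τ₃ := Z.map φ
        comm₁₂ := f.naturality φ
        comm₂₃ := g.naturality φ }).symm

lemma isZero_extend_of_homotopy {K : ChainComplex C ℕ} (h : Homotopy (𝟙 K) 0) :
    IsZero (DerivedCategory.Q.obj
      ((ComplexShape.embeddingDownNat.extendFunctor C).obj K)) := by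
  have h' : Homotopy ((ComplexShape.embeddingDownNat.extendFunctor C).map (𝟙 K))
      ((ComplexShape.embeddingDownNat.extendFunctor C).map 0) :=
    h.extend ComplexShape.embeddingDownNat
  rw [IsZero.iff_id_eq_zero, ← DerivedCategory.Q.map_id, ← CategoryTheory.Functor.map_id,
    DerivedCategory.Q_map_eq_of_homotopy (C := C) h', Functor.map_zero, Functor.map_zero]

end Step

/-! ### Décalage for simplicial short exact sequences with contractible middle term -/

section Simplicial

open AlgebraicTopology

/-- The complex attached to a functor on short complexes and to a simplicial short complex. -/
noncomputable def evalCpx : (ShortComplex Ab.{u} ⥤ Ab.{u}) ⥤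
    SimplicialObject (ShortComplex Ab.{u}) ⥤ CochainComplex Ab.{u} ℤ :=
  SimplicialObject.whiskering _ _ ⋙ (Functor.whiskeringRight _ _ _).obj
    (alternatingFaceMapComplex Ab.{u} ⋙ ComplexShape.embeddingDownNat.extendFunctor Ab.{u})

/-- The terms of the alternating face map complex are the values of the functors themselves, so
exactness is checked in each simplicial degree. -/
lemma evalCpx_shortExact {F G H : ShortComplex Ab.{u} ⥤ Ab.{u}} {f : F ⟶ G} {g : G ⟶ H}
    (w : f ≫ g = 0) (W : SimplicialObject (ShortComplex Ab.{u}))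
    (h : ∀ n, (ShortComplex.mk (f.app (W.obj n)) (g.app (W.obj n)) (congr_app w _)).ShortExact) :
    ∃ w', (ShortComplex.mk ((evalCpx.map f).app W) ((evalCpx.map g).app W) w').ShortExact := by
  let S : ShortComplex (ChainComplex Ab.{u} ℕ) :=
    { X₁ := (alternatingFaceMapComplex Ab).obj (((SimplicialObject.whiskering _ _).obj F).obj W)
      X₂ := (alternatingFaceMapComplex Ab).obj (((SimplicialObject.whiskering _ _).obj G).obj W)
      X₃ := (alternatingFaceMapComplex Ab).obj (((SimplicialObject.whiskering _ _).obj H).obj W)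
      f := (alternatingFaceMapComplex Ab).map (((SimplicialObject.whiskering _ _).map f).app W)
      g := (alternatingFaceMapComplex Ab).map (((SimplicialObject.whiskering _ _).map g).app W)
      zero := HomologicalComplex.hom_ext _ _ fun n => congr_app w _ }
  have hS := extend_shortExact (S := S) fun n => h (op (.mk n))
  exact ⟨_, hS⟩

/-- The homotopy on a pair of simplicial objects, which is constant on the first one. -/
def pairHomotopy (W : SimplicialObject (ShortComplex Ab.{u}))
    (H : SimplicialObject.Homotopy (𝟙 (((SimplicialObject.whiskering _ _).obj
      ShortComplex.π₂).obj W)) 0) :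
    SimplicialObject.Homotopy (𝟙 (((SimplicialObject.whiskering _ _).obj
      (ShortComplex.π₁.prod' ShortComplex.π₂)).obj W))
      { app := fun n => Prod.mkHom (𝟙 (W.obj n).X₁) (0 : (W.obj n).X₂ ⟶ (W.obj n).X₂)
        naturality := fun _ _ _ => Prod.ext ((Category.comp_id _).trans (Category.id_comp _).symm)
          (comp_zero.trans zero_comp.symm) } :=
  let R := SimplicialObject.Homotopy.refl (𝟙 (((SimplicialObject.whiskering _ _).obj
      ShortComplex.π₁).obj W))
  { h := fun i => Prod.mkHom (R.h i) (H.h i)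
    h_zero_comp_δ_zero := fun n => Prod.ext (R.h_zero_comp_δ_zero n) (H.h_zero_comp_δ_zero n)
    h_last_comp_δ_last := fun n => Prod.ext (R.h_last_comp_δ_last n) (H.h_last_comp_δ_last n)
    h_succ_comp_δ_castSucc_of_lt := fun i j h => Prod.ext
      (R.h_succ_comp_δ_castSucc_of_lt i j h) (H.h_succ_comp_δ_castSucc_of_lt i j h)
    h_succ_comp_δ_castSucc_succ := fun j => Prod.ext
      (R.h_succ_comp_δ_castSucc_succ j) (H.h_succ_comp_δ_castSucc_succ j)
    h_castSucc_comp_δ_succ_of_lt := fun i j h => Prod.ext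
      (R.h_castSucc_comp_δ_succ_of_lt i j h) (H.h_castSucc_comp_δ_succ_of_lt i j h)
    h_comp_σ_castSucc_of_le := fun i j h => Prod.ext
      (R.h_comp_σ_castSucc_of_le i j h) (H.h_comp_σ_castSucc_of_le i j h)
    h_comp_σ_succ_of_lt := fun i j h => Prod.ext
      (R.h_comp_σ_succ_of_lt i j h) (H.h_comp_σ_succ_of_lt i j h) }

lemma lieGrPair_map_zero {p k : ℕ} (h : k < p) {A A' B B' : Ab.{u}} (f : A ⟶ A') :
    (lieGrPair p k).map (Prod.mkHom f (0 : B ⟶ B')) = 0 :=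
  ModuleCat.hom_ext (LinearMap.ext fun x : LieGr A B p k =>
    DFunLike.congr_fun (LieGr.map_zero h f.hom.toAddMonoidHom) x)

/-- A contraction of B gives a simplicial homotopy on pairs from the identity to (1, 0). It survives
the nonadditive functor `lieGrPair`, which sends (1, 0) to zero for k < p. -/
lemma nonempty_lieGr_homotopy {p k : ℕ} (h : k < p) (W : SimplicialObject (ShortComplex Ab.{u}))
    (H : SimplicialObject.Homotopy (𝟙 (((SimplicialObject.whiskering _ _).obj
      ShortComplex.π₂).obj W)) 0) :
    Nonempty (Homotopy (𝟙 ((alternatingFaceMapComplex Ab).obj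
      (((SimplicialObject.whiskering _ _).obj (lieGrFunctor p k)).obj W))) 0) := by
  have H' := ((pairHomotopy W H).whiskerRight (lieGrPair p k)).toChainHomotopy
  refine ⟨(Homotopy.ofEq ?_).trans (H'.trans (Homotopy.ofEq ?_))⟩
  · exact HomologicalComplex.hom_ext _ _ fun n => ((lieGrPair p k).map_id _).symm
  · exact HomologicalComplex.hom_ext _ _ fun n => lieGrPair_map_zero h _

/-- The simplicial short complexes which are degreewise short exact with projective outer terms, and
the middle term of which is contractible. -/
def contractibleSES : ObjectProperty (SimplicialObject (ShortComplex Ab.{u})) := fun W =>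
  (∀ n, IsProjSES (W.obj n)) ∧ Nonempty (SimplicialObject.Homotopy
    (𝟙 (((SimplicialObject.whiskering _ _).obj ShortComplex.π₂).obj W)) 0)

variable [HasDerivedCategory.{w} Ab.{u}]

/-- The object of the derived category attached to a functor on short complexes and to a simplicial
short complex which is degreewise short exact with a contractible middle term. -/
noncomputable def evalDAb (F : ShortComplex Ab.{u} ⥤ Ab.{u}) :
    contractibleSES.{u}.FullSubcategory ⥤ DerivedCategory Ab.{u} :=
  (contractibleSES.ι ⋙ evalCpx.obj F) ⋙ DerivedCategory.Q

lemma isZero_evalDAb_lieGr {p k : ℕ} (h : k < p) (W : contractibleSES.{u}.FullSubcategory) :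
    IsZero ((evalDAb.{w} (lieGrFunctor p k)).obj W) := by
  obtain ⟨H⟩ := W.property.2
  obtain ⟨H'⟩ := nonempty_lieGr_homotopy h W.obj H
  exact isZero_extend_of_homotopy H'

lemma nonempty_evalDAb_shift_iso {p k : ℕ} (hk : k < p) {F G : ShortComplex Ab.{u} ⥤ Ab.{u}}
    (f : F ⟶ lieGrFunctor p k) (g : lieGrFunctor p k ⟶ G) (w : f ≫ g = 0)
    (h : ∀ S, IsProjSES S → (ShortComplex.mk (f.app S) (g.app S) (congr_app w _)).ShortExact) :
    Nonempty (evalDAb.{w} G ≅ evalDAb F ⋙ shiftFunctor _ (1 : ℤ)) := by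
  have key (W : contractibleSES.{u}.FullSubcategory) :=
    evalCpx_shortExact w W.obj fun n => h _ (W.property.1 n)
  exact ⟨shiftIsoOfShortExact (Functor.whiskerLeft _ (evalCpx.map f))
    (Functor.whiskerLeft _ (evalCpx.map g)) (fun W => (key W).1) (fun W => (key W).2)
    (isZero_evalDAb_lieGr hk)⟩

/-- Each step replaces the boundaries of degree m by those of degree m + 1 with one more shift. The
component crossed has degree less than p, hence vanishes in the derived category. -/
lemma nonempty_evalDAb_bd_iso {p : ℕ} (hp : p.Prime) (m : ℕ) (hm : m < p) (n : ℤ) (hn : n = m + 1) :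
    Nonempty (evalDAb.{w, u} (ShortComplex.π₃ ⋙ lieFunctor p) ≅
      evalDAb (bdFunctor p m) ⋙ shiftFunctor _ n) := by
  induction m generalizing n with
  | zero =>
    obtain rfl : n = 1 := hn
    exact nonempty_evalDAb_shift_iso hm _ _ (bdIncl_comp_lieGrAugment p)
      fun S hS => hS.augment_shortExact hp
  | succ m ih =>
    obtain ⟨e⟩ := ih (by omega) (m + 1) rfl
    obtain ⟨e'⟩ := nonempty_evalDAb_shift_iso hm _ _ (bdIncl_comp_lieGrD p m)
      fun S hS => hS.bd_shortExact hp m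
    exact ⟨e ≪≫ Functor.isoWhiskerRight e' _ ≪≫ Functor.associator _ _ _ ≪≫
      Functor.isoWhiskerLeft _ (shiftFunctorAdd' _ 1 (m + 1 : ℤ) n (by push_cast at hn; omega)).symm⟩

/-- An isomorphism of functors on the short exact sequences with projective outer terms induces an
isomorphism. -/
lemma nonempty_evalDAb_iso {F G : ShortComplex Ab.{u} ⥤ Ab.{u}} (f : F ⟶ G)
    (h : ∀ S, IsProjSES S → IsIso (f.app S)) : Nonempty (evalDAb.{w} F ≅ evalDAb G) := by
  have (W : contractibleSES.{u}.FullSubcategory) :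
      IsIso ((Functor.whiskerLeft contractibleSES.ι (evalCpx.map f)).app W) := by
    have (n : SimplexCategoryᵒᵖ) : IsIso ((((SimplicialObject.whiskering _ _).map f).app W.obj).app n) :=
      h _ (W.property.1 n)
    have : IsIso (((SimplicialObject.whiskering _ _).map f).app W.obj) :=
      NatIso.isIso_of_isIso_app _
    exact inferInstanceAs (IsIso ((alternatingFaceMapComplex Ab.{u} ⋙
      ComplexShape.embeddingDownNat.extendFunctor Ab.{u}).map
        (((SimplicialObject.whiskering _ _).map f).app W.obj)))
  have : IsIso (Functor.whiskerLeft contractibleSES.ι (evalCpx.map f)) :=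
    NatIso.isIso_of_isIso_app _
  exact ⟨Functor.isoWhiskerRight (asIso (Functor.whiskerLeft contractibleSES.ι (evalCpx.map f))) _⟩

/-- The p sequences end at the boundaries of degree p - 1. These are the component of degree p,
which is the super-Lie functor of the first term. -/
theorem nonempty_evalDAb_lie_iso {p : ℕ} (hp : p.Prime) :
    Nonempty (evalDAb.{w, u} (ShortComplex.π₃ ⋙ lieFunctor p) ≅
      evalDAb (ShortComplex.π₁ ⋙ superLieFunctor p) ⋙ shiftFunctor _ (p : ℤ)) := by
  obtain ⟨q, rfl⟩ := Nat.exists_eq_succ_of_ne_zero hp.ne_zero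
  obtain ⟨e⟩ := nonempty_evalDAb_bd_iso hp q (Nat.lt_succ_self q) (q.succ : ℤ) (by push_cast; rfl)
  obtain ⟨e'⟩ := nonempty_evalDAb_iso.{w} (lieGrD q.succ q) fun S hS => hS.isIso_lieGrD hp rfl
  obtain ⟨e''⟩ := nonempty_evalDAb_iso.{w} (superLieToGr q.succ) fun S hS =>
    hS.isIso_superLieToGr hp
  exact ⟨e ≪≫ Functor.isoWhiskerRight (e'' ≪≫ e').symm _⟩

end Simplicial

/-! ### The cone of the identity of a chain complex and the suspension -/

namespace Cone

open ZeroObject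

variable {C : Type*} [Category* C] [Abelian C]

section Biprod

variable {X₄ X₃ X₂ X₁ Y₃ Y₂ Y₁ : C}

/-- The differential of a cone in the degree `1`. -/
noncomputable def coneε (b : X₂ ⟶ X₁) : X₂ ⊞ X₁ ⟶ X₁ := biprod.fst ≫ b + biprod.snd

/-- The differential of a cone. -/
noncomputable def coneδ (a : X₃ ⟶ X₂) (b : X₂ ⟶ X₁) : X₃ ⊞ X₂ ⟶ X₂ ⊞ X₁ :=
  biprod.lift (coneε a) (biprod.snd ≫ (-b))

lemma inl_coneε (b : X₂ ⟶ X₁) : biprod.inl ≫ coneε b = b := by simp [coneε]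

lemma inr_coneε (b : X₂ ⟶ X₁) : biprod.inr ≫ coneε b = 𝟙 X₁ := by simp [coneε]

lemma coneδ_coneε (a : X₃ ⟶ X₂) (b : X₂ ⟶ X₁) (h : a ≫ b = 0) : coneδ a b ≫ coneε b = 0 := by
  simp [coneδ, coneε, h]

lemma coneδ_coneδ (a : X₄ ⟶ X₃) (b : X₃ ⟶ X₂) (c : X₂ ⟶ X₁) (h : a ≫ b = 0) (h' : b ≫ c = 0) :
    coneδ a b ≫ coneδ b c = 0 := by
  refine biprod.hom_ext _ _ ?_ ?_
  · simpa [coneδ] using coneδ_coneε a b h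
  · simp [coneδ, h']

lemma inl_coneδ (a : X₃ ⟶ X₂) (b : X₂ ⟶ X₁) : biprod.inl ≫ coneδ a b = a ≫ biprod.inl := by
  refine biprod.hom_ext _ _ ?_ ?_ <;> simp [coneδ, coneε]

lemma coneδ_snd (a : X₃ ⟶ X₂) (b : X₂ ⟶ X₁) :
    coneδ a b ≫ biprod.snd = biprod.snd ≫ (-b) := by
  simp [coneδ]

lemma map_coneε {b : X₂ ⟶ X₁} {b' : Y₂ ⟶ Y₁} {f₂ : X₂ ⟶ Y₂} {f₁ : X₁ ⟶ Y₁}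
    (h : f₂ ≫ b' = b ≫ f₁) : biprod.map f₂ f₁ ≫ coneε b' = coneε b ≫ f₁ := by
  simp [coneε, h]

lemma map_coneδ {a : X₃ ⟶ X₂} {a' : Y₃ ⟶ Y₂} {b : X₂ ⟶ X₁} {b' : Y₂ ⟶ Y₁} {f₃ : X₃ ⟶ Y₃}
    {f₂ : X₂ ⟶ Y₂} {f₁ : X₁ ⟶ Y₁} (h : f₃ ≫ a' = a ≫ f₂) (h' : f₂ ≫ b' = b ≫ f₁) :
    biprod.map f₃ f₂ ≫ coneδ a' b' = coneδ a b ≫ biprod.map f₂ f₁ := by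
  refine biprod.hom_ext _ _ ?_ ?_
  · simpa [coneδ] using map_coneε h
  · simp [coneδ, h']

/-- The contraction moves the first summand of the cone to the second summand one degree higher. The
degree 1 is separate since the cone has a single summand in degree 0. -/
lemma cone_homotopy_zero (a : X₃ ⟶ X₂) (b : X₂ ⟶ X₁) :
    𝟙 (X₂ ⊞ X₁) = coneε b ≫ biprod.inr + (biprod.fst ≫ biprod.inr) ≫ coneδ a b := by
  refine biprod.hom_ext _ _ ?_ ?_ <;> simp [coneδ, coneε]

lemma cone_homotopy_succ (a : X₄ ⟶ X₃) (b : X₃ ⟶ X₂) (c : X₂ ⟶ X₁) :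
    𝟙 (X₃ ⊞ X₂) = coneδ b c ≫ biprod.fst ≫ biprod.inr +
      (biprod.fst ≫ biprod.inr) ≫ coneδ a b := by
  refine biprod.hom_ext _ _ ?_ ?_ <;> simp [coneδ, coneε]

end Biprod

variable (P : ChainComplex C ℕ)

/-- The terms of the cone of the identity. -/
noncomputable def coneX : ℕ → C
  | 0 => P.X 0
  | n + 1 => P.X (n + 1) ⊞ P.X n

/-- The differentials of the cone of the identity. -/
noncomputable def coneD : ∀ n, coneX P (n + 1) ⟶ coneX P n
  | 0 => coneε (P.d 1 0)
  | n + 1 => coneδ (P.d (n + 2) (n + 1)) (P.d (n + 1) n)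

lemma coneD_comp (n : ℕ) : coneD P (n + 1) ≫ coneD P n = 0 := by
  cases n with
  | zero => exact coneδ_coneε _ _ (P.d_comp_d _ _ _)
  | succ n => exact coneδ_coneδ _ _ _ (P.d_comp_d _ _ _) (P.d_comp_d _ _ _)

/-- The cone of the identity. -/
noncomputable def cone : ChainComplex C ℕ := ChainComplex.of (coneX P) (coneD P) (coneD_comp P)

/-- The terms of the suspension. -/
noncomputable def suspX : ℕ → C
  | 0 => 0
  | n + 1 => P.X n

/-- The differentials of the suspension. -/
noncomputable def suspD : ∀ n, suspX P (n + 1) ⟶ suspX P n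
  | 0 => 0
  | n + 1 => -P.d (n + 1) n

lemma suspD_comp (n : ℕ) : suspD P (n + 1) ≫ suspD P n = 0 := by
  cases n with
  | zero => exact comp_zero
  | succ n =>
    have h : (-P.d (n + 2) (n + 1)) ≫ (-P.d (n + 1) n) = 0 := by simp
    exact h

/-- The suspension. -/
noncomputable def susp : ChainComplex C ℕ := ChainComplex.of (suspX P) (suspD P) (suspD_comp P)

lemma cone_d (n : ℕ) : (cone P).d (n + 1) n = coneD P n := ChainComplex.of_d _ _ _

lemma susp_d (n : ℕ) : (susp P).d (n + 1) n = suspD P n := ChainComplex.of_d _ _ _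

/-- The terms of the inclusion into the cone. -/
noncomputable def inclF : ∀ n, P.X n ⟶ coneX P n
  | 0 => 𝟙 _
  | _ + 1 => biprod.inl

/-- The inclusion into the cone. -/
noncomputable def incl : P ⟶ cone P := ChainComplex.ofHom (inclF P) fun n => by
  rw [cone_d]
  cases n with
  | zero => exact (inl_coneε _).trans (Category.comp_id _).symm
  | succ n => exact inl_coneδ _ _

/-- The terms of the projection to the suspension. -/
noncomputable def projF : ∀ n, coneX P n ⟶ suspX P n
  | 0 => 0
  | _ + 1 => biprod.snd

/-- The projection to the suspension. -/
noncomputable def proj : cone P ⟶ susp P := ChainComplex.ofHom (projF P) fun n => by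
  rw [cone_d, susp_d]
  cases n with
  | zero => exact comp_zero.trans comp_zero.symm
  | succ n => exact (coneδ_snd _ _).symm

lemma incl_comp_proj : incl P ≫ proj P = 0 := by
  refine HomologicalComplex.hom_ext _ _ fun n => ?_
  cases n with
  | zero => exact comp_zero
  | succ n => exact biprod.inl_snd

variable {P} {P' : ChainComplex C ℕ} (φ : P ⟶ P')

/-- The functoriality of the terms of the cone. -/
noncomputable def coneMapF : ∀ n, coneX P n ⟶ coneX P' n
  | 0 => φ.f 0
  | n + 1 => biprod.map (φ.f (n + 1)) (φ.f n)

/-- The functoriality of the cone. -/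
noncomputable def coneMap : cone P ⟶ cone P' := ChainComplex.ofHom (coneMapF φ) fun n => by
  rw [cone_d, cone_d]
  cases n with
  | zero => exact map_coneε (φ.comm _ _)
  | succ n => exact map_coneδ (φ.comm _ _) (φ.comm _ _)

/-- The functoriality of the terms of the suspension. -/
noncomputable def suspMapF : ∀ n, suspX P n ⟶ suspX P' n
  | 0 => 0
  | n + 1 => φ.f n

/-- The functoriality of the suspension. -/
noncomputable def suspMap : susp P ⟶ susp P' := ChainComplex.ofHom (suspMapF φ) fun n => by
  rw [susp_d, susp_d]
  cases n with
  | zero => exact comp_zero.trans zero_comp.symm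
  | succ n =>
    have h : φ.f (n + 1) ≫ (-P'.d (n + 1) n) = (-P.d (n + 1) n) ≫ φ.f n := by simp
    exact h

/-- The degreewise split short exact sequence `P ⟶ cone P ⟶ susp P`. -/
noncomputable def coneSES : ChainComplex C ℕ ⥤ ShortComplex (ChainComplex C ℕ) where
  obj P := ShortComplex.mk (incl P) (proj P) (incl_comp_proj P)
  map φ :=
    { τ₁ := φ
      τ₂ := coneMap φ
      τ₃ := suspMap φ
      comm₁₂ := HomologicalComplex.hom_ext _ _ fun n => by
        cases n with
        | zero => exact (Category.comp_id _).trans (Category.id_comp _).symm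
        | succ n => exact (biprod.inl_map _ _).symm
      comm₂₃ := HomologicalComplex.hom_ext _ _ fun n => by
        cases n with
        | zero => exact comp_zero.trans zero_comp.symm
        | succ n => exact biprod.map_snd _ _ }
  map_id P := by
    refine ShortComplex.hom_ext _ _ rfl ?_ ?_
    · refine HomologicalComplex.hom_ext _ _ fun n => ?_
      cases n with
      | zero => rfl
      | succ n =>
        have h {X Y : C} : biprod.map (𝟙 X) (𝟙 Y) = 𝟙 (X ⊞ Y) := by
          refine biprod.hom_ext _ _ ?_ ?_ <;> simp
        exact h
    · refine HomologicalComplex.hom_ext _ _ fun n => ?_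
      cases n with
      | zero => exact (isZero_zero C).eq_of_src _ _
      | succ n => rfl
  map_comp φ ψ := by
    refine ShortComplex.hom_ext _ _ rfl ?_ ?_
    · refine HomologicalComplex.hom_ext _ _ fun n => ?_
      cases n with
      | zero => rfl
      | succ n =>
        have h {X₁ X₂ Y₁ Y₂ Z₁ Z₂ : C} (f₁ : X₁ ⟶ Y₁) (f₂ : X₂ ⟶ Y₂) (g₁ : Y₁ ⟶ Z₁)
            (g₂ : Y₂ ⟶ Z₂) : biprod.map (f₁ ≫ g₁) (f₂ ≫ g₂) =
              biprod.map f₁ f₂ ≫ biprod.map g₁ g₂ := by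
          refine biprod.hom_ext _ _ ?_ ?_ <;> simp
        exact h _ _ _ _
    · refine HomologicalComplex.hom_ext _ _ fun n => ?_
      cases n with
      | zero => exact (isZero_zero C).eq_of_src _ _
      | succ n => rfl

lemma projective_susp (h : ∀ n, Projective (P.X n)) (n : ℕ) : Projective ((susp P).X n) := by
  cases n with
  | zero => exact inferInstanceAs (Projective (0 : C))
  | succ n => exact h n

variable (P)

lemma coneSES_shortExact_eval (n : ℕ) :
    ((coneSES.obj P).map (HomologicalComplex.eval C _ n)).ShortExact := by
  cases n with
  | zero =>
    have : IsIso ((coneSES.obj P).map (HomologicalComplex.eval C _ 0)).f :=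
      inferInstanceAs (IsIso (𝟙 (P.X 0)))
    exact (ShortComplex.Splitting.ofIsIsoOfIsZero _ this (isZero_zero C)).shortExact
  | succ n => exact (ShortComplex.Splitting.ofHasBinaryBiproduct (P.X (n + 1)) (P.X n)).shortExact

lemma coneSES_shortExact : (coneSES.obj P).ShortExact :=
  HomologicalComplex.shortExact_of_degreewise_shortExact _ (coneSES_shortExact_eval P)

/-- The terms of the contraction of the cone. -/
noncomputable def contractionF : ∀ n, (cone P).X n ⟶ (cone P).X (n + 1)
  | 0 => (biprod.inr : P.X 0 ⟶ P.X 1 ⊞ P.X 0)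
  | n + 1 => (biprod.fst ≫ biprod.inr : P.X (n + 1) ⊞ P.X n ⟶ P.X (n + 2) ⊞ P.X (n + 1))

/-- The components of the contraction of the cone. -/
noncomputable def contractionHom (i j : ℕ) : (cone P).X i ⟶ (cone P).X j :=
  if h : i + 1 = j then contractionF P i ≫ eqToHom (by rw [h]) else 0

lemma contractionHom_succ (i : ℕ) : contractionHom P i (i + 1) = contractionF P i :=
  (dif_pos rfl).trans (Category.comp_id _)

/-- The contraction of the cone. -/
noncomputable def contraction : Homotopy (𝟙 (cone P)) 0 where
  hom := contractionHom P
  zero _ _ h := dif_neg h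
  comm n := by
    rw [Homotopy.prevD_chainComplex, contractionHom_succ]
    cases n with
    | zero =>
      rw [Homotopy.dNext_zero_chainComplex, cone_d]
      have h : 𝟙 (P.X 0) = 0 + biprod.inr ≫ coneε (P.d 1 0) + 0 := by
        rw [inr_coneε, zero_add, add_zero]
      exact h
    | succ n =>
      rw [Homotopy.dNext_succ_chainComplex, contractionHom_succ, cone_d, cone_d, HomologicalComplex.zero_f, add_zero]
      cases n with
      | zero => exact cone_homotopy_zero _ _
      | succ n => exact cone_homotopy_succ _ _ _

end Cone

lemma projective_sigma {B : Type*} [Category* B] {I : Type*} {g : I → B} [HasCoproduct g]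
    (h : ∀ i, Projective (g i)) :
    Projective (∐ g) where
  factors f e _ := ⟨Sigma.desc fun b => Projective.factorThru (Sigma.ι g b ≫ f) e,
    Sigma.hom_ext _ _ fun b => by
      rw [← Category.assoc, Sigma.ι_desc, Projective.factorThru_comp]⟩

/-! ### The Dold–Kan correspondence: projectivity, exactness and homotopies -/

section DoldKan

open AlgebraicTopology AlgebraicTopology.DoldKan

variable {A : Type*} [Category* A] [Abelian A]

instance : (Abelian.DoldKan.Γ (A := A)).IsEquivalence :=
  inferInstanceAs (Abelian.DoldKan.equivalence (A := A)).inverse.IsEquivalence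

/-- Each term of the simplicial object is a coproduct of terms of K. -/
lemma projective_Γ {K : ChainComplex A ℕ} (hK : ∀ n, Projective (K.X n)) (Δ : SimplexCategoryᵒᵖ) :
    Projective ((Abelian.DoldKan.Γ.obj K).obj Δ) :=
  projective_sigma (g := fun i : SimplicialObject.Splitting.IndexSet Δ => K.X i.1.unop.len)
    fun _ => hK _

lemma shortExact_Γ {S : ShortComplex (ChainComplex A ℕ)} (hS : S.ShortExact)
    (Δ : SimplexCategoryᵒᵖ) :
    ((S.map Abelian.DoldKan.Γ).map ((evaluation SimplexCategoryᵒᵖ A).obj Δ)).ShortExact :=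
  (hS.map_of_exact Abelian.DoldKan.Γ).map_of_exact _

lemma nonempty_Γ_homotopy {K L : ChainComplex A ℕ} {f g : K ⟶ L} (h : Homotopy f g) :
    Nonempty (SimplicialObject.Homotopy (Abelian.DoldKan.Γ.map f) (Abelian.DoldKan.Γ.map g)) := by
  let ε := (Abelian.DoldKan.equivalence (A := A)).counitIso
  have key (k : K ⟶ L) : (normalizedMooreComplex A).map (Abelian.DoldKan.Γ.map k) =
      ε.hom.app K ≫ k ≫ ε.inv.app L :=
    eq_conj (ε.hom.naturality k) (ε.hom_inv_id_app L)
  have h' : Homotopy ((normalizedMooreComplex A).map (Abelian.DoldKan.Γ.map g))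
      ((normalizedMooreComplex A).map (Abelian.DoldKan.Γ.map f)) := by
    rw [key f, key g]
    exact (h.symm.compRight _).compLeft _
  exact nonempty_simplicial_homotopy h'

variable (A) in
/-- The inclusion of the normalized complex becomes invertible in the derived category. -/
noncomputable def normalizedIso [HasDerivedCategory.{w} A] :
    normalizedMooreComplex A ⋙ ComplexShape.embeddingDownNat.extendFunctor A ⋙ DerivedCategory.Q ≅
      alternatingFaceMapComplex A ⋙ ComplexShape.embeddingDownNat.extendFunctor A ⋙
        DerivedCategory.Q :=
  have (X : SimplicialObject A) : IsIso (((Functor.whiskerRight (inclusionOfMooreComplex A)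
      (ComplexShape.embeddingDownNat.extendFunctor A ⋙ DerivedCategory.Q))).app X) := by
    have : QuasiIso (inclusionOfMooreComplexMap X) :=
      homotopyEquivNormalizedMooreComplexAlternatingFaceMapComplex.quasiIso_hom
    exact inferInstanceAs (IsIso (DerivedCategory.Q.map
      (HomologicalComplex.extendMap (inclusionOfMooreComplexMap X) ComplexShape.embeddingDownNat)))
  NatIso.ofComponents (fun X => asIso ((Functor.whiskerRight (inclusionOfMooreComplex A)
    (ComplexShape.embeddingDownNat.extendFunctor A ⋙ DerivedCategory.Q)).app X))
    fun f => (Functor.whiskerRight (inclusionOfMooreComplex A) _).naturality f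

end DoldKan

/-! ### Décalage for complexes of projectives -/

/-- The chain complexes of projective abelian groups in nonnegative degrees. -/
def projCpxProp : ObjectProperty (ChainComplex Ab.{u} ℕ) := fun P => ∀ n, Projective (P.X n)

/-- The category of the chain complexes of projective abelian groups in nonnegative degrees. -/
abbrev ProjCpx := (projCpxProp.{u}).FullSubcategory

/-- The suspension of complexes of projective abelian groups. -/
noncomputable def projSusp : ProjCpx.{u} ⥤ ProjCpx.{u} :=
  ObjectProperty.lift _ (projCpxProp.ι ⋙ Cone.coneSES ⋙ ShortComplex.π₃) fun P =>
    Cone.projective_susp P.property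

/-- The simplicial short complex corresponding to the cone of a complex. -/
noncomputable def simplicialCone : ProjCpx.{u} ⥤ contractibleSES.{u}.FullSubcategory :=
  ObjectProperty.lift _ (projCpxProp.ι ⋙ Cone.coneSES ⋙ Abelian.DoldKan.Γ.mapShortComplex ⋙
    (ShortComplex.functorEquivalence _ _).functor) fun P =>
    ⟨fun n =>
      { exact := shortExact_Γ (Cone.coneSES_shortExact P.obj) n
        proj₁ := projective_Γ P.property n
        proj₃ := projective_Γ (projSusp.obj P).property n }, by
      obtain ⟨H⟩ := nonempty_Γ_homotopy (Cone.contraction P.obj)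
      rw [Functor.map_zero, CategoryTheory.Functor.map_id] at H
      exact ⟨H⟩⟩

section Derived

variable [HasDerivedCategory.{w} Ab.{u}]

/-- The derived functor on complexes of projective abelian groups. -/
noncomputable def projDoldPuppe (F : Ab.{u} ⥤ Ab.{u}) : ProjCpx.{u} ⥤ DerivedCategory Ab.{u} :=
  projCpxProp.ι ⋙ doldPuppeComplex F ⋙ ComplexShape.embeddingDownNat.extendFunctor Ab.{u} ⋙
    DerivedCategory.Q

/-- The third term of `simplicialCone` is by construction the simplicial object of the suspension;
only the normalized complex has to be exchanged for the alternating one. -/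
lemma nonempty_projSusp_doldPuppe_iso (F : Ab.{u} ⥤ Ab.{u}) :
    Nonempty (projSusp ⋙ projDoldPuppe.{w} F ≅
      simplicialCone ⋙ evalDAb (ShortComplex.π₃ ⋙ F)) :=
  ⟨Functor.isoWhiskerLeft (projSusp ⋙ projCpxProp.ι ⋙ Abelian.DoldKan.Γ ⋙
    (SimplicialObject.whiskering Ab Ab).obj F) (normalizedIso Ab)⟩

lemma nonempty_projDoldPuppe_iso (F : Ab.{u} ⥤ Ab.{u}) :
    Nonempty (projDoldPuppe.{w} F ≅ simplicialCone ⋙ evalDAb (ShortComplex.π₁ ⋙ F)) :=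
  ⟨Functor.isoWhiskerLeft (projCpxProp.ι ⋙ Abelian.DoldKan.Γ ⋙
    (SimplicialObject.whiskering Ab Ab).obj F) (normalizedIso Ab)⟩

theorem nonempty_projDoldPuppe_lie_iso {p : ℕ} (hp : p.Prime) :
    Nonempty (projSusp ⋙ projDoldPuppe.{w, u} (lieFunctor p) ≅
      projDoldPuppe (superLieFunctor p) ⋙ shiftFunctor _ (p : ℤ)) := by
  obtain ⟨e⟩ := nonempty_projSusp_doldPuppe_iso.{w} (lieFunctor.{u} p)
  obtain ⟨e'⟩ := nonempty_projDoldPuppe_iso.{w} (superLieFunctor.{u} p)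
  obtain ⟨e''⟩ := nonempty_evalDAb_lie_iso.{w, u} hp
  exact ⟨e ≪≫ Functor.isoWhiskerLeft _ e'' ≪≫ Functor.isoWhiskerRight e'.symm _⟩

/-- The object of the derived category given by a complex of projective abelian groups. -/
noncomputable def projCpxToDAb : ProjCpx.{u} ⥤ DerivedCategory Ab.{u} :=
  (projCpxProp.ι ⋙ ComplexShape.embeddingDownNat.extendFunctor Ab.{u}) ⋙ DerivedCategory.Q

/-- The connecting morphism of P → cone P → susp P identifies the suspension with the shift, without
comparing complexes term by term. -/
lemma nonempty_projSusp_iso :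
    Nonempty (projSusp ⋙ projCpxToDAb.{w, u} ≅ projCpxToDAb ⋙ shiftFunctor _ (1 : ℤ)) := by
  let E := ComplexShape.embeddingDownNat.extendFunctor Ab.{u}
  let S := projCpxProp.{u}.ι ⋙ Cone.coneSES ⋙ E.mapShortComplex
  exact ⟨shiftIsoOfShortExact (X := S ⋙ ShortComplex.π₁) (Y := S ⋙ ShortComplex.π₂)
    (Z := S ⋙ ShortComplex.π₃) (Functor.whiskerLeft S ShortComplex.π₁Toπ₂)
    (Functor.whiskerLeft S ShortComplex.π₂Toπ₃) (fun P => (S.obj P).zero)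
    (fun P => extend_shortExact (Cone.coneSES_shortExact_eval P.obj))
    (fun P => isZero_extend_of_homotopy (Cone.contraction P.obj))⟩

end Derived

/-! ### Descent to the homotopy category and to connective objects -/

/-- The functor sending a complex to its homotopy class. -/
def toProjHtpy : ProjCpx.{u} ⥤ ProjHtpy.{u} :=
  ObjectProperty.lift _ (projCpxProp.ι ⋙ HomotopyCategory.quotient _ _) fun P => P.property

lemma toProjHtpy_map_surjective {P Q : ProjCpx.{u}} (φ : toProjHtpy.obj P ⟶ toProjHtpy.obj Q) :
    ∃ ψ, toProjHtpy.map ψ = φ := by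
  obtain ⟨ψ, hψ⟩ := (HomotopyCategory.quotient _ _).map_surjective φ.hom
  exact ⟨ObjectProperty.homMk ψ, ObjectProperty.hom_ext _ hψ⟩

/-- Natural isomorphisms descend from complexes to homotopy classes. -/
def isoOfToProjHtpyIso {D : Type*} [Category* D] {F G : ProjHtpy.{u} ⥤ D}
    (e : toProjHtpy ⋙ F ≅ toProjHtpy ⋙ G) : F ≅ G :=
  -- Both categories have the same objects and every homotopy class has a representative, so
  -- naturality is checked on chain maps.
  NatIso.ofComponents (fun P => e.app ⟨P.obj.as, P.property⟩) fun {P Q} φ => by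
    obtain ⟨ψ, rfl⟩ := toProjHtpy_map_surjective (P := ⟨P.obj.as, P.property⟩)
      (Q := ⟨Q.obj.as, Q.property⟩) φ
    exact e.hom.naturality ψ

lemma nonempty_connectiveShift_iso [HasDerivedCategory.{w} Ab.{u}] :
    Nonempty (projSusp ⋙ toProjHtpy ⋙ projToConnective.{w, u} ≅
      toProjHtpy ⋙ projToConnective ⋙ connectiveShift) := by
  obtain ⟨e⟩ := nonempty_projSusp_iso.{w, u}
  exact ⟨NatIso.ofComponents (fun P => ObjectProperty.isoMk _ (e.app P)) fun φ =>
    ObjectProperty.hom_ext _ (e.hom.naturality φ)⟩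

end LieDecalage

theorem mainTheorem4 [HasDerivedCategory.{w} LieDecalage.Ab.{u}] (p : ℕ) (hp : p.Prime) :
    Nonempty (LieDecalage.connectiveShift.{w, u} ⋙
        LieDecalage.derivedFunctor (LieDecalage.lieFunctor.{u} p) ≅
      LieDecalage.derivedFunctor (LieDecalage.superLieFunctor.{u} p) ⋙
        shiftFunctor (DerivedCategory LieDecalage.Ab.{u}) (p : ℤ)) := by
  open LieDecalage in
  obtain ⟨e⟩ := nonempty_connectiveShift_iso.{w, u}
  obtain ⟨e'⟩ := nonempty_projDoldPuppe_lie_iso.{w, u} hp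
  let E := projToConnective.{w, u}
  -- After precomposition with the equivalence E the statement concerns complexes of projectives:
  -- the shift becomes the suspension, and the unit of E cancels the choice of a resolution in
  -- `derivedFunctor`.
  have i : E ⋙ connectiveShift.{w, u} ⋙ derivedFunctor (lieFunctor.{u} p) ≅
      projProp.ι ⋙ doldPuppe (superLieFunctor.{u} p) ⋙ shiftFunctor _ (p : ℤ) :=
    isoOfToProjHtpyIso (Functor.isoWhiskerRight e.symm (derivedFunctor (lieFunctor.{u} p)) ≪≫
      Functor.isoWhiskerLeft (projSusp ⋙ toProjHtpy) (Functor.isoWhiskerRight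
        E.asEquivalence.unitIso.symm (projProp.ι ⋙ doldPuppe (lieFunctor.{u} p))) ≪≫ e')
  exact ⟨Functor.isoWhiskerRight E.asEquivalence.counitIso.symm
    (connectiveShift ⋙ derivedFunctor (lieFunctor p)) ≪≫ Functor.isoWhiskerLeft E.inv i⟩
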